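/- **Setting.** Let $\sigma\in\mathbb R$. For each $k\in\mathbb N$ let $P_k$ be a probability distribution on $X_k\times\mathbb R$ and $\phi_k:X_k\to\mathbb R^{p_k}$ a measurable feature map with square-integrable coordinates and positive definite $\Sigma_k=\mathbb E[\phi_k(x)\phi_k(x)^{\mathsf T}]$. The training data of stage $k$ are $n_k$ i.i.d. samples $(x_i,y_i)\sim P_k$; the data of all stages live on one probability space, with no relation prescribed between different stages. For a predictor $f$ let $\widehat R_n(f)=\frac1n\sum_i(y_i-f(x_i))^2$, $R(f)=\mathbb E(y-f(x))^2$ and $\mathcal E(f)=R(f)-\inf_g R(g)$. For $\tau\in[0,1]$ put $$\mathcal E_\star(\tau;n_k,p_k)=\inf\{\mathcal E(\beta^{\mathsf T}\phi_k):\ \beta\in\mathbb R^{p_k},\ \widehat R_{n_k}(\beta^{\mathsf T}\phi_k)\le\tau\sigma^2\}\in[0,\infty]$$ (a random variable, equal to $\infty$ when the constraint is infeasible). Consider the following assumptions. * **[MP]** with ratio $\gamma\in(0,\infty)$: $n_k$ is strictly increasing, $p_k\to\infty$, $n_k/p_k\to\gamma$, and almost surely the empirical spectral distribution of $G_k=\frac1{p_k}W_kW_k^{\mathsf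 T}$, where $W_k=\Phi_k\Sigma_k^{-1/2}$ and $\Phi_k$ has rows $\phi_k(x_i)^{\mathsf T}$, converges weakly to the Marchenko–Pastur law $(1-\frac1\gamma)_+\delta_0+\frac{1}{2\pi\gamma x}\sqrt{(b-x)(x-a)}\,\mathbf 1_{[a,b]}(x)\,dx$, with $a=(1-\sqrt\gamma)^2$ and $b=(1+\sqrt\gamma)^2$. * **[Lin]**: $y=\beta_{\star,k}^{\mathsf T}\phi_k(x)+\varepsilon$ under $P_k$, with $\varepsilon$ independent of $x$, of a law not depending on $k$, with $\mathbb E\varepsilon=0$, $\mathbb E\varepsilon^2=\sigma^2$ and $\mathbb E|\varepsilon|^{4+\eta}<\infty$ for some $\eta>0$. **Theorem (MP Lower Bound).** There is a function $\mathcal E_\star:\mathbb R\times\mathbb R\to[0,\infty]$, $(\tau,\gamma)\mapsto\mathcal E_\star(\tau,\gamma)$ (only its values at $\tau\in[0,1]$, $\gamma>0$ matter), depending only on $\sigma$, that is the limiting minimal excess error in the following sense. * For all $\tau\in[0,1]$ and $\gamma>0$, except where $\tau=1-\frac1\gamma>0$, and every sequence of problems satisfying [MP] with ratio $\gamma$ and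 [Lin], almost surely $\mathcal E_\star(\tau;n_k,p_k)\to\mathcal E_\star(\tau,\gamma)$. If $\tau=0$ and $\gamma<1$, it is assumed in addition that almost surely the smallest eigenvalue of $G_k$ is eventually bounded below by a positive constant. * For every $\gamma>0$ the function $\tau\mapsto\mathcal E_\star(\tau,\gamma)$ is right-continuous on $[0,1)$; this fixes its value at the exceptional points $\tau=1-\frac1\gamma>0$. For every fixed $\tau\in[0,1]$ this function satisfies $$\mathcal E_\star(\tau,\gamma)\ \ge\ \sigma^2\gamma(1-\sqrt\tau)^2\qquad\text{for all }\gamma>0,$$ and for all $\gamma>0$ (without exceptions and without the eigenvalue assumption), for every sequence of problems satisfying [MP] with ratio $\gamma$ and [Lin], almost surely $\liminf_k\mathcal E_\star(\tau;n_k,p_k)\ge\sigma^2\gamma(1-\sqrt\tau)^2$. The bound is tight: $$\inf_{\gamma\in(0,\infty)}\frac{\mathcal E_\star(\tau,\gamma)}{\gamma}=\sigma^2(1-\sqrt\tau)^2=\lim_{\gamma\to0^+}\frac{\mathcal E_\star(\tau,\gamma)}{\gamma}.$$ -/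

import Mathlib

open MeasureTheory Filter Topology
open scoped ENNReal BoundedContinuousFunction Matrix

universe u v

noncomputable section

namespace MPRegression

/-! ### Losses -/

/-- The linear feature predictor `x ↦ βᵀ φ(x)`. -/
def linPred {X : Type v} {p : ℕ} (φ : X → Fin p → ℝ) (β : Fin p → ℝ) (x : X) : ℝ :=
  β ⬝ᵥ φ x

/-- Training loss `(1/n) ∑ᵢ (yᵢ - f(xᵢ))²`. -/
def trainLoss {X : Type v} {n : ℕ} (x : Fin n → X) (y : Fin n → ℝ) (f : X → ℝ) : ℝ :=
  (1 / (n : ℝ)) * ∑ i, (y i - f (x i)) ^ 2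

/-- Test loss `R(f) = E (y - f(x))²` for `(x, y) ∼ P`, as an extended nonnegative number. -/
def risk {X : Type v} [MeasurableSpace X] (P : Measure (X × ℝ)) (f : X → ℝ) : ℝ≥0∞ :=
  ∫⁻ z, ENNReal.ofReal ((z.2 - f z.1) ^ 2) ∂P

/-- The smallest test loss of any predictor; it is the test loss of the regression function
`x ↦ E (y | x)`. -/
def bayesRisk {X : Type v} [MeasurableSpace X] (P : Measure (X × ℝ)) : ℝ≥0∞ :=
  ⨅ (f : X → ℝ) (_ : Measurable f), risk P f

/-- Excess loss of `f` over the best predictor. -/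
def excessLoss {X : Type v} [MeasurableSpace X] (P : Measure (X × ℝ)) (f : X → ℝ) : ℝ≥0∞ :=
  risk P f - bayesRisk P

/-- Minimal excess loss of a linear feature model, given the training data, among those with
training loss at most `level`; it is `∞` when no linear feature model has such a training loss. -/
def minExcessLoss {X : Type v} [MeasurableSpace X] (P : Measure (X × ℝ)) {n p : ℕ}
    (φ : X → Fin p → ℝ) (x : Fin n → X) (y : Fin n → ℝ) (level : ℝ) : ℝ≥0∞ :=
  ⨅ (β : Fin p → ℝ) (_ : trainLoss x y (linPred φ β) ≤ level), excessLoss P (linPred φ β)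

/-! ### Feature matrices -/

/-- The feature matrix, with rows `φ(xᵢ)ᵀ`. -/
def featureMatrix {X : Type v} {n p : ℕ} (φ : X → Fin p → ℝ) (x : Fin n → X) :
    Matrix (Fin n) (Fin p) ℝ :=
  Matrix.of fun i j => φ (x i) j

/-- The feature covariance (second moment) matrix `E φ(x) φ(x)ᵀ`. -/
def featureCov {X : Type v} [MeasurableSpace X] (PX : Measure X) {p : ℕ}
    (φ : X → Fin p → ℝ) : Matrix (Fin p) (Fin p) ℝ :=
  Matrix.of fun i j => ∫ x, φ x i * φ x j ∂PX

/-- `A^(-1/2)` for a symmetric positive definite matrix `A`, by functional calculus. -/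
def invSqrt {p : ℕ} (A : Matrix (Fin p) (Fin p) ℝ) : Matrix (Fin p) (Fin p) ℝ :=
  cfc (fun t : ℝ => (Real.sqrt t)⁻¹) A

/-- The whitened feature matrix `W = Φ Σ^(-1/2)`. -/
def whitened {X : Type v} [MeasurableSpace X] (PX : Measure X) {n p : ℕ}
    (φ : X → Fin p → ℝ) (x : Fin n → X) : Matrix (Fin n) (Fin p) ℝ :=
  featureMatrix φ x * invSqrt (featureCov PX φ)

/-- The `n × n` matrix `(1/p) W Wᵀ` of a matrix `W` with `p` columns. -/
def gram {n p : ℕ} (W : Matrix (Fin n) (Fin p) ℝ) : Matrix (Fin n) (Fin n) ℝ :=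
  (1 / (p : ℝ)) • (W * Wᵀ)

theorem gram_isHermitian {n p : ℕ} (W : Matrix (Fin n) (Fin p) ℝ) : (gram W).IsHermitian := by
  unfold gram Matrix.IsHermitian
  rw [Matrix.conjTranspose_smul, Matrix.conjTranspose_mul]
  simp [Matrix.conjTranspose_eq_transpose_of_trivial]

/-- The eigenvalues of `(1/p) W Wᵀ`, with multiplicity. -/
def gramEigenvalues {n p : ℕ} (W : Matrix (Fin n) (Fin p) ℝ) : Fin n → ℝ :=
  (gram_isHermitian W).eigenvalues

/-- The empirical spectral distribution `(1/n) ∑ᵢ δ_{λᵢ}` of `(1/p) W Wᵀ`. -/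
def spectralDistribution {n p : ℕ} (W : Matrix (Fin n) (Fin p) ℝ) : Measure ℝ :=
  (n : ℝ≥0∞)⁻¹ • ∑ i, Measure.dirac (gramEigenvalues W i)

/-- The Marchenko–Pastur law with aspect ratio `γ`: an atom of mass `(1 - 1/γ)₊` at `0`, plus the
density `√((b - x)(x - a)) / (2πγx)` on `[a, b]`, where `a = (1 - √γ)²` and `b = (1 + √γ)²`. -/
def marchenkoPastur (γ : ℝ) : Measure ℝ :=
  ENNReal.ofReal (1 - 1 / γ) • Measure.dirac 0 +
    (volume.restrict (Set.Icc ((1 - Real.sqrt γ) ^ 2) ((1 + Real.sqrt γ) ^ 2))).withDensity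
      fun x => ENNReal.ofReal
        (Real.sqrt (((1 + Real.sqrt γ) ^ 2 - x) * (x - (1 - Real.sqrt γ) ^ 2)) /
          (2 * Real.pi * γ * x))

/-! ### Sequences of regression problems -/

/-- A sequence of regression problems with linear feature models: at stage `k` there are `n k`
training samples `(x k ω i, y k ω i)`, the data distribution is `P k`, and the feature map `φ k`
has `p k` features. No relation between the stages is prescribed. -/
structure ProblemSeq (Ω : Type u) where
  n : ℕ → ℕ
  p : ℕ → ℕ
  X : ℕ → Type v
  mX : ∀ k, MeasurableSpace (X k)
  P : ∀ k, Measure (X k × ℝ)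
  φ : ∀ k, X k → Fin (p k) → ℝ
  x : ∀ k, Ω → Fin (n k) → X k
  y : ∀ k, Ω → Fin (n k) → ℝ

attribute [instance] ProblemSeq.mX

namespace ProblemSeq

variable {Ω : Type u}

/-- The whitened feature matrix at stage `k`. -/
def W (S : ProblemSeq.{u, v} Ω) (k : ℕ) (ω : Ω) : Matrix (Fin (S.n k)) (Fin (S.p k)) ℝ :=
  whitened (S.P k).fst (S.φ k) (S.x k ω)

/-- The minimal excess loss at stage `k` under the training loss constraint `≤ τ σ²`. -/
def minExcess (S : ProblemSeq.{u, v} Ω) (σ τ : ℝ) (k : ℕ) (ω : Ω) : ℝ≥0∞ :=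
  minExcessLoss (S.P k) (S.φ k) (S.x k ω) (S.y k ω) (τ * σ ^ 2)

/-- At every stage the features are square integrable with positive definite covariance matrix,
and the training samples are i.i.d. from the data distribution. -/
structure IsSampled [MeasurableSpace Ω] (S : ProblemSeq.{u, v} Ω) (μ : Measure Ω) : Prop where
  isProb : ∀ k, IsProbabilityMeasure (S.P k)
  measurable_φ : ∀ k, Measurable (S.φ k)
  memLp_φ : ∀ k j, MemLp (fun x => S.φ k x j) 2 (S.P k).fst
  posDef : ∀ k, (featureCov (S.P k).fst (S.φ k)).PosDef
  measurable_x : ∀ k, Measurable (S.x k)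
  measurable_y : ∀ k, Measurable (S.y k)
  law : ∀ k, μ.map (fun ω i => (S.x k ω i, S.y k ω i)) = Measure.pi fun _ => S.P k

/-- The model is linear with additive noise, `y = β⋆ᵀ φ(x) + ε` with `ε` independent of `x`, where
the law `ν` of `ε` is the same at all stages, is centred with variance `σ²`, and has a finite
moment of some order `4 + η`, `η > 0`. The vector `β⋆` may depend on the stage. -/
def IsLin (S : ProblemSeq.{u, v} Ω) (σ : ℝ) : Prop :=
  ∃ ν : Measure ℝ, IsProbabilityMeasure ν ∧
    (∃ η : ℝ, 0 < η ∧ Integrable (fun e : ℝ => |e| ^ (4 + η)) ν) ∧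
    (∫ e, e ∂ν) = 0 ∧ (∫ e, e ^ 2 ∂ν) = σ ^ 2 ∧
    ∀ k, ∃ βs : Fin (S.p k) → ℝ,
      S.P k = ((S.P k).fst.prod ν).map fun z => (z.1, linPred (S.φ k) βs z.1 + z.2)

/-- `n, p → ∞` (with `n` strictly increasing along the sequence) and `n / p → γ`, and almost surely
the empirical spectral distribution of `(1/p) W Wᵀ` converges weakly to the Marchenko–Pastur law
with aspect ratio `γ`. -/
structure IsMP [MeasurableSpace Ω] (S : ProblemSeq.{u, v} Ω) (μ : Measure Ω) (γ : ℝ) : Prop where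
  n_strictMono : StrictMono S.n
  p_tendsto : Tendsto S.p atTop atTop
  ratio : Tendsto (fun k => (S.n k : ℝ) / (S.p k : ℝ)) atTop (𝓝 γ)
  weak : ∀ᵐ ω ∂μ, ∀ g : ℝ →ᵇ ℝ,
    Tendsto (fun k => ∫ s, g s ∂(spectralDistribution (S.W k ω))) atTop
      (𝓝 (∫ s, g s ∂(marchenkoPastur γ)))

/-- Almost surely the eigenvalues of `(1/p) W Wᵀ` eventually stay above a positive constant. -/
def SpectrumBoundedBelow [MeasurableSpace Ω] (S : ProblemSeq.{u, v} Ω) (μ : Measure Ω) : Prop :=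
  ∀ᵐ ω ∂μ, ∃ c : ℝ, 0 < c ∧ ∀ᶠ k in atTop, ∀ i, c ≤ gramEigenvalues (S.W k ω) i

end ProblemSeq

/-- `E τ γ` is the limiting minimal excess loss with noise variance `σ²`. For all sequences of
problems with Marchenko–Pastur asymptotics of ratio `γ` and linear model, it is the almost sure
limit of the minimal excess losses with training loss at most `τ σ²`. This is required at all
`τ ∈ [0, 1]` and `γ > 0`, except on the boundary `τ = 1 - 1/γ > 0` of the region
where the constraint is asymptotically infeasible; and for interpolation (`τ = 0`) with
`γ < 1` it is required only when the spectrum stays bounded away from `0`, since weak convergence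
does not control the smallest eigenvalue. On that boundary the value is the limit from
the right in `τ`. -/
structure IsLimitingMinExcess (σ : ℝ) (E : ℝ → ℝ → ℝ≥0∞) : Prop where
  limit : ∀ τ ∈ Set.Icc (0 : ℝ) 1, ∀ γ : ℝ, 0 < γ → (τ = 1 - 1 / γ → τ = 0) →
    ∀ (Ω : Type u) [MeasurableSpace Ω] (μ : Measure Ω) [IsProbabilityMeasure μ]
      (S : ProblemSeq.{u, v} Ω), S.IsSampled μ → S.IsLin σ → S.IsMP μ γ →
      (τ = 0 → γ < 1 → S.SpectrumBoundedBelow μ) →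
      ∀ᵐ ω ∂μ, Tendsto (fun k => S.minExcess σ τ k ω) atTop (𝓝 (E τ γ))
  right_cont : ∀ τ ∈ Set.Ico (0 : ℝ) 1, ∀ γ : ℝ, 0 < γ →
    Tendsto (fun t => E t γ) (𝓝[>] τ) (𝓝 (E τ γ))

end MPRegression

end

open ProbabilityTheory

noncomputable section

namespace MPRegression

/-! ### Ridge regression and weak duality -/

/-! Substitute `β = β⋆ + Σ^(-1/2) u`. Since the noise is centred and independent of the input, the
excess loss becomes `|u|²` and the training residual becomes `ε - W u`
(`minExcessLoss_eq_minNormSq`). What remains is a least norm problem with one quadratic constraint,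
whose Lagrange multiplier is a ridge parameter `l`. Write `G` for the Gram matrix. Every `l > 0`
gives the lower bound `(n/p) (εᵀ(G + l)⁻¹ε / n - τσ²/l)` (`le_minNormSq`). The ridge solution, when
feasible, exceeds this bound by `(n/p) (τσ² - its training loss) / l` (`minNormSq_le_ridge`).

Conditionally on the inputs, `εᵀAε` concentrates around `σ² tr A`, with probabilities of deviation
summable in `n` (`exists_summable_tail_quadForm`). Borel–Cantelli therefore applies without any
relation between the stages. The traces of powers of the resolvent converge by weak convergence of
the spectra, so `εᵀ(G + l)⁻¹ε / n → σ² m(l)` with `m(l) = ∫ 1/(s + l)` under the Marchenko–Pastur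
law. The limit is the dual value `sup_l γσ² (m(l) - τ/l)₊`, which is `limitExcess`. The lower bound
always holds. For the upper bound a ridge parameter is chosen whose limiting training loss is just
below `τσ²`. At `τ = 0`, `γ < 1` the interpolating solution takes its place, and this is where the
smallest eigenvalue enters. For `σ ≠ 0`, below the feasibility threshold and at `τ = 0`, `γ = 1` the
dual value is infinite; for `σ = 0` everything vanishes.

The Marchenko–Pastur law has mean `1`, so Jensen gives `m(l) ≥ 1/(1 + l)`, and the supremum of `1/(1
+ l) - τ/l` is `(1 - √τ)²`. For `γ < 1` the law lives above `a = (1 - √γ)²`, so `m(l) ≤ 1/(a + l)`,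
and the same optimisation gives `(1 - √τ)²/a`. Since `a → 1` as `γ → 0`, the bound is tight. -/

theorem dotProduct_gram_mulVec {n p : ℕ} (W : Matrix (Fin n) (Fin p) ℝ) (x y : Fin n → ℝ) :
    x ⬝ᵥ (gram W *ᵥ y) = (1 / (p : ℝ)) * ((Wᵀ *ᵥ x) ⬝ᵥ (Wᵀ *ᵥ y)) := by
  unfold gram
  rw [Matrix.smul_mulVec, dotProduct_smul, smul_eq_mul, ← Matrix.mulVec_mulVec,
    Matrix.dotProduct_mulVec, ← Matrix.mulVec_transpose]

theorem mulVec_dotProduct_eq {m n : ℕ} (W : Matrix (Fin m) (Fin n) ℝ) (u : Fin n → ℝ)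
    (v : Fin m → ℝ) : (W *ᵥ u) ⬝ᵥ v = u ⬝ᵥ (Wᵀ *ᵥ v) := by
  rw [dotProduct_comm, Matrix.dotProduct_mulVec, ← Matrix.mulVec_transpose, dotProduct_comm]

theorem dotProduct_self_nonneg' {n : ℕ} (x : Fin n → ℝ) : 0 ≤ x ⬝ᵥ x :=
  Finset.sum_nonneg fun _ _ => mul_self_nonneg _

theorem dotProduct_gram_mulVec_self_nonneg {n p : ℕ} (W : Matrix (Fin n) (Fin p) ℝ)
    (x : Fin n → ℝ) : 0 ≤ x ⬝ᵥ (gram W *ᵥ x) := by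
  rw [dotProduct_gram_mulVec]
  exact mul_nonneg (by positivity) (dotProduct_self_nonneg' _)

/-- The resolvent `(A + l)⁻¹`. -/
def resolvent {n : ℕ} (A : Matrix (Fin n) (Fin n) ℝ) (l : ℝ) : Matrix (Fin n) (Fin n) ℝ :=
  (A + l • (1 : Matrix (Fin n) (Fin n) ℝ))⁻¹

theorem isUnit_of_dotProduct_mulVec_pos {n : ℕ} (A : Matrix (Fin n) (Fin n) ℝ)
    (h : ∀ x, A *ᵥ x = 0 → x ⬝ᵥ x = 0) : IsUnit A.det := by
  rw [isUnit_iff_ne_zero]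
  intro h0
  obtain ⟨v, hv, hv0⟩ := Matrix.exists_mulVec_eq_zero_iff.2 h0
  exact hv (dotProduct_self_eq_zero.1 (h v hv0))

theorem isUnit_det_gram_add {n p : ℕ} (W : Matrix (Fin n) (Fin p) ℝ) {l : ℝ} (hl : 0 < l) :
    IsUnit (gram W + l • (1 : Matrix (Fin n) (Fin n) ℝ)).det := by
  refine isUnit_of_dotProduct_mulVec_pos _ fun x hx => ?_
  have h1 := congrArg (fun y => x ⬝ᵥ y) hx
  simp only [Matrix.add_mulVec, Matrix.smul_mulVec, Matrix.one_mulVec, dotProduct_add,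
    dotProduct_smul, smul_eq_mul, dotProduct_zero] at h1
  have h2 := dotProduct_gram_mulVec_self_nonneg W x
  have h3 := dotProduct_self_nonneg' x
  nlinarith [mul_nonneg hl.le h3, mul_pos hl hl]

theorem gram_mulVec_resolvent {n p : ℕ} (W : Matrix (Fin n) (Fin p) ℝ) {l : ℝ} (hl : 0 < l)
    (e : Fin n → ℝ) :
    gram W *ᵥ (resolvent (gram W) l *ᵥ e) = e - l • (resolvent (gram W) l *ᵥ e) := by
  have h : (gram W + l • (1 : Matrix (Fin n) (Fin n) ℝ)) *ᵥ (resolvent (gram W) l *ᵥ e) = e := by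
    rw [Matrix.mulVec_mulVec, resolvent, Matrix.mul_nonsing_inv _ (isUnit_det_gram_add W hl),
      Matrix.one_mulVec]
  rw [Matrix.add_mulVec, Matrix.smul_mulVec, Matrix.one_mulVec] at h
  exact eq_sub_of_add_eq h

theorem resolvent_isSymm {n p : ℕ} (W : Matrix (Fin n) (Fin p) ℝ) (l : ℝ) :
    (resolvent (gram W) l)ᵀ = resolvent (gram W) l := by
  have h := gram_isHermitian W
  rw [Matrix.IsHermitian, Matrix.conjTranspose_eq_transpose_of_trivial] at h
  rw [resolvent, Matrix.transpose_nonsing_inv, Matrix.transpose_add, h, Matrix.transpose_smul,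
    Matrix.transpose_one]

/-- Expand `|x - c y|² ≥ 0` and divide by `c`. This form of Young's inequality drives both weak
duality and the operator bounds. -/
theorem dotProduct_le_of_sq {n : ℕ} (x y : Fin n → ℝ) (c : ℝ) (hc : 0 < c) :
    2 * (x ⬝ᵥ y) ≤ (x ⬝ᵥ x) / c + c * (y ⬝ᵥ y) := by
  have h := dotProduct_self_nonneg' (x - c • y)
  simp only [sub_dotProduct, dotProduct_sub, smul_dotProduct, dotProduct_smul, smul_eq_mul] at h
  rw [dotProduct_comm y x] at h
  have : (x ⬝ᵥ x) / c + c * (y ⬝ᵥ y) - 2 * (x ⬝ᵥ y) =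
    (x ⬝ᵥ x - c * (x ⬝ᵥ y) - c * (x ⬝ᵥ y - c * (y ⬝ᵥ y))) / c := by field_simp; ring
  have h4 : 0 ≤ (x ⬝ᵥ x - c * (x ⬝ᵥ y) - c * (x ⬝ᵥ y - c * (y ⬝ᵥ y))) / c :=
    div_nonneg h hc.le
  linarith

/-- The resolvent contracts by `1 / l`. -/
theorem resolvent_mulVec_dotProduct_le {n p : ℕ} (W : Matrix (Fin n) (Fin p) ℝ) {l : ℝ}
    (hl : 0 < l) (e : Fin n → ℝ) :
    (resolvent (gram W) l *ᵥ e) ⬝ᵥ (resolvent (gram W) l *ᵥ e) ≤ (e ⬝ᵥ e) / l ^ 2 := by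
  set v := resolvent (gram W) l *ᵥ e with hv
  have h1 := dotProduct_gram_mulVec_self_nonneg W v
  rw [hv, gram_mulVec_resolvent W hl e, ← hv] at h1
  simp only [dotProduct_sub, dotProduct_smul, smul_eq_mul] at h1
  have h2 := dotProduct_le_of_sq e v l hl
  rw [dotProduct_comm] at h2
  rw [le_div_iff₀ (by positivity)]
  have h3 : l * (v ⬝ᵥ v) ≤ (e ⬝ᵥ e) / l := by linarith
  rw [le_div_iff₀ hl] at h3
  nlinarith

/-- The minimum of `|u|²` under the constraint `(1/n) |ε - W u|² ≤ level`. -/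
def minNormSq {n p : ℕ} (W : Matrix (Fin n) (Fin p) ℝ) (e : Fin n → ℝ) (level : ℝ) : ℝ≥0∞ :=
  ⨅ (u : Fin p → ℝ) (_ : (1 / (n : ℝ)) * ((e - W *ᵥ u) ⬝ᵥ (e - W *ᵥ u)) ≤ level),
    ENNReal.ofReal (u ⬝ᵥ u)

/-- Weak duality for the ridge problem. -/
theorem le_minNormSq {n p : ℕ} (hn : 0 < n) (hp : 0 < p) (W : Matrix (Fin n) (Fin p) ℝ)
    (e : Fin n → ℝ) (level : ℝ) {l : ℝ} (hl : 0 < l) :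
    ENNReal.ofReal ((n / p : ℝ) * ((1 / n : ℝ) * (e ⬝ᵥ (resolvent (gram W) l *ᵥ e)) - level / l))
      ≤ minNormSq W e level := by
  have hn' : (0 : ℝ) < n := by exact_mod_cast hn
  have hp' : (0 : ℝ) < p := by exact_mod_cast hp
  refine le_iInf₂ fun u hu => ENNReal.ofReal_le_ofReal ?_
  set v := resolvent (gram W) l *ᵥ e with hv
  set r := e - W *ᵥ u with hr
  have he : e = r + W *ᵥ u := by rw [hr]; abel
  have h1 := dotProduct_gram_mulVec W v v
  rw [hv, gram_mulVec_resolvent W hl e, ← hv] at h1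
  simp only [dotProduct_sub, dotProduct_smul, smul_eq_mul] at h1
  have h2 : e ⬝ᵥ v = r ⬝ᵥ v + u ⬝ᵥ (Wᵀ *ᵥ v) := by
    conv_lhs => rw [he]
    rw [add_dotProduct, mulVec_dotProduct_eq]
  -- With weights `l` and `p`, the terms in `v` add up to `l|v|² + |Wᵀv|²/p = vᵀ(G + l)v = e ⬝ᵥ v`
  -- by `h1`, and this cancels one of the two copies of `e ⬝ᵥ v` on the left.
  have h3 := dotProduct_le_of_sq r v l hl
  have h4 := dotProduct_le_of_sq (Wᵀ *ᵥ v) u p hp'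
  rw [dotProduct_comm v e] at h1
  rw [dotProduct_comm _ u] at h4
  have h5 : e ⬝ᵥ v ≤ (r ⬝ᵥ r) / l + p * (u ⬝ᵥ u) := by
    have : (Wᵀ *ᵥ v) ⬝ᵥ (Wᵀ *ᵥ v) / (p : ℝ) = 1 / (p : ℝ) * ((Wᵀ *ᵥ v) ⬝ᵥ (Wᵀ *ᵥ v)) := by ring
    linarith
  have h6 : r ⬝ᵥ r ≤ n * level := by
    rw [one_div, inv_mul_le_iff₀ hn'] at hu
    exact hu
  have h7 : (r ⬝ᵥ r) / l ≤ n * level / l := by gcongr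
  have h8 : (n / p : ℝ) * ((1 / n : ℝ) * (e ⬝ᵥ v) - level / l)
      = (e ⬝ᵥ v - n * level / l) / p := by field_simp
  rw [h8, div_le_iff₀ hp']
  linarith

/-- The candidate is `u = Wᵀv/p`, for which `W u = G v` and `|u|² = vᵀGv/p`. -/
theorem minNormSq_le_of_gram {n p : ℕ} (hp : 0 < p) (W : Matrix (Fin n) (Fin p) ℝ)
    (e v : Fin n → ℝ) (level : ℝ)
    (h : (1 / (n : ℝ)) * ((e - gram W *ᵥ v) ⬝ᵥ (e - gram W *ᵥ v)) ≤ level) :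
    minNormSq W e level ≤ ENNReal.ofReal ((1 / p : ℝ) * (v ⬝ᵥ (gram W *ᵥ v))) := by
  have hp' : (0 : ℝ) < p := by exact_mod_cast hp
  have hW : W *ᵥ ((1 / p : ℝ) • (Wᵀ *ᵥ v)) = gram W *ᵥ v := by
    rw [gram, Matrix.mulVec_smul, Matrix.smul_mulVec, Matrix.mulVec_mulVec]
  refine (iInf₂_le ((1 / p : ℝ) • (Wᵀ *ᵥ v)) (by rwa [hW])).trans (le_of_eq ?_)
  rw [dotProduct_gram_mulVec, smul_dotProduct, dotProduct_smul, smul_eq_mul, smul_eq_mul]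

/-- A feasible ridge solution bounds the minimum. -/
theorem minNormSq_le_ridge {n p : ℕ} (hn : 0 < n) (hp : 0 < p) (W : Matrix (Fin n) (Fin p) ℝ)
    (e : Fin n → ℝ) (level : ℝ) {l : ℝ} (hl : 0 < l)
    (h : l ^ 2 * ((1 / n : ℝ) *
      ((resolvent (gram W) l *ᵥ e) ⬝ᵥ (resolvent (gram W) l *ᵥ e))) ≤ level) :
    minNormSq W e level ≤ ENNReal.ofReal ((n / p : ℝ) *
      ((1 / n : ℝ) * (e ⬝ᵥ (resolvent (gram W) l *ᵥ e)) -
        l * ((1 / n : ℝ) * ((resolvent (gram W) l *ᵥ e) ⬝ᵥ (resolvent (gram W) l *ᵥ e))))) := by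
  have hn' : (0 : ℝ) < n := by exact_mod_cast hn
  have hp' : (0 : ℝ) < p := by exact_mod_cast hp
  set v := resolvent (gram W) l *ᵥ e with hv
  have hG : gram W *ᵥ v = e - l • v := by rw [hv, gram_mulVec_resolvent W hl e]
  refine (minNormSq_le_of_gram hp W e v level ?_).trans (ENNReal.ofReal_le_ofReal (le_of_eq ?_))
  · rw [hG]
    simp only [sub_sub_cancel, smul_dotProduct, dotProduct_smul, smul_eq_mul]
    linarith
  · rw [hG, dotProduct_sub, dotProduct_smul, smul_eq_mul, dotProduct_comm v e]
    field_simp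

/-- The interpolating solution bounds the minimum when the spectrum is bounded below. -/
theorem minNormSq_le_interpolation {n p : ℕ} (hn : 0 < n) (hp : 0 < p)
    (W : Matrix (Fin n) (Fin p) ℝ) (e : Fin n → ℝ) {level : ℝ} (h0 : 0 ≤ level) {l c : ℝ}
    (hl : 0 < l) (hc : 0 < c) (hG : ∀ x, c * (x ⬝ᵥ x) ≤ x ⬝ᵥ (gram W *ᵥ x)) :
    minNormSq W e level ≤ ENNReal.ofReal ((n / p : ℝ) *
      ((1 / n : ℝ) * (e ⬝ᵥ (resolvent (gram W) l *ᵥ e)) +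
        l / c ^ 2 * ((1 / n : ℝ) * (e ⬝ᵥ e)))) := by
  have hn' : (0 : ℝ) < n := by exact_mod_cast hn
  have hp' : (0 : ℝ) < p := by exact_mod_cast hp
  have hu : IsUnit (gram W).det := by
    refine isUnit_of_dotProduct_mulVec_pos _ fun x hx => ?_
    have h1 := hG x
    rw [hx, dotProduct_zero] at h1
    nlinarith [dotProduct_self_nonneg' x]
  have bound : ∀ x y : Fin n → ℝ, c * (x ⬝ᵥ x) ≤ x ⬝ᵥ y → x ⬝ᵥ x ≤ (y ⬝ᵥ y) / c ^ 2 := by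
    intro x y hxy
    have h2 := dotProduct_le_of_sq y x c hc
    rw [dotProduct_comm] at h2
    rw [le_div_iff₀ (by positivity)]
    have h3 : c * (x ⬝ᵥ x) ≤ (y ⬝ᵥ y) / c := by linarith
    rw [le_div_iff₀ hc] at h3
    nlinarith
  set v := resolvent (gram W) l *ᵥ e with hv
  set w := (gram W)⁻¹ *ᵥ e with hw
  have hGv : gram W *ᵥ v = e - l • v := by rw [hv, gram_mulVec_resolvent W hl e]
  have hGw : gram W *ᵥ w = e := by
    rw [hw, Matrix.mulVec_mulVec, Matrix.mul_nonsing_inv _ hu, Matrix.one_mulVec]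
  refine (minNormSq_le_of_gram hp W e w level ?_).trans (ENNReal.ofReal_le_ofReal ?_)
  · simpa [hGw] using h0
  have hwb := bound w e (by simpa [hGw] using hG w)
  have hvb := bound v e (by
    have h1 := hG v
    rw [hGv, dotProduct_sub, dotProduct_smul, smul_eq_mul] at h1
    nlinarith [dotProduct_self_nonneg' v])
  -- Resolvent identity: passing from `G⁻¹` to `(G + l)⁻¹` costs `l (w ⬝ᵥ v)`, and both `v` and `w`
  -- have norm at most `|e|/c`.
  have hsym : e ⬝ᵥ v = w ⬝ᵥ e - l * (w ⬝ᵥ v) := by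
    have h1 : w ⬝ᵥ (gram W *ᵥ v) = v ⬝ᵥ (gram W *ᵥ w) := by
      rw [dotProduct_gram_mulVec, dotProduct_gram_mulVec, dotProduct_comm (Wᵀ *ᵥ w)]
    rw [hGv, hGw, dotProduct_sub, dotProduct_smul, smul_eq_mul, dotProduct_comm v e] at h1
    exact h1.symm
  have h2 := dotProduct_le_of_sq w v 1 one_pos
  have h3 : w ⬝ᵥ v ≤ (e ⬝ᵥ e) / c ^ 2 := by
    rw [div_one, one_mul] at h2
    linarith
  have h4 : w ⬝ᵥ e ≤ e ⬝ᵥ v + l / c ^ 2 * (e ⬝ᵥ e) := by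
    have : l * (w ⬝ᵥ v) ≤ l * ((e ⬝ᵥ e) / c ^ 2) := by gcongr
    have h5 : l * ((e ⬝ᵥ e) / c ^ 2) = l / c ^ 2 * (e ⬝ᵥ e) := by ring
    linarith
  rw [hGw]
  have h6 : (n / p : ℝ) * ((1 / n : ℝ) * (e ⬝ᵥ v) + l / c ^ 2 * ((1 / n : ℝ) * (e ⬝ᵥ e)))
      = (1 / p : ℝ) * (e ⬝ᵥ v + l / c ^ 2 * (e ⬝ᵥ e)) := by field_simp
  rw [h6]
  gcongr

/-! ### Spectral form of traces -/

theorem gram_eq_conj {n p : ℕ} (W : Matrix (Fin n) (Fin p) ℝ) :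
    ∃ U : Matrix (Fin n) (Fin n) ℝ, Uᵀ * U = 1 ∧ U * Uᵀ = 1 ∧
      gram W = U * Matrix.diagonal (gramEigenvalues W) * Uᵀ := by
  have h := (gram_isHermitian W).spectral_theorem
  refine ⟨(gram_isHermitian W).eigenvectorUnitary, ?_, ?_, ?_⟩
  · have := Unitary.coe_star_mul_self (gram_isHermitian W).eigenvectorUnitary
    rwa [Matrix.star_eq_conjTranspose, Matrix.conjTranspose_eq_transpose_of_trivial] at this
  · have := Unitary.coe_mul_star_self (gram_isHermitian W).eigenvectorUnitary
    rwa [Unitary.coe_star, Matrix.star_eq_conjTranspose, Matrix.conjTranspose_eq_transpose_of_trivial] at this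
  · rw [Unitary.conjStarAlgAut_apply] at h
    rw [Matrix.star_eq_conjTranspose, Matrix.conjTranspose_eq_transpose_of_trivial] at h
    exact h

theorem gramEigenvalues_nonneg {n p : ℕ} (W : Matrix (Fin n) (Fin p) ℝ) (i : Fin n) :
    0 ≤ gramEigenvalues W i := by
  refine Matrix.PosSemidef.eigenvalues_nonneg (A := gram W) ?_ i
  refine Matrix.PosSemidef.of_dotProduct_mulVec_nonneg (gram_isHermitian W) fun x => ?_
  simpa using dotProduct_gram_mulVec_self_nonneg W x

theorem resolvent_eq_conj {n p : ℕ} (W : Matrix (Fin n) (Fin p) ℝ) {l : ℝ} (hl : 0 < l)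
    {U : Matrix (Fin n) (Fin n) ℝ} (h1 : Uᵀ * U = 1) (h2 : U * Uᵀ = 1)
    (h : gram W = U * Matrix.diagonal (gramEigenvalues W) * Uᵀ) :
    resolvent (gram W) l = U * Matrix.diagonal (fun i => (gramEigenvalues W i + l)⁻¹) * Uᵀ := by
  have h3 : gram W + l • (1 : Matrix (Fin n) (Fin n) ℝ) =
      U * Matrix.diagonal (fun i => gramEigenvalues W i + l) * Uᵀ := by
    have : Matrix.diagonal (fun i => gramEigenvalues W i + l) =
        Matrix.diagonal (gramEigenvalues W) + l • (1 : Matrix (Fin n) (Fin n) ℝ) := by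
      rw [← Matrix.diagonal_one, ← Matrix.diagonal_smul, Matrix.diagonal_add]
      simp
    rw [this, Matrix.mul_add, Matrix.add_mul, ← h, Matrix.mul_smul, Matrix.smul_mul,
      Matrix.mul_one, h2]
  rw [resolvent, h3]
  refine Matrix.inv_eq_left_inv ?_
  rw [show ∀ A B : Matrix (Fin n) (Fin n) ℝ, U * A * Uᵀ * (U * B * Uᵀ) =
    U * (A * (Uᵀ * U) * B) * Uᵀ from fun A B => by simp only [Matrix.mul_assoc], h1,
    Matrix.mul_one, Matrix.diagonal_mul_diagonal]
  have : (fun i => (gramEigenvalues W i + l)⁻¹ * (gramEigenvalues W i + l)) = fun _ => 1 := by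
    funext i
    have := gramEigenvalues_nonneg W i
    exact inv_mul_cancel₀ (by positivity)
  rw [this, Matrix.diagonal_one, Matrix.mul_one, h2]

theorem trace_resolvent {n p : ℕ} (W : Matrix (Fin n) (Fin p) ℝ) {l : ℝ} (hl : 0 < l) :
    (resolvent (gram W) l).trace = ∑ i, (gramEigenvalues W i + l)⁻¹ := by
  obtain ⟨U, h1, h2, h⟩ := gram_eq_conj W
  rw [resolvent_eq_conj W hl h1 h2 h, Matrix.trace_mul_comm, ← Matrix.mul_assoc, h1,
    Matrix.one_mul, Matrix.trace_diagonal]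

theorem trace_resolvent_sq {n p : ℕ} (W : Matrix (Fin n) (Fin p) ℝ) {l : ℝ} (hl : 0 < l) :
    (resolvent (gram W) l * resolvent (gram W) l).trace =
      ∑ i, ((gramEigenvalues W i + l)⁻¹) ^ 2 := by
  obtain ⟨U, h1, h2, h⟩ := gram_eq_conj W
  rw [resolvent_eq_conj W hl h1 h2 h, show ∀ A B : Matrix (Fin n) (Fin n) ℝ,
    U * A * Uᵀ * (U * B * Uᵀ) = U * (A * (Uᵀ * U) * B) * Uᵀ from
    fun A B => by simp only [Matrix.mul_assoc], h1, Matrix.mul_one,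
    Matrix.diagonal_mul_diagonal, Matrix.trace_mul_comm, ← Matrix.mul_assoc, h1,
    Matrix.one_mul, Matrix.trace_diagonal]
  simp only [sq]

theorem integral_spectralDistribution {n p : ℕ} (W : Matrix (Fin n) (Fin p) ℝ) (g : ℝ → ℝ) :
    ∫ s, g s ∂(spectralDistribution W) = (1 / n : ℝ) * ∑ i, g (gramEigenvalues W i) := by
  rw [spectralDistribution, integral_smul_measure, integral_finsetSum_measure]
  · simp
  · intro i _
    exact integrable_dirac (by simp)

theorem le_dotProduct_gram_of_le_eigenvalues {n p : ℕ} (W : Matrix (Fin n) (Fin p) ℝ) {c : ℝ}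
    (hc : ∀ i, c ≤ gramEigenvalues W i) (x : Fin n → ℝ) :
    c * (x ⬝ᵥ x) ≤ x ⬝ᵥ (gram W *ᵥ x) := by
  obtain ⟨U, h1, h2, h⟩ := gram_eq_conj W
  have e1 : x ⬝ᵥ (gram W *ᵥ x) =
      (Uᵀ *ᵥ x) ⬝ᵥ (Matrix.diagonal (gramEigenvalues W) *ᵥ (Uᵀ *ᵥ x)) := by
    conv_lhs => rw [h]
    rw [← Matrix.mulVec_mulVec, ← Matrix.mulVec_mulVec, Matrix.dotProduct_mulVec,
      ← Matrix.mulVec_transpose]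
  have e2 : x ⬝ᵥ x = (Uᵀ *ᵥ x) ⬝ᵥ (Uᵀ *ᵥ x) := by
    conv_rhs => rw [Matrix.dotProduct_mulVec, ← Matrix.mulVec_transpose, Matrix.transpose_transpose,
      Matrix.mulVec_mulVec, h2, Matrix.one_mulVec]
  rw [e1, e2]
  simp only [dotProduct, Matrix.mulVec_diagonal, Finset.mul_sum]
  refine Finset.sum_le_sum fun i _ => ?_
  nlinarith [hc i, mul_self_nonneg ((Uᵀ *ᵥ x) i)]

/-! ### The Marchenko–Pastur law -/

/-! ### Antiderivatives for the mass and the mean of the density -/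

theorem hasDerivAt_sqrt_mul {a b x : ℝ} (hx : x ∈ Set.Ioo a b) :
    HasDerivAt (fun x => Real.sqrt ((b - x) * (x - a)))
      ((a + b - 2 * x) / (2 * Real.sqrt ((b - x) * (x - a)))) x := by
  have hpos : 0 < (b - x) * (x - a) := mul_pos (sub_pos.2 hx.2) (sub_pos.2 hx.1)
  have h := (((hasDerivAt_id x).const_sub b).mul ((hasDerivAt_id x).sub_const a)).sqrt hpos.ne'
  refine h.congr_deriv ?_
  simp only [id, Pi.mul_apply]
  ring

theorem hasDerivAt_arcsin_affine {a b x : ℝ} (hx : x ∈ Set.Ioo a b) :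
    HasDerivAt (fun x => Real.arcsin ((2 * x - a - b) / (b - a)))
      (1 / Real.sqrt ((b - x) * (x - a))) x := by
  have hab : 0 < b - a := by linarith [hx.1, hx.2]
  have h1 : (2 * x - a - b) / (b - a) ≠ -1 := by
    intro h
    rw [div_eq_iff hab.ne'] at h
    linarith [hx.1]
  have h2 : (2 * x - a - b) / (b - a) ≠ 1 := by
    intro h
    rw [div_eq_iff hab.ne'] at h
    linarith [hx.2]
  have hg : HasDerivAt (fun x : ℝ => (2 * x - a - b) / (b - a)) (2 / (b - a)) x := by
    have := ((((hasDerivAt_id x).const_mul 2).sub_const a).sub_const b).div_const (b - a)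
    simpa using this
  have h := (Real.hasDerivAt_arcsin h1 h2).comp x hg
  refine h.congr_deriv ?_
  have hpos : 0 < (b - x) * (x - a) := mul_pos (sub_pos.2 hx.2) (sub_pos.2 hx.1)
  have e : 1 - ((2 * x - a - b) / (b - a)) ^ 2 = (2 / (b - a)) ^ 2 * ((b - x) * (x - a)) := by
    field_simp
    ring
  rw [e, Real.sqrt_mul (by positivity), Real.sqrt_sq (by positivity)]
  have := Real.sqrt_pos.2 hpos
  field_simp

/-- This is the affine arcsine of `hasDerivAt_arcsin_affine` under `x ↦ 1/x`, which maps `[a, b]` to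
`[1/b, 1/a]`, with the sign reversed. -/
theorem hasDerivAt_arcsin_inv {a b x : ℝ} (ha : 0 < a) (hx : x ∈ Set.Ioo a b) :
    HasDerivAt (fun x => Real.arcsin (((a + b) * x - 2 * (a * b)) / (x * (b - a))))
      (Real.sqrt (a * b) / (x * Real.sqrt ((b - x) * (x - a)))) x := by
  have hab : 0 < b - a := by linarith [hx.1, hx.2]
  have hx0 : 0 < x := ha.trans hx.1
  have hb : 0 < b := hx0.trans hx.2
  have h1 : ((a + b) * x - 2 * (a * b)) / (x * (b - a)) ≠ -1 := by
    intro h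
    rw [div_eq_iff (by positivity)] at h
    have : b * (x - a) = 0 := by linarith
    rcases mul_eq_zero.1 this with h | h <;> linarith [hx.1]
  have h2 : ((a + b) * x - 2 * (a * b)) / (x * (b - a)) ≠ 1 := by
    intro h
    rw [div_eq_iff (by positivity)] at h
    have : a * (b - x) = 0 := by linarith
    rcases mul_eq_zero.1 this with h | h <;> linarith [hx.2]
  have hg : HasDerivAt (fun x : ℝ => ((a + b) * x - 2 * (a * b)) / (x * (b - a)))
      (2 * (a * b) / (x ^ 2 * (b - a))) x := by
    have h3 := (((hasDerivAt_id x).const_mul (a + b)).sub_const (2 * (a * b))).div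
      ((hasDerivAt_id x).mul_const (b - a)) (by simp only [id]; positivity)
    refine h3.congr_deriv ?_
    simp only [id]
    field_simp
    ring
  have h := (Real.hasDerivAt_arcsin h1 h2).comp x hg
  refine h.congr_deriv ?_
  have hpos : 0 < (b - x) * (x - a) := mul_pos (sub_pos.2 hx.2) (sub_pos.2 hx.1)
  have e : 1 - (((a + b) * x - 2 * (a * b)) / (x * (b - a))) ^ 2 =
      (2 / (x * (b - a))) ^ 2 * ((a * b) * ((b - x) * (x - a))) := by
    field_simp
    ring
  rw [e, Real.sqrt_mul (by positivity), Real.sqrt_sq (by positivity), Real.sqrt_mul (by positivity)]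
  have h4 := Real.sqrt_pos.2 hpos
  have h5 := Real.sqrt_pos.2 (mul_pos ha hb)
  have h6 := Real.sq_sqrt (mul_pos ha hb).le
  generalize Real.sqrt (a * b) = c at *
  generalize Real.sqrt ((b - x) * (x - a)) = s at *
  field_simp
  linarith

theorem arcsin_neg_one_eq : Real.arcsin (-1) = -(Real.pi / 2) := by
  rw [Real.arcsin_neg, Real.arcsin_one]

/-- Integrability and value of `∫ √((b - x)(x - a)) / x` over `[a, b]`. -/
theorem integral_sqrt_div {a b : ℝ} (ha : 0 ≤ a) (hab : a < b) :
    IntegrableOn (fun x => Real.sqrt ((b - x) * (x - a)) / x) (Set.Icc a b) ∧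
    ∫ x in Set.Icc a b, Real.sqrt ((b - x) * (x - a)) / x =
      Real.pi * ((a + b) / 2 - Real.sqrt (a * b)) := by
  have hba : 0 < b - a := sub_pos.2 hab
  have hb : 0 < b := ha.trans_lt hab
  -- `F₃` is an antiderivative of `ab / (x √((b - x)(x - a)))`. For `a = 0`, which is the case `γ =
  -- 1`, this integrand vanishes; it is split off because `hasDerivAt_arcsin_inv` needs `0 < a`.
  set F₃ : ℝ → ℝ := fun x => if a = 0 then 0 else
    Real.sqrt (a * b) * Real.arcsin (((a + b) * x - 2 * (a * b)) / (x * (b - a))) with hF₃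
  have hc3 : ContinuousOn F₃ (Set.Icc a b) := by
    rcases ha.eq_or_lt with h | h
    · simp only [hF₃, h.symm, if_true]
      exact continuousOn_const
    · simp only [hF₃, h.ne', if_false]
      refine continuousOn_const.mul (Real.continuous_arcsin.comp_continuousOn ?_)
      refine ContinuousOn.div (by fun_prop) (by fun_prop) fun x hx => ?_
      have : 0 < x := h.trans_le hx.1
      positivity
  have hd3 : ∀ x ∈ Set.Ioo a b, HasDerivAt F₃ (a * b / (x * Real.sqrt ((b - x) * (x - a)))) x := by
    intro x hx
    rcases ha.eq_or_lt with h | h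
    · simp only [hF₃, h.symm, if_true]
      simpa using hasDerivAt_const x (0 : ℝ)
    · simp only [hF₃, h.ne', if_false]
      refine ((hasDerivAt_arcsin_inv h hx).const_mul (Real.sqrt (a * b))).congr_deriv ?_
      rw [mul_div_assoc', Real.mul_self_sqrt (by positivity)]
  have hF₃b : F₃ b = Real.sqrt (a * b) * (Real.pi / 2) := by
    rcases ha.eq_or_lt with h | h
    · simp [hF₃, h.symm]
    · simp only [hF₃, h.ne', if_false]
      rw [show ((a + b) * b - 2 * (a * b)) / (b * (b - a)) = 1 by
        rw [div_eq_one_iff_eq (by positivity)]; ring, Real.arcsin_one]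
  have hF₃a : F₃ a = -(Real.sqrt (a * b) * (Real.pi / 2)) := by
    rcases ha.eq_or_lt with h | h
    · simp [hF₃, h.symm]
    · simp only [hF₃, h.ne', if_false]
      rw [show ((a + b) * a - 2 * (a * b)) / (a * (b - a)) = -1 by
        rw [div_eq_iff (by positivity)]; ring, arcsin_neg_one_eq]
      ring
  -- Dividing `(b - x)(x - a) = -x² + (a + b)x - ab` by `x√((b - x)(x - a))` writes the integrand as
  -- `((a + b)/2 - x)/√ + ((a + b)/2)/√ - ab/(x√)`; the three summands of `F` integrate these in
  -- turn.
  set F : ℝ → ℝ := fun x => Real.sqrt ((b - x) * (x - a)) +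
    (a + b) / 2 * Real.arcsin ((2 * x - a - b) / (b - a)) - F₃ x with hF
  have hc : ContinuousOn F (Set.Icc a b) := by
    refine ContinuousOn.sub (Continuous.continuousOn ?_) hc3
    exact (Real.continuous_sqrt.comp (by fun_prop)).add
      (continuous_const.mul (Real.continuous_arcsin.comp (by fun_prop)))
  have hd : ∀ x ∈ Set.Ioo a b, HasDerivAt F (Real.sqrt ((b - x) * (x - a)) / x) x := by
    intro x hx
    have hx0 : 0 < x := ha.trans_lt hx.1
    refine (((hasDerivAt_sqrt_mul hx).add
      ((hasDerivAt_arcsin_affine hx).const_mul ((a + b) / 2))).sub (hd3 x hx)).congr_deriv ?_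
    have hpos : 0 < (b - x) * (x - a) := mul_pos (sub_pos.2 hx.2) (sub_pos.2 hx.1)
    have h4 := Real.sqrt_pos.2 hpos
    have h6 := Real.sq_sqrt hpos.le
    generalize Real.sqrt ((b - x) * (x - a)) = s at *
    field_simp
    rw [h6]
    ring
  -- For `a = 0` the integrand is unbounded near `0`; integrability comes from its being the
  -- nonnegative derivative of a function continuous up to the endpoints.
  have hint : IntegrableOn (fun x => Real.sqrt ((b - x) * (x - a)) / x) (Set.Ioc a b) :=
    intervalIntegral.integrableOn_deriv_of_nonneg hc hd fun x hx =>
      div_nonneg (Real.sqrt_nonneg _) (ha.trans hx.1.le)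
  refine ⟨(integrableOn_Icc_iff_integrableOn_Ioc (by simp)).2 hint, ?_⟩
  rw [integral_Icc_eq_integral_Ioc, ← intervalIntegral.integral_of_le hab.le,
    intervalIntegral.integral_eq_sub_of_hasDerivAt_of_le hab.le hc hd
      ((intervalIntegrable_iff_integrableOn_Ioc_of_le hab.le).2 hint)]
  simp only [hF, hF₃a, hF₃b]
  rw [show (2 * b - a - b) / (b - a) = 1 by rw [div_eq_one_iff_eq hba.ne']; ring,
    show (2 * a - a - b) / (b - a) = -1 by rw [div_eq_iff hba.ne']; ring, Real.arcsin_one,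
    arcsin_neg_one_eq]
  simp
  ring

theorem integral_sqrt_mul {a b : ℝ} (hab : a < b) :
    ∫ x in Set.Icc a b, Real.sqrt ((b - x) * (x - a)) = Real.pi * (b - a) ^ 2 / 8 := by
  have hba : 0 < b - a := sub_pos.2 hab
  set F : ℝ → ℝ := fun x => (2 * x - a - b) / 4 * Real.sqrt ((b - x) * (x - a)) +
    (b - a) ^ 2 / 8 * Real.arcsin ((2 * x - a - b) / (b - a)) with hF
  have hs : Continuous fun x => Real.sqrt ((b - x) * (x - a)) :=
    Real.continuous_sqrt.comp (by fun_prop)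
  have hc : Continuous F := ((by fun_prop : Continuous fun x : ℝ => (2 * x - a - b) / 4).mul
      hs).add (continuous_const.mul (Real.continuous_arcsin.comp (by fun_prop)))
  have hd : ∀ x ∈ Set.Ioo a b, HasDerivAt F (Real.sqrt ((b - x) * (x - a))) x := by
    intro x hx
    have h1 : HasDerivAt (fun x : ℝ => (2 * x - a - b) / 4) (2 / 4) x := by
      have := ((((hasDerivAt_id x).const_mul 2).sub_const a).sub_const b).div_const 4
      simpa using this
    refine ((h1.mul (hasDerivAt_sqrt_mul hx)).add
      ((hasDerivAt_arcsin_affine hx).const_mul ((b - a) ^ 2 / 8))).congr_deriv ?_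
    have hpos : 0 < (b - x) * (x - a) := mul_pos (sub_pos.2 hx.2) (sub_pos.2 hx.1)
    have h4 := Real.sqrt_pos.2 hpos
    have h6 := Real.sq_sqrt hpos.le
    generalize Real.sqrt ((b - x) * (x - a)) = s at *
    field_simp
    rw [h6]
    ring
  rw [integral_Icc_eq_integral_Ioc, ← intervalIntegral.integral_of_le hab.le,
    intervalIntegral.integral_eq_sub_of_hasDerivAt_of_le hab.le hc.continuousOn hd
      (hs.intervalIntegrable _ _)]
  simp only [hF]
  rw [show (2 * b - a - b) / (b - a) = 1 by rw [div_eq_one_iff_eq hba.ne']; ring,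
    show (2 * a - a - b) / (b - a) = -1 by rw [div_eq_iff hba.ne']; ring, Real.arcsin_one,
    arcsin_neg_one_eq]
  simp
  ring

/-- The left edge of the Marchenko–Pastur law. -/
def mpLeft (γ : ℝ) : ℝ := (1 - Real.sqrt γ) ^ 2

/-- The right edge of the Marchenko–Pastur law. -/
def mpRight (γ : ℝ) : ℝ := (1 + Real.sqrt γ) ^ 2

/-- The density of the absolutely continuous part of the Marchenko–Pastur law. -/
def mpDensity (γ x : ℝ) : ℝ :=
  Real.sqrt ((mpRight γ - x) * (x - mpLeft γ)) / (2 * Real.pi * γ * x)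

/-- The absolutely continuous part of the Marchenko–Pastur law. -/
def mpContinuousPart (γ : ℝ) : Measure ℝ :=
  (volume.restrict (Set.Icc (mpLeft γ) (mpRight γ))).withDensity
    fun x => ENNReal.ofReal (mpDensity γ x)

/-! ### Mass, support and mean of the Marchenko–Pastur law -/

theorem marchenkoPastur_eq (γ : ℝ) : marchenkoPastur γ =
    ENNReal.ofReal (1 - 1 / γ) • Measure.dirac 0 + mpContinuousPart γ := rfl

theorem mpLeft_nonneg (γ : ℝ) : 0 ≤ mpLeft γ := sq_nonneg _

theorem mpLeft_lt_mpRight {γ : ℝ} (hγ : 0 < γ) : mpLeft γ < mpRight γ := by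
  have := Real.sqrt_pos.2 hγ
  unfold mpLeft mpRight
  nlinarith

theorem measurable_mpDensity (γ : ℝ) : Measurable (mpDensity γ) := by
  unfold mpDensity
  fun_prop

theorem mpDensity_nonneg {γ x : ℝ} (hγ : 0 < γ) (hx : 0 ≤ x) : 0 ≤ mpDensity γ x := by
  unfold mpDensity
  positivity

theorem mpDensity_eq (γ : ℝ) : mpDensity γ = fun x => (1 / (2 * Real.pi * γ)) *
    (Real.sqrt ((mpRight γ - x) * (x - mpLeft γ)) / x) := by
  funext x
  unfold mpDensity
  rw [div_mul_div_comm, one_mul]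

/-- With `(a + b)/2 = 1 + γ` and `√(ab) = |1 - γ|` the value is `min(1, 1/γ)`, exactly what the atom
at `0` leaves over. -/
theorem integral_mpDensity {γ : ℝ} (hγ : 0 < γ) :
    ∫ x in Set.Icc (mpLeft γ) (mpRight γ), mpDensity γ x = (1 + γ - |1 - γ|) / (2 * γ) := by
  rw [mpDensity_eq γ, integral_const_mul,
    (integral_sqrt_div (mpLeft_nonneg γ) (mpLeft_lt_mpRight hγ)).2]
  have h1 : (mpLeft γ + mpRight γ) / 2 = 1 + γ := by
    have := Real.sq_sqrt hγ.le
    unfold mpLeft mpRight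
    linarith
  have h2 : Real.sqrt (mpLeft γ * mpRight γ) = |1 - γ| := by
    have := Real.sq_sqrt hγ.le
    rw [show mpLeft γ * mpRight γ = (1 - Real.sqrt γ ^ 2) ^ 2 by unfold mpLeft mpRight; ring,
      this, Real.sqrt_sq_eq_abs]
  rw [h1, h2]
  have := Real.pi_pos
  field_simp

theorem integrableOn_mpDensity {γ : ℝ} (hγ : 0 < γ) :
    IntegrableOn (mpDensity γ) (Set.Icc (mpLeft γ) (mpRight γ)) := by
  rw [mpDensity_eq γ]
  exact (integral_sqrt_div (mpLeft_nonneg γ) (mpLeft_lt_mpRight hγ)).1.const_mul _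

theorem mpContinuousPart_univ {γ : ℝ} (hγ : 0 < γ) :
    mpContinuousPart γ Set.univ = ENNReal.ofReal ((1 + γ - |1 - γ|) / (2 * γ)) := by
  rw [mpContinuousPart, withDensity_apply _ MeasurableSet.univ, Measure.restrict_univ,
    ← integral_mpDensity hγ, ofReal_integral_eq_lintegral_ofReal (integrableOn_mpDensity hγ)]
  exact (ae_restrict_iff' measurableSet_Icc).2 (ae_of_all _ fun x hx =>
    mpDensity_nonneg hγ ((mpLeft_nonneg γ).trans hx.1))

theorem isProbabilityMeasure_marchenkoPastur {γ : ℝ} (hγ : 0 < γ) :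
    IsProbabilityMeasure (marchenkoPastur γ) := by
  refine ⟨?_⟩
  rw [marchenkoPastur_eq, Measure.add_apply, mpContinuousPart_univ hγ, Measure.smul_apply,
    measure_univ, smul_eq_mul, mul_one]
  rcases le_total γ 1 with h | h
  · have h1 : 1 - 1 / γ ≤ 0 := by
      rw [sub_nonpos, le_div_iff₀ hγ]; linarith
    rw [ENNReal.ofReal_of_nonpos h1, zero_add, abs_of_nonneg (by linarith),
      show (1 + γ - (1 - γ)) / (2 * γ) = 1 by field_simp; ring, ENNReal.ofReal_one]
  · have h1 : 0 ≤ 1 - 1 / γ := by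
      rw [sub_nonneg, div_le_iff₀ hγ]; linarith
    rw [abs_of_nonpos (by linarith), ← ENNReal.ofReal_add h1
      (div_nonneg (by linarith) (by linarith)),
      show 1 - 1 / γ + (1 + γ - -(1 - γ)) / (2 * γ) = 1 by field_simp; ring, ENNReal.ofReal_one]

theorem ae_mpContinuousPart_mem (γ : ℝ) :
    ∀ᵐ s ∂(mpContinuousPart γ), s ∈ Set.Icc (mpLeft γ) (mpRight γ) :=
  (withDensity_absolutelyContinuous _ _).ae_le (ae_restrict_mem measurableSet_Icc)

theorem ae_marchenkoPastur_mem {γ : ℝ} :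
    ∀ᵐ s ∂(marchenkoPastur γ), s ∈ Set.Icc 0 (mpRight γ) := by
  rw [marchenkoPastur_eq, ae_add_measure_iff]
  constructor
  · refine Measure.ae_smul_measure ?_ _
    refine (ae_dirac_iff measurableSet_Icc).2 ?_
    exact ⟨le_rfl, sq_nonneg _⟩
  · filter_upwards [ae_mpContinuousPart_mem γ] with s hs
    exact ⟨(mpLeft_nonneg γ).trans hs.1, hs.2⟩

theorem ae_mpLeft_le_of_lt_one {γ : ℝ} (hγ : 0 < γ) (h1 : γ < 1) :
    ∀ᵐ s ∂(marchenkoPastur γ), mpLeft γ ≤ s := by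
  have h : 1 - 1 / γ ≤ 0 := by
    rw [sub_nonpos, le_div_iff₀ hγ]; linarith
  rw [marchenkoPastur_eq, ENNReal.ofReal_of_nonpos h, zero_smul, zero_add]
  filter_upwards [ae_mpContinuousPart_mem γ] with s hs using hs.1

theorem integrable_id_marchenkoPastur {γ : ℝ} (hγ : 0 < γ) :
    Integrable (fun s => s) (marchenkoPastur γ) := by
  have := isProbabilityMeasure_marchenkoPastur hγ
  refine Integrable.of_bound (by fun_prop) (mpRight γ) ?_
  filter_upwards [ae_marchenkoPastur_mem] with s hs
  rw [Real.norm_of_nonneg hs.1]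
  exact hs.2

/-- The factor `x` cancels the `1/x` in the density and leaves the area of a half-disc of diameter
`b - a = 4√γ`, which is `2πγ`. The unit mean is what makes the final constant independent of `γ`. -/
theorem integral_id_marchenkoPastur {γ : ℝ} (hγ : 0 < γ) :
    ∫ s, s ∂(marchenkoPastur γ) = 1 := by
  have hi := integrable_id_marchenkoPastur hγ
  rw [marchenkoPastur_eq] at hi ⊢
  rw [integral_add_measure hi.left_of_add_measure hi.right_of_add_measure, integral_smul_measure,
    integral_dirac, smul_zero, zero_add, mpContinuousPart,
    integral_withDensity_eq_integral_toReal_smul (measurable_mpDensity γ).ennreal_ofReal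
      (ae_of_all _ fun _ => ENNReal.ofReal_lt_top)]
  have h2 : ∫ x in Set.Icc (mpLeft γ) (mpRight γ), (ENNReal.ofReal (mpDensity γ x)).toReal • x =
      ∫ x in Set.Icc (mpLeft γ) (mpRight γ), (1 / (2 * Real.pi * γ)) *
        Real.sqrt ((mpRight γ - x) * (x - mpLeft γ)) := by
    refine setIntegral_congr_ae measurableSet_Icc ?_
    filter_upwards [Measure.ae_ne volume (0 : ℝ)] with x hx0 hx
    have h0 : 0 ≤ x := (mpLeft_nonneg γ).trans hx.1
    rw [ENNReal.toReal_ofReal (mpDensity_nonneg hγ h0), mpDensity_eq γ, smul_eq_mul]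
    field_simp
  rw [h2, integral_const_mul, integral_sqrt_mul (mpLeft_lt_mpRight hγ)]
  have h3 : mpRight γ - mpLeft γ = 4 * Real.sqrt γ := by unfold mpRight mpLeft; ring
  rw [h3, mul_pow, Real.sq_sqrt hγ.le]
  have := Real.pi_pos
  field_simp
  norm_num

/-! ### Stieltjes transform of the Marchenko–Pastur law -/

/-- `∫ 1 / (s + l)` under the Marchenko–Pastur law. -/
def mpStieltjes (γ l : ℝ) : ℝ := ∫ s, (|s| + l)⁻¹ ∂(marchenkoPastur γ)

/-- `∫ 1 / (s + l)²` under the Marchenko–Pastur law. -/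
def mpStieltjesSq (γ l : ℝ) : ℝ := ∫ s, ((|s| + l)⁻¹) ^ 2 ∂(marchenkoPastur γ)

/-- The absolute value is invisible on the support `[0, ∞)` and keeps the integrand bounded and
continuous on all of `ℝ`, as testing weak convergence requires. -/
theorem inv_abs_add_le {l : ℝ} (hl : 0 < l) (s : ℝ) : (|s| + l)⁻¹ ≤ l⁻¹ :=
  inv_anti₀ hl (by linarith [abs_nonneg s])

theorem inv_abs_add_nonneg {l : ℝ} (hl : 0 < l) (s : ℝ) : 0 ≤ (|s| + l)⁻¹ := by positivity

theorem integrable_inv_abs_add {γ l : ℝ} (hγ : 0 < γ) (hl : 0 < l) :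
    Integrable (fun s => (|s| + l)⁻¹) (marchenkoPastur γ) := by
  have := isProbabilityMeasure_marchenkoPastur hγ
  refine Integrable.of_bound (by fun_prop) l⁻¹ (ae_of_all _ fun s => ?_)
  rw [Real.norm_of_nonneg (inv_abs_add_nonneg hl s)]
  exact inv_abs_add_le hl s

/-- Jensen's inequality for the Marchenko–Pastur law. -/
theorem inv_one_add_le_mpStieltjes {γ l : ℝ} (hγ : 0 < γ) (hl : 0 < l) :
    (1 + l)⁻¹ ≤ mpStieltjes γ l := by
  have := isProbabilityMeasure_marchenkoPastur hγ
  have hi := integrable_id_marchenkoPastur hγ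
  have hi2 : Integrable (fun s => ((1 + l)⁻¹) ^ 2 * (s - 1)) (marchenkoPastur γ) :=
    (hi.sub (integrable_const 1)).const_mul _
  -- The integrand is the tangent line of `s ↦ 1/(s + l)` at the mean `s = 1`.
  have h : ∫ s, ((1 + l)⁻¹ - ((1 + l)⁻¹) ^ 2 * (s - 1)) ∂(marchenkoPastur γ) = (1 + l)⁻¹ := by
    rw [integral_sub (integrable_const _) hi2,
      integral_const_mul, integral_sub hi (integrable_const _), integral_id_marchenkoPastur hγ]
    simp
  rw [← h]
  refine integral_mono_ae ((integrable_const _).sub hi2)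
    (integrable_inv_abs_add hγ hl) ?_
  filter_upwards [ae_marchenkoPastur_mem] with s hs
  rw [abs_of_nonneg hs.1]
  have h0 := hs.1
  have h1 : 0 < s + l := by linarith
  have h2 : (s + l)⁻¹ - ((1 + l)⁻¹ - ((1 + l)⁻¹) ^ 2 * (s - 1)) =
      (s - 1) ^ 2 / ((s + l) * (1 + l) ^ 2) := by
    have : 0 < 1 + l := by linarith
    field_simp
    ring
  have h3 : 0 ≤ (s - 1) ^ 2 / ((s + l) * (1 + l) ^ 2) := by positivity
  linarith

theorem mpStieltjes_le_of_lt_one {γ l : ℝ} (hγ : 0 < γ) (h1 : γ < 1) (hl : 0 < l) :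
    mpStieltjes γ l ≤ (mpLeft γ + l)⁻¹ := by
  have := isProbabilityMeasure_marchenkoPastur hγ
  have h : ∫ _, (mpLeft γ + l)⁻¹ ∂(marchenkoPastur γ) = (mpLeft γ + l)⁻¹ := by simp
  rw [← h]
  refine integral_mono_ae (integrable_inv_abs_add hγ hl) (integrable_const _) ?_
  filter_upwards [ae_mpLeft_le_of_lt_one hγ h1] with s hs
  have := mpLeft_nonneg γ
  exact inv_anti₀ (by linarith) (by linarith [le_abs_self s])

theorem marchenkoPastur_singleton_zero (γ : ℝ) :
    marchenkoPastur γ {0} = ENNReal.ofReal (1 - 1 / γ) := by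
  have h0 : mpContinuousPart γ {0} = 0 :=
    withDensity_absolutelyContinuous _ _ (by
      refine le_antisymm ((Measure.restrict_apply_le _ _).trans ?_) bot_le
      simp)
  rw [marchenkoPastur_eq, Measure.add_apply, h0, Measure.smul_apply]
  simp

/-- Only the atom at `0` is kept, where the integrand equals `1/l`. -/
theorem div_le_mpStieltjes {γ l : ℝ} (hγ : 0 < γ) (hl : 0 < l) :
    (1 - 1 / γ) / l ≤ mpStieltjes γ l := by
  have := isProbabilityMeasure_marchenkoPastur hγ
  have h1 : ∫ s, Set.indicator {0} (fun _ => l⁻¹) s ∂(marchenkoPastur γ) ≤ mpStieltjes γ l := by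
    refine integral_mono ((integrable_const _).indicator (measurableSet_singleton 0))
      (integrable_inv_abs_add hγ hl) fun s => ?_
    by_cases hs : s = 0
    · simp [hs]
    · simp only [Set.mem_singleton_iff, hs, not_false_eq_true, Set.indicator_of_notMem]
      exact inv_abs_add_nonneg hl s
  rw [integral_indicator_const _ (measurableSet_singleton 0), Measure.real,
    marchenkoPastur_singleton_zero, smul_eq_mul] at h1
  refine le_trans ?_ h1
  rw [div_eq_mul_inv, ENNReal.toReal_ofReal']
  gcongr
  exact le_max_left _ _

theorem mpDensity_one_ge {x : ℝ} (h0 : 0 < x) (h1 : x ≤ 1) :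
    1 / (2 * Real.pi * Real.sqrt x) ≤ mpDensity 1 x := by
  have e1 : mpLeft 1 = 0 := by simp [mpLeft]
  have e2 : mpRight 1 = 4 := by simp [mpRight]; norm_num
  rw [mpDensity, e1, e2, sub_zero, mul_one, div_le_div_iff₀ (by positivity) (by positivity), one_mul]
  have hs := Real.sqrt_pos.2 h0
  have h3 : Real.sqrt x ≤ Real.sqrt ((4 - x) * x) := Real.sqrt_le_sqrt (by nlinarith)
  have h4 := Real.mul_self_sqrt h0.le
  have hp := Real.pi_pos
  calc 2 * Real.pi * x = Real.sqrt x * (2 * Real.pi * Real.sqrt x) := by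
        linear_combination -(2 * Real.pi) * h4
    _ ≤ _ := by gcongr

/-- At `γ = 1` the density is at least of order `x^(-1/2)` near `0`, so `[l, 2l]` has mass at least
`l/(2π√(2l))`, and the integrand there is at least `1/(3l)`. Hence the transform blows up as `l → 0`
although there is no atom. -/
theorem mpStieltjes_one_ge {l : ℝ} (hl : 0 < l) (hl2 : 2 * l ≤ 1) :
    1 / (6 * Real.pi * Real.sqrt (2 * l)) ≤ mpStieltjes 1 l := by
  have := isProbabilityMeasure_marchenkoPastur one_pos
  have e1 : mpLeft 1 = 0 := by simp [mpLeft]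
  have e2 : mpRight 1 = 4 := by simp [mpRight]; norm_num
  have hs : 0 < Real.sqrt (2 * l) := Real.sqrt_pos.2 (by linarith)
  have hp := Real.pi_pos
  set c : ℝ := 1 / (2 * Real.pi * Real.sqrt (2 * l)) with hc
  have hm : ENNReal.ofReal (c * l) ≤ marchenkoPastur 1 (Set.Icc l (2 * l)) := by
    rw [marchenkoPastur_eq, Measure.add_apply]
    refine le_trans ?_ le_add_self
    rw [mpContinuousPart, withDensity_apply _ measurableSet_Icc,
      Measure.restrict_restrict measurableSet_Icc, e1, e2,
      Set.inter_eq_self_of_subset_left (Set.Icc_subset_Icc hl.le (by linarith))]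
    have : ∫⁻ _ in Set.Icc l (2 * l), ENNReal.ofReal c = ENNReal.ofReal (c * l) := by
      rw [setLIntegral_const, Real.volume_Icc, ← ENNReal.ofReal_mul (by positivity)]
      ring_nf
    rw [← this]
    refine setLIntegral_mono' measurableSet_Icc fun x hx => ENNReal.ofReal_le_ofReal ?_
    have hx0 : 0 < x := hl.trans_le hx.1
    refine le_trans ?_ (mpDensity_one_ge hx0 (hx.2.trans hl2))
    have := Real.sqrt_le_sqrt hx.2
    have := Real.sqrt_pos.2 hx0
    rw [hc]
    gcongr
  have hm' : c * l ≤ (marchenkoPastur 1).real (Set.Icc l (2 * l)) :=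
    (ENNReal.ofReal_le_iff_le_toReal (measure_ne_top _ _)).1 hm
  have h1 : ∫ s, Set.indicator (Set.Icc l (2 * l)) (fun _ => (3 * l)⁻¹) s ∂(marchenkoPastur 1)
      ≤ mpStieltjes 1 l := by
    refine integral_mono ((integrable_const _).indicator measurableSet_Icc)
      (integrable_inv_abs_add one_pos hl) fun s => ?_
    by_cases hs : s ∈ Set.Icc l (2 * l)
    · simp only [hs, Set.indicator_of_mem]
      have h0 := hs.1
      have h2 := hs.2
      rw [abs_of_pos (hl.trans_le h0)]
      exact inv_anti₀ (by linarith) (by linarith)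
    · simp only [hs, not_false_eq_true, Set.indicator_of_notMem]
      exact inv_abs_add_nonneg hl s
  rw [integral_indicator_const _ measurableSet_Icc, smul_eq_mul] at h1
  refine le_trans ?_ h1
  calc 1 / (6 * Real.pi * Real.sqrt (2 * l)) = c * l * (3 * l)⁻¹ := by
        rw [hc]; field_simp; norm_num
    _ ≤ _ := by gcongr

/-- The limiting training error of ridge regression, relative to the noise. -/
def mpTrain (γ l : ℝ) : ℝ := l ^ 2 * mpStieltjesSq γ l

/-! ### Limiting training error as a function of the ridge parameter -/

theorem mpTrain_eq (γ l : ℝ) : mpTrain γ l = ∫ s, (l * (|s| + l)⁻¹) ^ 2 ∂(marchenkoPastur γ) := by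
  rw [mpTrain, mpStieltjesSq, ← integral_const_mul]
  simp only [mul_pow]

theorem norm_mpTrain_integrand_le {l : ℝ} (hl : 0 < l) (s : ℝ) :
    ‖(l * (|s| + l)⁻¹) ^ 2‖ ≤ 1 := by
  rw [Real.norm_of_nonneg (sq_nonneg _)]
  refine pow_le_one₀ (mul_nonneg hl.le (inv_abs_add_nonneg hl s)) ?_
  rw [← mul_inv_cancel₀ hl.ne']
  exact mul_le_mul_of_nonneg_left (inv_abs_add_le hl s) hl.le

theorem continuousOn_mpTrain {γ : ℝ} (hγ : 0 < γ) : ContinuousOn (mpTrain γ) (Set.Ioi 0) := by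
  have := isProbabilityMeasure_marchenkoPastur hγ
  simp only [funext (mpTrain_eq γ)]
  refine continuousOn_of_dominated (bound := fun _ => 1) ?_ ?_ (integrable_const _) ?_
  · intro l _
    exact Measurable.aestronglyMeasurable (by fun_prop)
  · intro l hl
    exact ae_of_all _ (norm_mpTrain_integrand_le hl)
  · refine ae_of_all _ fun s => ?_
    refine (ContinuousOn.mul continuousOn_id (ContinuousOn.inv₀ (by fun_prop) ?_)).pow 2
    intro l hl
    have : 0 < l := hl
    positivity

theorem tendsto_mpTrain_atTop {γ : ℝ} (hγ : 0 < γ) : Tendsto (mpTrain γ) atTop (𝓝 1) := by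
  have := isProbabilityMeasure_marchenkoPastur hγ
  simp only [funext (mpTrain_eq γ)]
  have h : (1 : ℝ) = ∫ _, 1 ∂(marchenkoPastur γ) := by simp
  rw [h]
  refine tendsto_integral_filter_of_dominated_convergence (fun _ => 1) ?_ ?_ (integrable_const _) ?_
  · exact Eventually.of_forall fun l => Measurable.aestronglyMeasurable (by fun_prop)
  · filter_upwards [eventually_gt_atTop 0] with l hl
    exact ae_of_all _ (norm_mpTrain_integrand_le hl)
  · refine ae_of_all _ fun s => ?_
    have h1 : Tendsto (fun l : ℝ => (1 - |s| * (|s| + l)⁻¹) ^ 2) atTop (𝓝 ((1 - |s| * 0) ^ 2)) :=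
      ((tendsto_const_nhds.mul (tendsto_inv_atTop_zero.comp
        (tendsto_atTop_add_const_left _ _ tendsto_id))).const_sub 1).pow 2
    simp only [mul_zero, sub_zero, one_pow] at h1
    refine h1.congr' ?_
    filter_upwards [eventually_gt_atTop 0] with l hl
    have : 0 < |s| + l := by positivity
    congr 1
    field_simp
    ring

/-- As `l → 0`, `(l/(s + l))²` tends to the indicator of `s = 0`. The limit is the mass of the atom,
the fraction of the noise that no ridge solution can fit. -/
theorem tendsto_mpTrain_zero {γ : ℝ} (hγ : 0 < γ) :
    Tendsto (mpTrain γ) (𝓝[>] 0) (𝓝 (max (1 - 1 / γ) 0)) := by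
  have := isProbabilityMeasure_marchenkoPastur hγ
  simp only [funext (mpTrain_eq γ)]
  have h : max (1 - 1 / γ) 0 =
      ∫ s, Set.indicator {0} (fun _ => (1 : ℝ)) s ∂(marchenkoPastur γ) := by
    rw [integral_indicator_const _ (measurableSet_singleton 0), Measure.real,
      marchenkoPastur_singleton_zero, smul_eq_mul, mul_one, ENNReal.toReal_ofReal']
  rw [h]
  refine tendsto_integral_filter_of_dominated_convergence (fun _ => 1) ?_ ?_ (integrable_const _) ?_
  · exact Eventually.of_forall fun l => Measurable.aestronglyMeasurable (by fun_prop)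
  · filter_upwards [self_mem_nhdsWithin] with l hl
    exact ae_of_all _ (norm_mpTrain_integrand_le hl)
  · refine ae_of_all _ fun s => ?_
    by_cases hs : s = 0
    · simp only [hs, Set.mem_singleton_iff, Set.indicator_of_mem, abs_zero, zero_add]
      refine tendsto_const_nhds.congr' ?_
      filter_upwards [self_mem_nhdsWithin] with l hl
      rw [mul_inv_cancel₀ (ne_of_gt hl), one_pow]
    · simp only [hs, Set.mem_singleton_iff, not_false_eq_true, Set.indicator_of_notMem]
      have hs' : |s| + 0 ≠ 0 := by simpa using hs
      have h1 : Tendsto (fun l : ℝ => (l * (|s| + l)⁻¹) ^ 2) (𝓝 0)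
          (𝓝 ((0 * (|s| + 0)⁻¹) ^ 2)) :=
        (tendsto_id.mul ((tendsto_const_nhds.add tendsto_id).inv₀ hs')).pow 2
      simp only [zero_mul, ne_eq, OfNat.ofNat_ne_zero, not_false_eq_true, zero_pow] at h1
      exact h1.mono_left nhdsWithin_le_nhds

/-- There are ridge parameters whose limiting training error approaches `τ` from below. -/
theorem exists_mpTrain_lt {γ τ δ : ℝ} (hγ : 0 < γ) (h1 : max (1 - 1 / γ) 0 < τ) (h2 : τ ≤ 1)
    (hδ : 0 < δ) : ∃ l, 0 < l ∧ mpTrain γ l < τ ∧ (τ - mpTrain γ l) / l < δ := by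
  obtain ⟨l₁, hl₁, hl₁0⟩ := (((tendsto_mpTrain_zero hγ).eventually (gt_mem_nhds h1)).and
    self_mem_nhdsWithin).exists
  have hl₁0 : 0 < l₁ := hl₁0
  -- The intermediate value aimed at is `τ - d`. It lies above the value at `l₁`, and below `1` even
  -- when `τ = 1`; the solution satisfies `l ≥ l₁`, so `d/l ≤ δ/2`.
  set d := min (δ * l₁ / 2) ((τ - mpTrain γ l₁) / 2) with hd
  have hd0 : 0 < d := lt_min (by positivity) (by linarith)
  have hd1 : d ≤ δ * l₁ / 2 := min_le_left _ _
  have hd2 : d ≤ (τ - mpTrain γ l₁) / 2 := min_le_right _ _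
  obtain ⟨l₂, hl₂, hl₂1⟩ := (((tendsto_mpTrain_atTop hγ).eventually
    (lt_mem_nhds (show τ - d < 1 by linarith))).and (eventually_ge_atTop l₁)).exists
  obtain ⟨l, hl, hlT⟩ := intermediate_value_Icc hl₂1
    ((continuousOn_mpTrain hγ).mono fun x hx => hl₁0.trans_le hx.1)
    (show τ - d ∈ Set.Icc (mpTrain γ l₁) (mpTrain γ l₂) from ⟨by linarith, hl₂.le⟩)
  have hl0 : 0 < l := hl₁0.trans_le hl.1
  refine ⟨l, hl0, by linarith, ?_⟩
  rw [hlT, div_lt_iff₀ hl0]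
  have : δ * l₁ ≤ δ * l := mul_le_mul_of_nonneg_left hl.1 hδ.le
  nlinarith

/-! ### The limiting minimal excess error -/

/-- The limiting minimal excess error: the value of the dual of the limiting ridge problem. -/
def limitExcess (σ τ γ : ℝ) : ℝ≥0∞ :=
  ⨆ l : Set.Ioi (0 : ℝ), ENNReal.ofReal (γ * (σ ^ 2 * mpStieltjes γ l - τ * σ ^ 2 / l))

theorem le_limitExcess (σ τ γ : ℝ) {l : ℝ} (hl : 0 < l) :
    ENNReal.ofReal (γ * (σ ^ 2 * mpStieltjes γ l - τ * σ ^ 2 / l)) ≤ limitExcess σ τ γ :=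
  le_iSup (fun l : Set.Ioi (0 : ℝ) =>
    ENNReal.ofReal (γ * (σ ^ 2 * mpStieltjes γ l - τ * σ ^ 2 / l))) ⟨l, hl⟩

theorem limitExcess_antitone (σ : ℝ) {γ : ℝ} (hγ : 0 < γ) :
    Antitone fun τ => limitExcess σ τ γ := by
  intro s t hst
  refine iSup_mono fun l => ENNReal.ofReal_le_ofReal ?_
  have hl : (0 : ℝ) < l := l.2
  gcongr

/-- A supremum of functions continuous in `τ` is lower semicontinuous; monotonicity supplies the
upper half, but only from the right. -/
theorem tendsto_limitExcess_right (σ τ : ℝ) {γ : ℝ} (hγ : 0 < γ) :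
    Tendsto (fun t => limitExcess σ t γ) (𝓝[>] τ) (𝓝 (limitExcess σ τ γ)) := by
  refine tendsto_order.2 ⟨fun a ha => ?_, fun a ha => ?_⟩
  · obtain ⟨l, hl⟩ := lt_iSup_iff.1 ha
    have hc : Continuous fun t : ℝ =>
        ENNReal.ofReal (γ * (σ ^ 2 * mpStieltjes γ l - t * σ ^ 2 / l)) :=
      ENNReal.continuous_ofReal.comp (by fun_prop)
    have := (hc.tendsto τ).eventually (lt_mem_nhds hl)
    filter_upwards [this.filter_mono nhdsWithin_le_nhds] with t ht
    exact ht.trans_le (le_limitExcess σ t γ l.2)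
  · filter_upwards [self_mem_nhdsWithin] with t ht
    exact (limitExcess_antitone σ hγ (le_of_lt ht)).trans_lt ha

theorem le_limitExcess_bound (σ : ℝ) {τ γ : ℝ} (hτ : τ ∈ Set.Icc (0 : ℝ) 1) (hγ : 0 < γ) :
    ENNReal.ofReal (σ ^ 2 * γ * (1 - Real.sqrt τ) ^ 2) ≤ limitExcess σ τ γ := by
  have key : ∀ l : ℝ, 0 < l →
      ENNReal.ofReal (σ ^ 2 * γ * ((1 + l)⁻¹ - τ / l)) ≤ limitExcess σ τ γ := by
    intro l hl
    refine le_trans (ENNReal.ofReal_le_ofReal ?_) (le_limitExcess σ τ γ hl)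
    have h := mul_le_mul_of_nonneg_left (inv_one_add_le_mpStieltjes hγ hl)
      (mul_nonneg hγ.le (sq_nonneg σ))
    have e : γ * (σ ^ 2 * mpStieltjes γ l - τ * σ ^ 2 / l) =
      γ * σ ^ 2 * mpStieltjes γ l - σ ^ 2 * γ * (τ / l) := by ring
    rw [e]
    linarith
  -- The maximiser of `1/(1 + l) - τ/l` is `l = √τ/(1 - √τ)`. It degenerates to `0` at `τ = 0`,
  -- where the limit `l → 0` is taken, and to `∞` at `τ = 1`, where the bound is `0`.
  rcases hτ.1.eq_or_lt with h | h
  · subst h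
    have hc : Tendsto (fun l : ℝ => ENNReal.ofReal (σ ^ 2 * γ * ((1 + l)⁻¹ - 0 / l))) (𝓝[>] 0)
        (𝓝 (ENNReal.ofReal (σ ^ 2 * γ * (1 + 0)⁻¹))) := by
      simp only [zero_div, sub_zero]
      refine ENNReal.tendsto_ofReal (tendsto_const_nhds.mul ?_)
      exact ((tendsto_const_nhds.add tendsto_id).inv₀ (by norm_num)).mono_left nhdsWithin_le_nhds
    have := le_of_tendsto hc (by
      filter_upwards [self_mem_nhdsWithin] with l hl using key l hl)
    simpa using this
  rcases hτ.2.eq_or_lt with h1 | h1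
  · simp [h1]
  have h2 : 0 < Real.sqrt τ := Real.sqrt_pos.2 h
  have h3 : Real.sqrt τ < 1 := by
    rw [Real.sqrt_lt' one_pos]; simpa using h1
  have h4 := Real.sq_sqrt hτ.1
  have h5 : 0 < 1 - Real.sqrt τ := by linarith
  have := key (Real.sqrt τ / (1 - Real.sqrt τ)) (by positivity)
  convert this using 3
  have h6 : (1 + Real.sqrt τ / (1 - Real.sqrt τ))⁻¹ = 1 - Real.sqrt τ := by
    have : 1 + Real.sqrt τ / (1 - Real.sqrt τ) = 1 / (1 - Real.sqrt τ) := by field_simp; ring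
    rw [this, one_div, inv_inv]
  rw [h6]
  generalize Real.sqrt τ = r at *
  rw [← h4]
  field_simp

/-- For `γ < 1` there is no atom and the law lives on `[a, ∞)` with `a > 0`, so the transform is at
most `1/(a + l)`. Completing the square shows `1/(a + l) - τ/l ≤ (1 - √τ)²/a`. -/
theorem limitExcess_le_bound (σ : ℝ) {τ γ : ℝ} (hτ : 0 ≤ τ) (hγ : 0 < γ) (h1 : γ < 1) :
    limitExcess σ τ γ ≤ ENNReal.ofReal (γ * (σ ^ 2 * (1 - Real.sqrt τ) ^ 2 / mpLeft γ)) := by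
  have ha : 0 < mpLeft γ := by
    have : Real.sqrt γ < 1 := by
      rw [Real.sqrt_lt' one_pos]; simpa using h1
    unfold mpLeft
    have : 0 < 1 - Real.sqrt γ := by linarith
    positivity
  refine iSup_le fun l => ENNReal.ofReal_le_ofReal (mul_le_mul_of_nonneg_left ?_ hγ.le)
  have hl : (0 : ℝ) < l := l.2
  have h2 := mpStieltjes_le_of_lt_one hγ h1 hl
  have h4 := Real.sq_sqrt hτ
  have h3 : (mpLeft γ + l)⁻¹ - τ / l ≤ (1 - Real.sqrt τ) ^ 2 / mpLeft γ := by
    generalize Real.sqrt τ = r at *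
    have e : (1 - r) ^ 2 / mpLeft γ - ((mpLeft γ + l)⁻¹ - τ / l) =
        ((1 - r) * l - r * mpLeft γ) ^ 2 / (mpLeft γ * l * (mpLeft γ + l)) := by
      rw [← h4]
      field_simp
      ring
    have : 0 ≤ ((1 - r) * l - r * mpLeft γ) ^ 2 / (mpLeft γ * l * (mpLeft γ + l)) := by positivity
    linarith
  calc σ ^ 2 * mpStieltjes γ l - τ * σ ^ 2 / l = σ ^ 2 * (mpStieltjes γ l - τ / l) := by ring
    _ ≤ σ ^ 2 * ((1 - Real.sqrt τ) ^ 2 / mpLeft γ) := by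
        gcongr
        linarith
    _ = _ := by ring

theorem le_limitExcess_div (σ : ℝ) {τ γ : ℝ} (hτ : τ ∈ Set.Icc (0 : ℝ) 1) (hγ : 0 < γ) :
    ENNReal.ofReal (σ ^ 2 * (1 - Real.sqrt τ) ^ 2) ≤
      limitExcess σ τ γ / ENNReal.ofReal γ := by
  rw [ENNReal.le_div_iff_mul_le (Or.inl (by simpa using hγ)) (Or.inl ENNReal.ofReal_ne_top),
    ← ENNReal.ofReal_mul (by positivity)]
  convert le_limitExcess_bound σ hτ hγ using 2
  ring

theorem tendsto_limitExcess_div (σ : ℝ) {τ : ℝ} (hτ : τ ∈ Set.Icc (0 : ℝ) 1) :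
    Tendsto (fun γ => limitExcess σ τ γ / ENNReal.ofReal γ) (𝓝[>] 0)
      (𝓝 (ENNReal.ofReal (σ ^ 2 * (1 - Real.sqrt τ) ^ 2))) := by
  have hc : Tendsto (fun γ => ENNReal.ofReal (σ ^ 2 * (1 - Real.sqrt τ) ^ 2 / mpLeft γ)) (𝓝[>] 0)
      (𝓝 (ENNReal.ofReal (σ ^ 2 * (1 - Real.sqrt τ) ^ 2 / 1))) := by
    refine ENNReal.tendsto_ofReal (tendsto_const_nhds.div ?_ one_ne_zero)
    have : Continuous mpLeft := by unfold mpLeft; fun_prop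
    have h := this.tendsto 0
    simp only [mpLeft, Real.sqrt_zero, sub_zero, one_pow] at h
    exact h.mono_left nhdsWithin_le_nhds
  rw [div_one] at hc
  refine tendsto_of_tendsto_of_tendsto_of_le_of_le' tendsto_const_nhds hc ?_ ?_
  · filter_upwards [self_mem_nhdsWithin] with γ hγ using le_limitExcess_div σ hτ hγ
  · filter_upwards [Ioo_mem_nhdsGT (zero_lt_one (α := ℝ))] with γ hγ
    refine ENNReal.div_le_of_le_mul ?_
    rw [mul_comm, ← ENNReal.ofReal_mul hγ.1.le]
    exact limitExcess_le_bound σ hτ.1 hγ.1 hγ.2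

theorem iInf_limitExcess_div (σ : ℝ) {τ : ℝ} (hτ : τ ∈ Set.Icc (0 : ℝ) 1) :
    (⨅ γ : Set.Ioi (0 : ℝ), limitExcess σ τ γ / ENNReal.ofReal γ) =
      ENNReal.ofReal (σ ^ 2 * (1 - Real.sqrt τ) ^ 2) := by
  refine le_antisymm (ge_of_tendsto (tendsto_limitExcess_div σ hτ) ?_)
    (le_iInf fun γ => le_limitExcess_div σ hτ γ.2)
  filter_upwards [self_mem_nhdsWithin] with γ hγ
  exact iInf_le (fun γ : Set.Ioi (0 : ℝ) => limitExcess σ τ γ / ENNReal.ofReal γ) ⟨γ, hγ⟩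

/-! ### Parameters at which the limit is infinite -/

theorem limitExcess_eq_top_of_lt {σ τ γ : ℝ} (hσ : σ ≠ 0) (hγ : 0 < γ) (h : τ < 1 - 1 / γ) :
    limitExcess σ τ γ = ∞ := by
  refine ENNReal.eq_top_of_forall_nnreal_le fun r => ?_
  have hs : 0 < σ ^ 2 := by positivity
  have hd : 0 < γ * σ ^ 2 * (1 - 1 / γ - τ) := mul_pos (mul_pos hγ hs) (by linarith)
  -- The atom alone makes the dual value at `l` at least `γσ²(1 - 1/γ - τ)/l`; this choice turns
  -- that into `r + 1`.
  set l : ℝ := γ * σ ^ 2 * (1 - 1 / γ - τ) / (r + 1) with hl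
  have hr : (0 : ℝ) ≤ r := r.2
  have hl0 : 0 < l := by positivity
  refine le_trans ?_ (le_limitExcess σ τ γ hl0)
  rw [← ENNReal.ofReal_coe_nnreal]
  refine ENNReal.ofReal_le_ofReal ?_
  have h1 := mul_le_mul_of_nonneg_left (div_le_mpStieltjes hγ hl0) (mul_pos hγ hs).le
  have h2 : γ * σ ^ 2 * ((1 - 1 / γ) / l) - γ * (τ * σ ^ 2 / l) = r + 1 := by
    rw [hl]
    have : 1 - 1 / γ - τ ≠ 0 := by linarith
    generalize 1 - 1 / γ = q at *
    field_simp
  have h3 : γ * (σ ^ 2 * mpStieltjes γ l - τ * σ ^ 2 / l) =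
    γ * σ ^ 2 * mpStieltjes γ l - γ * (τ * σ ^ 2 / l) := by ring
  linarith

theorem limitExcess_zero_one_eq_top {σ : ℝ} (hσ : σ ≠ 0) : limitExcess σ 0 1 = ∞ := by
  refine ENNReal.eq_top_of_forall_nnreal_le fun r => ?_
  have hs : 0 < σ ^ 2 := by positivity
  have ht : Tendsto (fun l : ℝ => σ ^ 2 * (1 / (6 * Real.pi * Real.sqrt (2 * l)))) (𝓝[>] 0)
      atTop := by
    refine Tendsto.const_mul_atTop hs ?_
    simp only [one_div]
    refine tendsto_inv_nhdsGT_zero.comp ?_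
    refine tendsto_nhdsWithin_iff.2 ⟨?_, ?_⟩
    · have : Continuous fun l : ℝ => 6 * Real.pi * Real.sqrt (2 * l) := by fun_prop
      have h := this.tendsto 0
      simp only [mul_zero, Real.sqrt_zero] at h
      exact h.mono_left nhdsWithin_le_nhds
    · filter_upwards [self_mem_nhdsWithin] with l hl
      have : 0 < l := hl
      exact Set.mem_Ioi.2 (by positivity)
  obtain ⟨l, hl, hl'⟩ := ((ht.eventually_ge_atTop (r : ℝ)).and
    (Ioo_mem_nhdsGT (show (0 : ℝ) < 1 / 2 by norm_num))).exists
  refine le_trans ?_ (le_limitExcess σ 0 1 hl'.1)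
  rw [← ENNReal.ofReal_coe_nnreal]
  refine ENNReal.ofReal_le_ofReal ?_
  have := mul_le_mul_of_nonneg_left (mpStieltjes_one_ge hl'.1 (by linarith [hl'.2])) hs.le
  simp only [zero_mul, zero_div, sub_zero, one_mul]
  linarith

/-! ### Reduction of the excess loss to a least norm problem -/

theorem invSqrt_transpose {p : ℕ} (A : Matrix (Fin p) (Fin p) ℝ) : (invSqrt A)ᵀ = invSqrt A := by
  have h : IsSelfAdjoint (invSqrt A) := IsSelfAdjoint.cfc
  rw [IsSelfAdjoint, Matrix.star_eq_conjTranspose,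
    Matrix.conjTranspose_eq_transpose_of_trivial] at h
  exact h

theorem invSqrt_mul_mul_invSqrt {p : ℕ} {A : Matrix (Fin p) (Fin p) ℝ} (hA : A.PosDef) :
    invSqrt A * A * invSqrt A = 1 := by
  have hsa : IsSelfAdjoint A := hA.isHermitian
  have hfin : (spectrum ℝ A).Finite := Matrix.finite_real_spectrum
  -- The spectrum is finite, so every function is continuous on it and the calculus applies to
  -- `(√t)⁻¹` as it stands.
  have hc : ∀ f : ℝ → ℝ, ContinuousOn f (spectrum ℝ A) := fun f => hfin.continuousOn f
  have hpos : ∀ t ∈ spectrum ℝ A, 0 < t := by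
    intro t ht
    rw [hA.isHermitian.spectrum_real_eq_range_eigenvalues] at ht
    obtain ⟨i, rfl⟩ := ht
    exact hA.eigenvalues_pos i
  have h1 : invSqrt A * A * invSqrt A =
      cfc (fun t : ℝ => (Real.sqrt t)⁻¹ * id t * (Real.sqrt t)⁻¹) A := by
    rw [cfc_mul (fun t : ℝ => (Real.sqrt t)⁻¹ * id t) _ A (hc _) (hc _),
      cfc_mul _ _ A (hc _) (hc _), cfc_id ℝ A]
    rfl
  rw [h1, ← cfc_one ℝ A]
  refine cfc_congr fun t ht => ?_
  have := Real.sqrt_pos.2 (hpos t ht)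
  have h2 := Real.mul_self_sqrt (hpos t ht).le
  simp only [id, Pi.one_apply]
  field_simp
  linarith

theorem featureMatrix_mulVec {X : Type v} {n p : ℕ} (φ : X → Fin p → ℝ) (x : Fin n → X)
    (β : Fin p → ℝ) (i : Fin n) : (featureMatrix φ x *ᵥ β) i = linPred φ β (x i) := by
  rw [linPred, dotProduct_comm]
  rfl

theorem measurable_linPred {X : Type v} [MeasurableSpace X] {p : ℕ} {φ : X → Fin p → ℝ}
    (hφ : Measurable φ) (β : Fin p → ℝ) : Measurable (linPred φ β) := by
  have h : linPred φ β = fun x => ∑ i, β i * φ x i := rfl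
  rw [h]
  exact Finset.measurable_fun_sum _ fun i _ => ((measurable_pi_apply i).comp hφ).const_mul _

theorem integral_linPred_sq {X : Type v} [MeasurableSpace X] (PX : Measure X) {p : ℕ}
    {φ : X → Fin p → ℝ} (hφ : ∀ j, MemLp (fun x => φ x j) 2 PX) (d : Fin p → ℝ) :
    Integrable (fun x => (linPred φ d x) ^ 2) PX ∧
      ∫ x, (linPred φ d x) ^ 2 ∂PX = d ⬝ᵥ (featureCov PX φ *ᵥ d) := by
  have h : ∀ x, (linPred φ d x) ^ 2 = ∑ i, ∑ j, d i * (φ x i * φ x j * d j) := by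
    intro x
    rw [linPred, sq, dotProduct, Finset.sum_mul_sum]
    refine Finset.sum_congr rfl fun i _ => Finset.sum_congr rfl fun j _ => by ring
  have hi : ∀ i j, Integrable (fun x => d i * (φ x i * φ x j * d j)) PX := fun i j =>
    (((hφ i).integrable_mul (hφ j)).mul_const (d j)).const_mul (d i)
  simp only [h]
  refine ⟨integrable_finsetSum _ fun i _ => integrable_finsetSum _ fun j _ => hi i j, ?_⟩
  rw [integral_finsetSum _ fun i _ => integrable_finsetSum _ fun j _ => hi i j]
  rw [dotProduct]
  refine Finset.sum_congr rfl fun i _ => ?_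
  rw [integral_finsetSum _ fun j _ => hi i j, Matrix.mulVec, dotProduct, Finset.mul_sum]
  refine Finset.sum_congr rfl fun j _ => ?_
  rw [integral_const_mul, integral_mul_const]
  rfl

theorem lintegral_noise_sub_sq {ν : Measure ℝ} [IsProbabilityMeasure ν] {σ : ℝ}
    (h1 : Integrable (fun e => e) ν) (h2 : Integrable (fun e => e ^ 2) ν)
    (hm : (∫ e, e ∂ν) = 0) (hv : (∫ e, e ^ 2 ∂ν) = σ ^ 2) (c : ℝ) :
    ∫⁻ e, ENNReal.ofReal ((e - c) ^ 2) ∂ν = ENNReal.ofReal (σ ^ 2 + c ^ 2) := by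
  have h : ∀ e : ℝ, (e - c) ^ 2 = e ^ 2 - 2 * c * e + c ^ 2 := fun e => by ring
  have hi : Integrable (fun e : ℝ => e ^ 2 - 2 * c * e) ν := h2.sub (h1.const_mul _)
  rw [← ofReal_integral_eq_lintegral_ofReal]
  · simp only [h]
    rw [integral_add hi (integrable_const _), integral_sub h2 (h1.const_mul _),
      integral_const_mul, hm, hv]
    simp
  · simp only [h]
    exact hi.add (integrable_const _)
  · exact ae_of_all _ fun e => sq_nonneg _

theorem risk_eq {X : Type v} [MeasurableSpace X] {P : Measure (X × ℝ)} [IsProbabilityMeasure P]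
    {p : ℕ} {φ : X → Fin p → ℝ} (hφ : Measurable φ) {ν : Measure ℝ} [IsProbabilityMeasure ν]
    {σ : ℝ} (h1 : Integrable (fun e => e) ν) (h2 : Integrable (fun e => e ^ 2) ν)
    (hm : (∫ e, e ∂ν) = 0) (hv : (∫ e, e ^ 2 ∂ν) = σ ^ 2) {βs : Fin p → ℝ}
    (hP : P = (P.fst.prod ν).map fun z => (z.1, linPred φ βs z.1 + z.2))
    {f : X → ℝ} (hf : Measurable f) :
    risk P f = ∫⁻ x, ENNReal.ofReal (σ ^ 2 + (f x - linPred φ βs x) ^ 2) ∂P.fst := by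
  have hl := measurable_linPred hφ βs
  have hg : Measurable fun z : X × ℝ => (z.1, linPred φ βs z.1 + z.2) := by fun_prop
  have hF : Measurable fun z : X × ℝ => ENNReal.ofReal ((z.2 - f z.1) ^ 2) := by fun_prop
  calc risk P f = ∫⁻ z, ENNReal.ofReal ((z.2 - f z.1) ^ 2)
        ∂((P.fst.prod ν).map fun z => (z.1, linPred φ βs z.1 + z.2)) := by rw [← hP, risk]
    _ = ∫⁻ x, ∫⁻ e, ENNReal.ofReal ((e - (f x - linPred φ βs x)) ^ 2) ∂ν ∂P.fst := by
        rw [lintegral_map hF hg, lintegral_prod _ (by fun_prop)]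
        refine lintegral_congr fun x => lintegral_congr fun e => ?_
        congr 1
        ring
    _ = _ := lintegral_congr fun x => lintegral_noise_sub_sq h1 h2 hm hv _

/-- Integrating out the noise first gives risk `σ² + E(f - β⋆ᵀφ)²` for every measurable `f`. So the
Bayes risk is `σ²`, attained at `β⋆ᵀφ`, and the excess is a quadratic form in `β - β⋆`. -/
theorem excessLoss_linPred {X : Type v} [MeasurableSpace X] {P : Measure (X × ℝ)}
    [IsProbabilityMeasure P] {p : ℕ} {φ : X → Fin p → ℝ} (hφ : Measurable φ)
    (hL : ∀ j, MemLp (fun x => φ x j) 2 P.fst) {ν : Measure ℝ} [IsProbabilityMeasure ν]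
    {σ : ℝ} (h1 : Integrable (fun e => e) ν) (h2 : Integrable (fun e => e ^ 2) ν)
    (hm : (∫ e, e ∂ν) = 0) (hv : (∫ e, e ^ 2 ∂ν) = σ ^ 2) {βs : Fin p → ℝ}
    (hP : P = (P.fst.prod ν).map fun z => (z.1, linPred φ βs z.1 + z.2)) (β : Fin p → ℝ) :
    excessLoss P (linPred φ β) =
      ENNReal.ofReal ((β - βs) ⬝ᵥ (featureCov P.fst φ *ᵥ (β - βs))) := by
  have hb : bayesRisk P = ENNReal.ofReal (σ ^ 2) := by
    refine le_antisymm ((iInf₂_le (linPred φ βs) (measurable_linPred hφ βs)).trans ?_)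
      (le_iInf₂ fun f hf => ?_)
    · rw [risk_eq hφ h1 h2 hm hv hP (measurable_linPred hφ βs)]
      simp
    · rw [risk_eq hφ h1 h2 hm hv hP hf]
      calc ENNReal.ofReal (σ ^ 2) = ∫⁻ _, ENNReal.ofReal (σ ^ 2) ∂P.fst := by simp
        _ ≤ _ := lintegral_mono fun x => ENNReal.ofReal_le_ofReal
            (le_add_of_nonneg_right (sq_nonneg _))
  have hd : ∀ x, linPred φ β x - linPred φ βs x = linPred φ (β - βs) x := by
    intro x
    simp [linPred, sub_dotProduct]
  obtain ⟨hi, he⟩ := integral_linPred_sq P.fst hL (β - βs)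
  have hi2 : Integrable (fun x => σ ^ 2 + linPred φ (β - βs) x ^ 2) P.fst :=
    (integrable_const _).add hi
  rw [excessLoss, hb, risk_eq hφ h1 h2 hm hv hP (measurable_linPred hφ β)]
  simp only [hd]
  rw [← ofReal_integral_eq_lintegral_ofReal hi2
    (ae_of_all _ fun x => add_nonneg (sq_nonneg _) (sq_nonneg _)),
    integral_add (integrable_const _) hi, he, ← ENNReal.ofReal_sub _ (sq_nonneg σ)]
  simp

theorem minExcessLoss_eq_minNormSq {X : Type v} [MeasurableSpace X] {P : Measure (X × ℝ)}
    [IsProbabilityMeasure P] {n p : ℕ} {φ : X → Fin p → ℝ} (hφ : Measurable φ)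
    (hL : ∀ j, MemLp (fun x => φ x j) 2 P.fst) (hpd : (featureCov P.fst φ).PosDef)
    {ν : Measure ℝ} [IsProbabilityMeasure ν]
    {σ : ℝ} (h1 : Integrable (fun e => e) ν) (h2 : Integrable (fun e => e ^ 2) ν)
    (hm : (∫ e, e ∂ν) = 0) (hv : (∫ e, e ^ 2 ∂ν) = σ ^ 2) {βs : Fin p → ℝ}
    (hP : P = (P.fst.prod ν).map fun z => (z.1, linPred φ βs z.1 + z.2))
    (x : Fin n → X) (y : Fin n → ℝ) (level : ℝ) :
    minExcessLoss P φ x y level =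
      minNormSq (whitened P.fst φ x) (fun i => y i - linPred φ βs (x i)) level := by
  set A := featureCov P.fst φ with hA
  have hS := invSqrt_mul_mul_invSqrt hpd
  have hSt := invSqrt_transpose A
  have hS2 : invSqrt A * (invSqrt A * A) = 1 := by
    have h3 : (invSqrt A * A) * invSqrt A = 1 := hS
    exact mul_eq_one_comm.1 h3
  have htrain : ∀ u : Fin p → ℝ, trainLoss x y (linPred φ (βs + invSqrt A *ᵥ u)) =
      (1 / (n : ℝ)) * (((fun i => y i - linPred φ βs (x i)) - whitened P.fst φ x *ᵥ u) ⬝ᵥ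
        ((fun i => y i - linPred φ βs (x i)) - whitened P.fst φ x *ᵥ u)) := by
    intro u
    rw [trainLoss, dotProduct]
    congr 1
    refine Finset.sum_congr rfl fun i _ => ?_
    rw [Pi.sub_apply, whitened, ← Matrix.mulVec_mulVec, featureMatrix_mulVec, ← hA]
    simp only [linPred, add_dotProduct]
    ring
  have hex : ∀ u : Fin p → ℝ, excessLoss P (linPred φ (βs + invSqrt A *ᵥ u)) =
      ENNReal.ofReal (u ⬝ᵥ u) := by
    intro u
    rw [excessLoss_linPred hφ hL h1 h2 hm hv hP, add_sub_cancel_left, mulVec_dotProduct_eq, hSt,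
      Matrix.mulVec_mulVec, Matrix.mulVec_mulVec, ← hA, hS, Matrix.one_mulVec]
  refine le_antisymm (le_iInf₂ fun u hu => ?_) (le_iInf₂ fun β hβ => ?_)
  · rw [← hex u]
    exact iInf₂_le (βs + invSqrt A *ᵥ u) (by rw [htrain]; exact hu)
  · have hβ' : β = βs + invSqrt A *ᵥ ((invSqrt A * A) *ᵥ (β - βs)) := by
      rw [Matrix.mulVec_mulVec, hS2, Matrix.one_mulVec, add_sub_cancel]
    rw [hβ'] at hβ ⊢
    rw [hex]
    exact iInf₂_le _ (by rw [← htrain]; exact hβ)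

/-! ### Fourth moments of linear and quadratic forms in independent variables -/

section Moments

theorem integral_indep_pow {Ω : Type*} [MeasurableSpace Ω] {μ : Measure Ω}
    {f g : Ω → ℝ} (h : IndepFun f g μ) (hf : Measurable f) (hg : Measurable g) (i j : ℕ) :
    ∫ ω, f ω ^ i * g ω ^ j ∂μ = (∫ ω, f ω ^ i ∂μ) * ∫ ω, g ω ^ j ∂μ :=
  (h.comp (measurable_id.pow_const i) (measurable_id.pow_const j)).integral_fun_mul_eq_mul_integral
    (hf.pow_const i).aestronglyMeasurable (hg.pow_const j).aestronglyMeasurable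

/-- A function of the variables in `s` is independent of any other variable. -/
theorem indepFun_of_dependsOn {Ω ι : Type*} [MeasurableSpace Ω] {μ : Measure Ω}
    {X : ι → Ω → ℝ} (hind : iIndepFun X μ)
    (hm : ∀ i, Measurable (X i)) {s : Finset ι} {a : ι} (ha : a ∉ s) {G : (ι → ℝ) → ℝ}
    (hG : Measurable G) (hGs : ∀ z z' : ι → ℝ, (∀ i ∈ s, z i = z' i) → G z = G z') :
    IndepFun (fun ω => G fun i => X i ω) (X a) μ := by
  classical
  have h := hind.indepFun_finset s {a} (Finset.disjoint_singleton_right.2 ha) hm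
  set ext : (s → ℝ) → ι → ℝ := fun z i => if h : i ∈ s then z ⟨i, h⟩ else 0 with hext
  have hext_m : Measurable ext := by
    refine measurable_pi_lambda _ fun i => ?_
    by_cases hi : i ∈ s
    · simp only [hext, hi, dif_pos]
      exact measurable_pi_apply _
    · simp only [hext, hi, dif_neg, not_false_eq_true]
      exact measurable_const
  have h2 := h.comp (hG.comp hext_m)
    (measurable_pi_apply (⟨a, Finset.mem_singleton_self a⟩ : ({a} : Finset ι)))
  refine (h2.congr (ae_of_all _ fun ω => ?_) (ae_of_all _ fun ω => rfl))
  refine hGs _ _ fun i hi => ?_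
  simp [hext, hi]

variable {Ω : Type*} [MeasurableSpace Ω] {μ : Measure Ω} [IsProbabilityMeasure μ]

theorem abs_pow_mul_pow_le (x y : ℝ) {i j : ℕ} (h : i + j ≤ 4) :
    |x ^ i * y ^ j| ≤ 1 + x ^ 4 + y ^ 4 := by
  set m := max 1 (max |x| |y|) with hm
  have h1 : 1 ≤ m := le_max_left _ _
  have hx : |x| ≤ m := (le_max_left _ _).trans (le_max_right _ _)
  have hy : |y| ≤ m := (le_max_right _ _).trans (le_max_right _ _)
  have h2 : |x ^ i * y ^ j| ≤ m ^ 4 := by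
    rw [abs_mul, abs_pow, abs_pow]
    calc |x| ^ i * |y| ^ j ≤ m ^ i * m ^ j := by gcongr
      _ = m ^ (i + j) := (pow_add _ _ _).symm
      _ ≤ m ^ 4 := pow_le_pow_right₀ h1 h
  refine h2.trans ?_
  have hx4 : 0 ≤ x ^ 4 := by positivity
  have hy4 : 0 ≤ y ^ 4 := by positivity
  rcases max_choice 1 (max |x| |y|) with h | h
  · rw [hm, h]; linarith
  · rcases max_choice |x| |y| with h' | h'
    · rw [hm, h, h', ← abs_pow, abs_of_nonneg hx4]; linarith
    · rw [hm, h, h', ← abs_pow, abs_of_nonneg hy4]; linarith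

theorem integrable_pow_mul_pow {f g : Ω → ℝ} (hf : Measurable f) (hg : Measurable g)
    (hf4 : Integrable (fun ω => f ω ^ 4) μ) (hg4 : Integrable (fun ω => g ω ^ 4) μ) {i j : ℕ}
    (h : i + j ≤ 4) : Integrable (fun ω => f ω ^ i * g ω ^ j) μ :=
  Integrable.mono' (((integrable_const (1 : ℝ)).add hf4).add hg4)
    (Measurable.aestronglyMeasurable (by fun_prop))
    (ae_of_all _ fun ω => abs_pow_mul_pow_le (f ω) (g ω) h)

theorem integrable_pow_of_four {f : Ω → ℝ} (hf : Measurable f)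
    (hf4 : Integrable (fun ω => f ω ^ 4) μ) {i : ℕ} (h : i ≤ 4) :
    Integrable (fun ω => f ω ^ i) μ := by
  simpa using integrable_pow_mul_pow hf hf hf4 hf4 (show i + 0 ≤ 4 by omega)

theorem add_pow_four (x y : ℝ) : (x + y) ^ 4 =
    x ^ 4 + 4 * (x ^ 3 * y ^ 1) + 6 * (x ^ 2 * y ^ 2) + 4 * (x ^ 1 * y ^ 3) + y ^ 4 := by ring

theorem integrable_add_pow_four {f g : Ω → ℝ} (hf : Measurable f) (hg : Measurable g)
    (hf4 : Integrable (fun ω => f ω ^ 4) μ) (hg4 : Integrable (fun ω => g ω ^ 4) μ) :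
    Integrable (fun ω => (f ω + g ω) ^ 4) μ ∧
    ∫ ω, (f ω + g ω) ^ 4 ∂μ = ∫ ω, f ω ^ 4 ∂μ + 4 * ∫ ω, f ω ^ 3 * g ω ^ 1 ∂μ +
      6 * ∫ ω, f ω ^ 2 * g ω ^ 2 ∂μ + 4 * ∫ ω, f ω ^ 1 * g ω ^ 3 ∂μ + ∫ ω, g ω ^ 4 ∂μ := by
  have h1 := (integrable_pow_mul_pow hf hg hf4 hg4 (show 3 + 1 ≤ 4 by norm_num)).const_mul 4
  have h2 := (integrable_pow_mul_pow hf hg hf4 hg4 (show 2 + 2 ≤ 4 by norm_num)).const_mul 6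
  have h3 := (integrable_pow_mul_pow hf hg hf4 hg4 (show 1 + 3 ≤ 4 by norm_num)).const_mul 4
  simp only [add_pow_four]
  have i1 : Integrable (fun ω => f ω ^ 4 + 4 * (f ω ^ 3 * g ω ^ 1)) μ := hf4.add h1
  have i2 : Integrable (fun ω => f ω ^ 4 + 4 * (f ω ^ 3 * g ω ^ 1) +
    6 * (f ω ^ 2 * g ω ^ 2)) μ := i1.add h2
  have i3 : Integrable (fun ω => f ω ^ 4 + 4 * (f ω ^ 3 * g ω ^ 1) +
    6 * (f ω ^ 2 * g ω ^ 2) + 4 * (f ω ^ 1 * g ω ^ 3)) μ := i2.add h3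
  refine ⟨i3.add hg4, ?_⟩
  rw [integral_add i3 hg4, integral_add i2 h3, integral_add i1 h2, integral_add hf4 h1,
    integral_const_mul, integral_const_mul, integral_const_mul]

/-- Cauchy–Schwarz for `f²` and `g²`, from the discriminant of the nonnegative quadratic `x ↦ ∫ (x
f² + g²)²`. -/
theorem sq_integral_mul_le {f g : Ω → ℝ} (hf : Measurable f) (hg : Measurable g)
    (hf4 : Integrable (fun ω => f ω ^ 4) μ) (hg4 : Integrable (fun ω => g ω ^ 4) μ) :
    (∫ ω, f ω ^ 2 * g ω ^ 2 ∂μ) ^ 2 ≤ (∫ ω, f ω ^ 4 ∂μ) * ∫ ω, g ω ^ 4 ∂μ := by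
  have h2 := integrable_pow_mul_pow hf hg hf4 hg4 (show 2 + 2 ≤ 4 by norm_num)
  have h : ∀ x : ℝ, 0 ≤ (∫ ω, f ω ^ 4 ∂μ) * (x * x) + (2 * ∫ ω, f ω ^ 2 * g ω ^ 2 ∂μ) * x +
      ∫ ω, g ω ^ 4 ∂μ := by
    intro x
    have h0 : 0 ≤ ∫ ω, (x * f ω ^ 2 + g ω ^ 2) ^ 2 ∂μ := integral_nonneg fun ω => sq_nonneg _
    have e : ∀ ω, (x * f ω ^ 2 + g ω ^ 2) ^ 2 =
      (x * x) * f ω ^ 4 + (2 * x) * (f ω ^ 2 * g ω ^ 2) + g ω ^ 4 := fun ω => by ring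
    simp only [e] at h0
    have i1 : Integrable (fun ω => (x * x) * f ω ^ 4 + (2 * x) * (f ω ^ 2 * g ω ^ 2)) μ :=
      (hf4.const_mul _).add (h2.const_mul _)
    rw [integral_add i1 hg4, integral_add (hf4.const_mul _) (h2.const_mul _), integral_const_mul,
      integral_const_mul] at h0
    linarith
  have := discrim_le_zero h
  rw [discrim] at this
  nlinarith

variable {ι : Type*}

/-- Second and fourth moments of a sum of independent centred variables. -/
theorem fourth_moment_sum {t : ι → Ω → ℝ} (hind : iIndepFun t μ) (hm : ∀ i, Measurable (t i))
    (h4 : ∀ i, Integrable (fun ω => t i ω ^ 4) μ) (h0 : ∀ i, ∫ ω, t i ω ∂μ = 0)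
    (s : Finset ι) :
    Integrable (fun ω => (∑ i ∈ s, t i ω) ^ 4) μ ∧ (∫ ω, ∑ i ∈ s, t i ω ∂μ = 0) ∧
    (∫ ω, (∑ i ∈ s, t i ω) ^ 2 ∂μ = ∑ i ∈ s, ∫ ω, t i ω ^ 2 ∂μ) ∧
    ∫ ω, (∑ i ∈ s, t i ω) ^ 4 ∂μ ≤
      ∑ i ∈ s, ∫ ω, t i ω ^ 4 ∂μ + 3 * (∑ i ∈ s, ∫ ω, t i ω ^ 2 ∂μ) ^ 2 := by
  classical
  have hi1 : ∀ i, Integrable (t i) μ := fun i => by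
    simpa using integrable_pow_of_four (hm i) (h4 i) (show 1 ≤ 4 by norm_num)
  induction s using Finset.induction_on with
  | empty => simp
  | insert a s ha ih =>
    obtain ⟨ih1, ih2, ih3, ih4⟩ := ih
    simp only [Finset.sum_insert ha]
    have hS : Measurable fun ω => ∑ i ∈ s, t i ω := Finset.measurable_fun_sum _ fun i _ => hm i
    have hI : IndepFun (fun ω => ∑ i ∈ s, t i ω) (t a) μ := by
      have := hind.indepFun_finsetSum_of_notMem hm ha
      convert this using 1
      funext ω
      simp
    have hiS : Integrable (fun ω => ∑ i ∈ s, t i ω) μ := integrable_finsetSum _ fun i _ => hi1 i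
    obtain ⟨q1, q2⟩ := integrable_add_pow_four (hm a) hS (h4 a) ih1
    refine ⟨q1, ?_, ?_, ?_⟩
    · rw [integral_add (hi1 a) hiS, ih2, h0, add_zero]
    · have e : ∀ ω, (t a ω + ∑ i ∈ s, t i ω) ^ 2 =
        t a ω ^ 2 + 2 * (t a ω ^ 1 * (∑ i ∈ s, t i ω) ^ 1) + (∑ i ∈ s, t i ω) ^ 2 :=
        fun ω => by ring
      have j1 := integrable_pow_of_four (hm a) (h4 a) (show 2 ≤ 4 by norm_num)
      have j2 := (integrable_pow_mul_pow (hm a) hS (h4 a) ih1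
        (show 1 + 1 ≤ 4 by norm_num)).const_mul 2
      have j3 := integrable_pow_of_four hS ih1 (show 2 ≤ 4 by norm_num)
      have j4 : Integrable (fun ω => t a ω ^ 2 + 2 * (t a ω ^ 1 * (∑ i ∈ s, t i ω) ^ 1)) μ :=
        j1.add j2
      simp only [e]
      rw [integral_add j4 j3, integral_add j1 j2, integral_const_mul,
        integral_indep_pow hI.symm (hm a) hS, ih3]
      simp only [pow_one, h0]
      ring
    -- Independence and centring remove the odd cross terms. The remaining one, `6 E[t_a²] E[S²]`,
    -- is the cross term of `3 (E[t_a²] + E[S²])²`.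
    · rw [q2, integral_indep_pow hI.symm (hm a) hS, integral_indep_pow hI.symm (hm a) hS,
        integral_indep_pow hI.symm (hm a) hS, ih3]
      simp only [pow_one, h0, ih2]
      have : 0 ≤ ∫ ω, t a ω ^ 2 ∂μ := integral_nonneg fun ω => sq_nonneg _
      nlinarith

/-- Adding an index `a` changes the form from `U` to `U + L X_a`, where `L` is linear in the earlier
variables and `X_a` is independent of the pair `(U, L)`. The term cubic in `U` vanishes by centring
and the others are controlled by Cauchy–Schwarz. A bound quadratic in the squared size of `B`
reproduces itself under `S ↦ S + q`. -/
theorem fourth_moment_offDiag {X : ι → Ω → ℝ} (hind : iIndepFun X μ)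
    (hm : ∀ i, Measurable (X i)) (h4 : ∀ i, Integrable (fun ω => X i ω ^ 4) μ)
    (h0 : ∀ i, ∫ ω, X i ω ∂μ = 0) {D : ℝ} (hD : 0 ≤ D) (hX2 : ∀ i, ∫ ω, X i ω ^ 2 ∂μ ≤ D)
    (hX4 : ∀ i, ∫ ω, X i ω ^ 4 ∂μ ≤ D ^ 2) (B : ι → ι → ℝ) (hB : ∀ i, B i i = 0)
    (s : Finset ι) :
    Integrable (fun ω => (∑ i ∈ s, ∑ j ∈ s, B i j * (X i ω * X j ω)) ^ 4) μ ∧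
    ∫ ω, (∑ i ∈ s, ∑ j ∈ s, B i j * (X i ω * X j ω)) ^ 4 ∂μ ≤
      64 * D ^ 4 * (2 * ∑ i ∈ s, ∑ j ∈ s, B i j ^ 2) ^ 2 := by
  classical
  induction s using Finset.induction_on with
  | empty => simp
  | insert a s ha ih =>
    obtain ⟨ih1, ih2⟩ := ih
    set U : Ω → ℝ := fun ω => ∑ i ∈ s, ∑ j ∈ s, B i j * (X i ω * X j ω) with hU
    set b : ι → ℝ := fun j => B a j + B j a with hb
    set L : Ω → ℝ := fun ω => ∑ j ∈ s, b j * X j ω with hL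
    have hUm : Measurable U := by
      refine Finset.measurable_fun_sum _ fun i _ => Finset.measurable_fun_sum _ fun j _ => ?_
      exact ((hm i).mul (hm j)).const_mul _
    have hLm : Measurable L := Finset.measurable_fun_sum _ fun j _ => (hm j).const_mul _
    set q := ∑ j ∈ s, b j ^ 2 with hq
    have hq0 : 0 ≤ q := Finset.sum_nonneg fun _ _ => sq_nonneg _
    set S := 2 * ∑ i ∈ s, ∑ j ∈ s, B i j ^ 2 with hS
    have hS0 : 0 ≤ S := mul_nonneg two_pos.le
      (Finset.sum_nonneg fun _ _ => Finset.sum_nonneg fun _ _ => sq_nonneg _)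
    have hnew : ∀ ω, ∑ i ∈ insert a s, ∑ j ∈ insert a s, B i j * (X i ω * X j ω) =
        U ω + L ω * X a ω := by
      intro ω
      simp only [Finset.sum_insert ha, hB, Finset.sum_add_distrib, hU, hL, hb, add_mul,
        Finset.sum_mul]
      have e1 : ∑ i ∈ s, B a i * (X a ω * X i ω) = ∑ i ∈ s, B a i * X i ω * X a ω :=
        Finset.sum_congr rfl fun i _ => by ring
      have e2 : ∑ i ∈ s, B i a * (X i ω * X a ω) = ∑ i ∈ s, B i a * X i ω * X a ω :=
        Finset.sum_congr rfl fun i _ => by ring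
      rw [e1, e2]
      ring
    have hSnew : S + q ≤ 2 * ∑ i ∈ insert a s, ∑ j ∈ insert a s, B i j ^ 2 := by
      simp only [Finset.sum_insert ha, hB, Finset.sum_add_distrib]
      have : q ≤ 2 * (∑ i ∈ s, B a i ^ 2 + ∑ i ∈ s, B i a ^ 2) := by
        rw [hq, ← Finset.sum_add_distrib, Finset.mul_sum]
        refine Finset.sum_le_sum fun i _ => ?_
        simp only [hb]
        nlinarith [sq_nonneg (B a i - B i a)]
      rw [hS]
      linarith
    -- moments of the linear form
    obtain ⟨l1, -, -, l4⟩ := fourth_moment_sum (t := fun j ω => b j * X j ω)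
      (hind.comp (fun j x => b j * x) fun j => measurable_const_mul _)
      (fun j => (hm j).const_mul _)
      (fun j => by simpa only [mul_pow] using (h4 j).const_mul (b j ^ 4))
      (fun j => by rw [integral_const_mul, h0, mul_zero]) s
    have hL4 : ∫ ω, L ω ^ 4 ∂μ ≤ 4 * D ^ 2 * q ^ 2 := by
      refine l4.trans ?_
      simp only [mul_pow, integral_const_mul]
      have e1 : ∑ j ∈ s, b j ^ 4 * ∫ ω, X j ω ^ 4 ∂μ ≤ D ^ 2 * q ^ 2 := by
        have e3 : ∑ j ∈ s, b j ^ 4 ≤ q ^ 2 := by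
          rw [hq, sq, Finset.sum_mul_sum]
          refine Finset.sum_le_sum fun i hi => ?_
          have := Finset.single_le_sum (f := fun j => b i ^ 2 * b j ^ 2)
            (fun j _ => by positivity) hi
          calc b i ^ 4 = b i ^ 2 * b i ^ 2 := by ring
            _ ≤ _ := this
        calc ∑ j ∈ s, b j ^ 4 * ∫ ω, X j ω ^ 4 ∂μ ≤ ∑ j ∈ s, b j ^ 4 * D ^ 2 :=
              Finset.sum_le_sum fun j _ => mul_le_mul_of_nonneg_left (hX4 j) (by positivity)
          _ = D ^ 2 * ∑ j ∈ s, b j ^ 4 := by rw [← Finset.sum_mul, mul_comm]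
          _ ≤ _ := by gcongr
      have e2 : ∑ j ∈ s, b j ^ 2 * ∫ ω, X j ω ^ 2 ∂μ ≤ D * q := by
        calc ∑ j ∈ s, b j ^ 2 * ∫ ω, X j ω ^ 2 ∂μ ≤ ∑ j ∈ s, b j ^ 2 * D :=
              Finset.sum_le_sum fun j _ => mul_le_mul_of_nonneg_left (hX2 j) (by positivity)
          _ = D * q := by rw [← Finset.sum_mul, mul_comm]
      have e0 : 0 ≤ ∑ j ∈ s, b j ^ 2 * ∫ ω, X j ω ^ 2 ∂μ :=
        Finset.sum_nonneg fun j _ => mul_nonneg (sq_nonneg _)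
          (integral_nonneg fun ω => sq_nonneg _)
      have e4 := pow_le_pow_left₀ e0 e2 2
      nlinarith
    -- independence
    have hGU : Measurable fun z : ι → ℝ => ∑ i ∈ s, ∑ j ∈ s, B i j * (z i * z j) :=
      Finset.measurable_fun_sum _ fun i _ => Finset.measurable_fun_sum _ fun j _ =>
        ((measurable_pi_apply i).mul (measurable_pi_apply j)).const_mul _
    have hGL : Measurable fun z : ι → ℝ => ∑ j ∈ s, b j * z j :=
      Finset.measurable_fun_sum _ fun j _ => (measurable_pi_apply j).const_mul _
    have hGU' : ∀ z z' : ι → ℝ, (∀ i ∈ s, z i = z' i) →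
        ∑ i ∈ s, ∑ j ∈ s, B i j * (z i * z j) = ∑ i ∈ s, ∑ j ∈ s, B i j * (z' i * z' j) :=
      fun z z' h => Finset.sum_congr rfl fun i hi => Finset.sum_congr rfl fun j hj => by
        rw [h i hi, h j hj]
    have hGL' : ∀ z z' : ι → ℝ, (∀ i ∈ s, z i = z' i) →
        ∑ j ∈ s, b j * z j = ∑ j ∈ s, b j * z' j :=
      fun z z' h => Finset.sum_congr rfl fun j hj => by rw [h j hj]
    have hIL : IndepFun L (X a) μ := indepFun_of_dependsOn hind hm ha hGL hGL'
    have hIUL : ∀ i j : ℕ, IndepFun (fun ω => U ω ^ i * L ω ^ j) (X a) μ := fun i j =>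
      indepFun_of_dependsOn hind hm ha
        (G := fun z => (∑ i ∈ s, ∑ j ∈ s, B i j * (z i * z j)) ^ i * (∑ j ∈ s, b j * z j) ^ j)
        ((hGU.pow_const i).mul (hGL.pow_const j))
        fun z z' h => by rw [hGU' z z' h, hGL' z z' h]
    have hsplit : ∀ i j : ℕ, ∫ ω, U ω ^ i * (L ω * X a ω) ^ j ∂μ =
        (∫ ω, U ω ^ i * L ω ^ j ∂μ) * ∫ ω, X a ω ^ j ∂μ := by
      intro i j
      have := integral_indep_pow (hIUL i j) ((hUm.pow_const i).mul (hLm.pow_const j)) (hm a) 1 j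
      simp only [pow_one] at this
      rw [← this]
      refine integral_congr_ae (ae_of_all _ fun ω => ?_)
      simp only [mul_pow]
      ring
    have hV4 : Integrable (fun ω => (L ω * X a ω) ^ 4) μ := by
      have := (hIL.comp (measurable_id.pow_const 4) (measurable_id.pow_const 4)).integrable_mul
        l1 (h4 a)
      simp only [mul_pow]
      exact this
    have hVm : Measurable fun ω => L ω * X a ω := hLm.mul (hm a)
    obtain ⟨q1, q2⟩ := integrable_add_pow_four hUm hVm ih1 hV4
    simp only [hnew]
    refine ⟨q1, ?_⟩
    have t1 : ∫ ω, U ω ^ 3 * (L ω * X a ω) ^ 1 ∂μ = 0 := by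
      rw [hsplit]; simp [h0]
    have x0 : 0 ≤ ∫ ω, U ω ^ 2 * L ω ^ 2 ∂μ := integral_nonneg fun ω => by positivity
    have x1 : ∫ ω, U ω ^ 2 * L ω ^ 2 ∂μ ≤ 16 * D ^ 3 * S * q := by
      refine (abs_le_of_sq_le_sq ?_ (by positivity)).trans' (le_abs_self _)
      refine (sq_integral_mul_le hUm hLm ih1 l1).trans ?_
      calc (∫ ω, U ω ^ 4 ∂μ) * ∫ ω, L ω ^ 4 ∂μ
          ≤ (64 * D ^ 4 * S ^ 2) * (4 * D ^ 2 * q ^ 2) :=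
            mul_le_mul ih2 hL4 (integral_nonneg fun ω => by positivity) (by positivity)
        _ = _ := by ring
    have t2 : ∫ ω, U ω ^ 2 * (L ω * X a ω) ^ 2 ∂μ ≤ 16 * D ^ 4 * S * q := by
      rw [hsplit]
      calc (∫ ω, U ω ^ 2 * L ω ^ 2 ∂μ) * ∫ ω, X a ω ^ 2 ∂μ ≤ (16 * D ^ 3 * S * q) * D :=
            mul_le_mul x1 (hX2 a) (integral_nonneg fun ω => sq_nonneg _) (by positivity)
        _ = _ := by ring
    have t4 : ∫ ω, (L ω * X a ω) ^ 4 ∂μ ≤ 4 * D ^ 4 * q ^ 2 := by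
      have := hsplit 0 4
      simp only [pow_zero, one_mul] at this
      rw [this]
      calc (∫ ω, L ω ^ 4 ∂μ) * ∫ ω, X a ω ^ 4 ∂μ ≤ (4 * D ^ 2 * q ^ 2) * D ^ 2 :=
            mul_le_mul hL4 (hX4 a) (integral_nonneg fun ω => by positivity) (by positivity)
        _ = _ := by ring
    have i22 := integrable_pow_mul_pow hUm hVm ih1 hV4 (show 2 + 2 ≤ 4 by norm_num)
    -- Pointwise `2UV³ ≤ U²V² + V⁴`, so no bound on the third moment of `X a` is needed.
    have t3 : 2 * ∫ ω, U ω ^ 1 * (L ω * X a ω) ^ 3 ∂μ ≤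
        ∫ ω, U ω ^ 2 * (L ω * X a ω) ^ 2 ∂μ + ∫ ω, (L ω * X a ω) ^ 4 ∂μ := by
      rw [← integral_const_mul, ← integral_add i22 hV4]
      refine integral_mono ((integrable_pow_mul_pow hUm hVm ih1 hV4
        (show 1 + 3 ≤ 4 by norm_num)).const_mul 2) (i22.add hV4) fun ω => ?_
      simp only
      nlinarith [sq_nonneg (U ω * (L ω * X a ω) - (L ω * X a ω) ^ 2)]
    rw [q2, t1]
    -- Origin of `64`: a constant `C` in the induction hypothesis bounds the mixed term by `2√C D⁴ S
    -- q`. It occurs `6 + 2 = 8` times and must fit into `2C D⁴ S q`, that is `C ≥ 64`.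
    have hfin : ∫ ω, U ω ^ 4 ∂μ + 4 * 0 + 6 * ∫ ω, U ω ^ 2 * (L ω * X a ω) ^ 2 ∂μ +
        4 * ∫ ω, U ω ^ 1 * (L ω * X a ω) ^ 3 ∂μ + ∫ ω, (L ω * X a ω) ^ 4 ∂μ ≤
        64 * D ^ 4 * (S + q) ^ 2 := by
      have e : 64 * D ^ 4 * (S + q) ^ 2 = 64 * D ^ 4 * S ^ 2 + 8 * (16 * D ^ 4 * S * q) +
        16 * (4 * D ^ 4 * q ^ 2) := by ring
      have : 0 ≤ 4 * D ^ 4 * q ^ 2 := by positivity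
      have ih2' : ∫ ω, U ω ^ 4 ∂μ ≤ 64 * D ^ 4 * S ^ 2 := ih2
      linarith
    refine hfin.trans ?_
    gcongr

end Moments

/-! ### Tail bounds for quadratic forms -/

section Tail

variable {ν : Measure ℝ} [IsProbabilityMeasure ν]

theorem abs_rpow_le_add {x a b : ℝ} (ha : 0 ≤ a) (hab : a ≤ b) : |x| ^ a ≤ 1 + |x| ^ b := by
  rcases le_total |x| 1 with h | h
  · have := Real.rpow_le_one (abs_nonneg x) h ha
    have := Real.rpow_nonneg (abs_nonneg x) b
    linarith
  · have := Real.rpow_le_rpow_of_exponent_le h hab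
    linarith

theorem integrable_abs_rpow_of_le {a b : ℝ} (ha : 0 ≤ a) (hab : a ≤ b)
    (h : Integrable (fun e : ℝ => |e| ^ b) ν) : Integrable (fun e : ℝ => |e| ^ a) ν := by
  refine Integrable.mono' ((integrable_const (1 : ℝ)).add h)
    (Measurable.aestronglyMeasurable (by fun_prop)) (ae_of_all _ fun e => ?_)
  rw [Real.norm_of_nonneg (Real.rpow_nonneg (abs_nonneg e) a)]
  exact abs_rpow_le_add ha hab

theorem integrable_pow_four_of_rpow {η : ℝ} (hη : 0 < η)
    (h : Integrable (fun e : ℝ => |e| ^ (4 + η)) ν) : Integrable (fun e : ℝ => e ^ 4) ν := by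
  have := integrable_abs_rpow_of_le (show (0 : ℝ) ≤ 4 by norm_num) (by linarith) h
  refine this.congr (ae_of_all _ fun e => ?_)
  simp only
  rw [show (4 : ℝ) = ((4 : ℕ) : ℝ) by norm_num, Real.rpow_natCast, ← abs_pow,
    abs_of_nonneg (by positivity)]

/-- The square, clipped at height `M`. -/
def clipSq (M e : ℝ) : ℝ := min (e ^ 2) M

theorem measurable_clipSq (M : ℝ) : Measurable (clipSq M) := by
  unfold clipSq
  fun_prop

theorem clipSq_nonneg {M : ℝ} (hM : 0 < M) (e : ℝ) : 0 ≤ clipSq M e :=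
  le_min (sq_nonneg e) hM.le

theorem clipSq_le (M e : ℝ) : clipSq M e ≤ M := min_le_right _ _

theorem clipSq_sq_le {M : ℝ} (hM : 0 < M) (e : ℝ) : clipSq M e ^ 2 ≤ e ^ 4 := by
  have h := pow_le_pow_left₀ (clipSq_nonneg hM e) (min_le_left (e ^ 2) M : clipSq M e ≤ e ^ 2) 2
  calc clipSq M e ^ 2 ≤ (e ^ 2) ^ 2 := h
    _ = e ^ 4 := by ring

theorem integrable_clipSq_pow {M : ℝ} (hM : 0 < M) (k : ℕ) :
    Integrable (fun e => clipSq M e ^ k) ν := by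
  refine Integrable.of_bound ((measurable_clipSq M).pow_const k).aestronglyMeasurable (M ^ k)
    (ae_of_all _ fun e => ?_)
  rw [Real.norm_of_nonneg (pow_nonneg (clipSq_nonneg hM e) k)]
  exact pow_le_pow_left₀ (clipSq_nonneg hM e) (clipSq_le M e) k

theorem integrable_clipSq {M : ℝ} (hM : 0 < M) : Integrable (clipSq M) ν := by
  simpa using integrable_clipSq_pow (ν := ν) hM 1

/-- The bias of clipping: pointwise `(e² - clipSq M e) M ≤ e⁴`. -/
theorem abs_integral_clipSq_sub_le {M : ℝ} (hM : 0 < M) (h4 : Integrable (fun e : ℝ => e ^ 4) ν)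
    (h2 : Integrable (fun e : ℝ => e ^ 2) ν) :
    |(∫ e, clipSq M e ∂ν) - ∫ e, e ^ 2 ∂ν| ≤ (∫ e, e ^ 4 ∂ν) / M := by
  rw [abs_sub_comm, ← integral_sub h2 (integrable_clipSq hM), abs_of_nonneg, ← integral_div]
  · refine integral_mono (h2.sub (integrable_clipSq hM)) (h4.div_const M) fun e => ?_
    simp only
    rw [le_div_iff₀ hM]
    rcases le_total (e ^ 2) M with h | h
    · rw [clipSq, min_eq_left h, sub_self, zero_mul]
      positivity
    · rw [clipSq, min_eq_right h]
      nlinarith [sq_nonneg (e ^ 2 - M)]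
  · exact integral_nonneg fun e => sub_nonneg.2 (min_le_left _ _)

theorem integral_clipSq_mem {M : ℝ} (hM : 0 < M) : (∫ e, clipSq M e ∂ν) ∈ Set.Icc 0 M := by
  refine ⟨integral_nonneg (clipSq_nonneg hM), ?_⟩
  have := integral_mono (integrable_clipSq (ν := ν) hM) (integrable_const M) (clipSq_le M)
  simpa using this

theorem integral_clipSq_centred_sq_le {M : ℝ} (hM : 0 < M)
    (h4 : Integrable (fun e : ℝ => e ^ 4) ν) :
    ∫ e, (clipSq M e - ∫ e, clipSq M e ∂ν) ^ 2 ∂ν ≤ ∫ e, e ^ 4 ∂ν := by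
  set r := ∫ e, clipSq M e ∂ν with hr
  have e : ∀ e, (clipSq M e - r) ^ 2 = clipSq M e ^ 2 - 2 * r * clipSq M e + r ^ 2 :=
    fun e => by ring
  have i1 : Integrable (fun e => clipSq M e ^ 2 - 2 * r * clipSq M e) ν :=
    (integrable_clipSq_pow hM 2).sub ((integrable_clipSq hM).const_mul _)
  simp only [e]
  rw [integral_add i1 (integrable_const _), integral_sub (integrable_clipSq_pow hM 2)
    ((integrable_clipSq hM).const_mul _), integral_const_mul, ← hr]
  have := integral_mono (integrable_clipSq_pow (ν := ν) hM 2) h4 (clipSq_sq_le hM)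
  simp only [integral_const, probReal_univ, one_smul]
  nlinarith [sq_nonneg r]

theorem integrable_clipSq_centred_pow {M : ℝ} (hM : 0 < M) (k : ℕ) :
    Integrable (fun e => (clipSq M e - ∫ e, clipSq M e ∂ν) ^ k) ν := by
  refine Integrable.of_bound (((measurable_clipSq M).sub_const _).pow_const k).aestronglyMeasurable
    (M ^ k) (ae_of_all _ fun e => ?_)
  rw [norm_pow]
  refine pow_le_pow_left₀ (norm_nonneg _) ?_ k
  have h := integral_clipSq_mem (ν := ν) hM
  rw [Real.norm_eq_abs, abs_le]
  constructor <;> linarith [h.1, h.2, clipSq_nonneg hM e, clipSq_le M e]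

/-- Two factors are bounded by `M` and the other two are integrated; a fourth moment of `e²` itself
would need eight moments of the noise. -/
theorem integral_clipSq_centred_four_le {M : ℝ} (hM : 0 < M)
    (h4 : Integrable (fun e : ℝ => e ^ 4) ν) :
    ∫ e, (clipSq M e - ∫ e, clipSq M e ∂ν) ^ 4 ∂ν ≤ M ^ 2 * ∫ e, e ^ 4 ∂ν := by
  refine le_trans ?_ (mul_le_mul_of_nonneg_left (integral_clipSq_centred_sq_le hM h4)
    (sq_nonneg M))
  rw [← integral_const_mul]
  refine integral_mono (integrable_clipSq_centred_pow hM 4)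
    ((integrable_clipSq_centred_pow hM 2).const_mul _) fun e => ?_
  have h := integral_clipSq_mem (ν := ν) hM
  have h1 : (clipSq M e - ∫ e, clipSq M e ∂ν) ^ 2 ≤ M ^ 2 := by
    refine sq_le_sq' ?_ ?_ <;> linarith [h.1, h.2, clipSq_nonneg hM e, clipSq_le M e]
  simp only
  nlinarith [sq_nonneg (clipSq M e - ∫ e, clipSq M e ∂ν)]

variable {n : ℕ}

theorem iIndepFun_eval : iIndepFun (fun (i : Fin n) (e : Fin n → ℝ) => e i)
    (Measure.pi fun _ : Fin n => ν) :=
  iIndepFun_pi (X := fun _ => id) fun _ => aemeasurable_id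

theorem integral_pi_eval {f : ℝ → ℝ} (hf : Measurable f) (i : Fin n) :
    ∫ e, f (e i) ∂(Measure.pi fun _ : Fin n => ν) = ∫ x, f x ∂ν :=
  integral_comp_eval (μ := fun _ : Fin n => ν) hf.aestronglyMeasurable

theorem integrable_pi_eval {f : ℝ → ℝ} (hf : Integrable f ν) (i : Fin n) :
    Integrable (fun e : Fin n → ℝ => f (e i)) (Measure.pi fun _ : Fin n => ν) :=
  (measurePreserving_eval (fun _ : Fin n => ν) i).integrable_comp_of_integrable hf

theorem measureReal_pow_four_ge {Ω : Type*} [MeasurableSpace Ω] {μ : Measure Ω}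
    [IsFiniteMeasure μ] {f : Ω → ℝ} (hf : Integrable (fun ω => f ω ^ 4) μ) {t K : ℝ} (ht : 0 < t)
    (hK : ∫ ω, f ω ^ 4 ∂μ ≤ K) : μ.real {ω | t ≤ |f ω|} ≤ K / t ^ 4 := by
  have h := mul_meas_ge_le_integral_of_nonneg (ae_of_all μ fun ω => by positivity) hf (t ^ 4)
  rw [le_div_iff₀ (by positivity), mul_comm]
  refine le_trans (le_trans ?_ h) hK
  refine mul_le_mul_of_nonneg_left (measureReal_mono fun ω hω => ?_) (by positivity)
  have h1 : t ≤ |f ω| := hω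
  have := pow_le_pow_left₀ ht.le h1 4
  rwa [← abs_pow, abs_of_nonneg (by positivity : 0 ≤ f ω ^ 4)] at this

theorem abs_diag_le {A : Matrix (Fin n) (Fin n) ℝ} {L : ℝ} (hL : 0 ≤ L)
    (hA : ∀ i, ∑ j, A i j ^ 2 ≤ L ^ 2) (i : Fin n) : |A i i| ≤ L := by
  refine abs_le_of_sq_le_sq ?_ hL
  exact (Finset.single_le_sum (f := fun j => A i j ^ 2) (fun j _ => sq_nonneg _)
    (Finset.mem_univ i)).trans (hA i)

/-- Tail of the diagonal part of the quadratic form, clipped at `M`. -/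
theorem tail_diag {M : ℝ} (hM : 0 < M) (h4 : Integrable (fun e : ℝ => e ^ 4) ν)
    {L : ℝ} (a : Fin n → ℝ) (ha : ∀ i, |a i| ≤ L) {t : ℝ} (ht : 0 < t) :
    (Measure.pi fun _ : Fin n => ν).real
      {e | t ≤ |∑ i, a i * (clipSq M (e i) - ∫ e, clipSq M e ∂ν)|} ≤
      (n * (L ^ 4 * (M ^ 2 * ∫ e, e ^ 4 ∂ν)) + 3 * (n * (L ^ 2 * ∫ e, e ^ 4 ∂ν)) ^ 2) / t ^ 4 := by
  set r := ∫ e, clipSq M e ∂ν with hr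
  have hm0 : 0 ≤ ∫ e, e ^ 4 ∂ν := integral_nonneg fun e => by positivity
  have hmeas : ∀ i, Measurable fun x => a i * (clipSq M x - r) := fun i =>
    ((measurable_clipSq M).sub_const r).const_mul _
  obtain ⟨q1, -, -, q4⟩ := fourth_moment_sum
    (t := fun (i : Fin n) (e : Fin n → ℝ) => a i * (clipSq M (e i) - r))
    ((iIndepFun_eval (ν := ν)).comp (fun i x => a i * (clipSq M x - r)) hmeas)
    (fun i => (hmeas i).comp (measurable_pi_apply i))
    (fun i => by
      simp only [mul_pow]
      exact (integrable_pi_eval (integrable_clipSq_centred_pow hM 4) i).const_mul _)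
    (fun i => by
      rw [integral_pi_eval (hmeas i), integral_const_mul, integral_sub (integrable_clipSq hM)
        (integrable_const _), ← hr]
      simp) Finset.univ
  refine measureReal_pow_four_ge q1 ht (q4.trans ?_)
  have e2 : ∀ i, ∫ e, (a i * (clipSq M (e i) - r)) ^ 2 ∂(Measure.pi fun _ : Fin n => ν) ≤
      L ^ 2 * ∫ e, e ^ 4 ∂ν := by
    intro i
    rw [integral_pi_eval (f := fun x => (a i * (clipSq M x - r)) ^ 2) ((hmeas i).pow_const 2)]
    simp only [mul_pow]
    rw [integral_const_mul]
    have h1 : a i ^ 2 ≤ L ^ 2 := by rw [← sq_abs]; exact pow_le_pow_left₀ (abs_nonneg _) (ha i) 2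
    exact mul_le_mul h1 (integral_clipSq_centred_sq_le hM h4)
      (integral_nonneg fun e => sq_nonneg _) (by positivity)
  have e4 : ∀ i, ∫ e, (a i * (clipSq M (e i) - r)) ^ 4 ∂(Measure.pi fun _ : Fin n => ν) ≤
      L ^ 4 * (M ^ 2 * ∫ e, e ^ 4 ∂ν) := by
    intro i
    rw [integral_pi_eval (f := fun x => (a i * (clipSq M x - r)) ^ 4) ((hmeas i).pow_const 4)]
    simp only [mul_pow]
    rw [integral_const_mul]
    have h1 : a i ^ 4 ≤ L ^ 4 := by
      rw [← Even.pow_abs (by decide : Even 4)]; exact pow_le_pow_left₀ (abs_nonneg _) (ha i) 4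
    exact mul_le_mul h1 (integral_clipSq_centred_four_le hM h4)
      (integral_nonneg fun e => by positivity) (by positivity)
  have s4 := Finset.sum_le_card_nsmul Finset.univ _ _ fun i _ => e4 i
  have s2 := Finset.sum_le_card_nsmul Finset.univ _ _ fun i _ => e2 i
  simp only [Finset.card_univ, Fintype.card_fin, nsmul_eq_mul] at s4 s2
  have s2' := pow_le_pow_left₀ (Finset.sum_nonneg fun i _ =>
    integral_nonneg fun e => sq_nonneg _) s2 2
  linarith

/-- Tail of the off-diagonal part of the quadratic form. -/
theorem tail_offDiag (h4 : Integrable (fun e : ℝ => e ^ 4) ν) (hm : (∫ e, e ∂ν) = 0) {D : ℝ}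
    (hD : 0 ≤ D) (hD2 : ∫ e, e ^ 2 ∂ν ≤ D) (hD4 : ∫ e, e ^ 4 ∂ν ≤ D ^ 2)
    {A : Matrix (Fin n) (Fin n) ℝ} {L : ℝ} (hA : ∀ i, ∑ j, A i j ^ 2 ≤ L ^ 2) {t : ℝ}
    (ht : 0 < t) :
    (Measure.pi fun _ : Fin n => ν).real
      {e | t ≤ |∑ i, ∑ j, (if i = j then 0 else A i j) * (e i * e j)|} ≤
      64 * D ^ 4 * (2 * (n * L ^ 2)) ^ 2 / t ^ 4 := by
  obtain ⟨q1, q2⟩ := fourth_moment_offDiag (iIndepFun_eval (ν := ν) (n := n))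
    (fun i => measurable_pi_apply i) (fun i => integrable_pi_eval h4 i)
    (fun i => by rw [integral_pi_eval (f := fun x => x) measurable_id, hm]) hD
    (fun i => by rwa [integral_pi_eval (f := fun x => x ^ 2) (by fun_prop)])
    (fun i => by rwa [integral_pi_eval (f := fun x => x ^ 4) (by fun_prop)])
    (fun i j => if i = j then 0 else A i j) (fun i => by simp) Finset.univ
  refine measureReal_pow_four_ge q1 ht (q2.trans ?_)
  have h1 : ∑ i, ∑ j, (if i = j then 0 else A i j) ^ 2 ≤ n * L ^ 2 := by
    have := Finset.sum_le_card_nsmul Finset.univ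
      (fun i => ∑ j, (if i = j then 0 else A i j) ^ 2) (L ^ 2) fun i _ => by
        refine le_trans (Finset.sum_le_sum fun j _ => ?_) (hA i)
        split_ifs
        · simpa using sq_nonneg (A i j)
        · exact le_rfl
    simpa using this
  have h0 : 0 ≤ ∑ i, ∑ j, (if i = j then 0 else A i j) ^ 2 :=
    Finset.sum_nonneg fun _ _ => Finset.sum_nonneg fun _ _ => sq_nonneg _
  gcongr

/-- Probability that some coordinate is large. -/
theorem tail_max {η : ℝ} (hη : 0 < η) (h : Integrable (fun e : ℝ => |e| ^ (4 + η)) ν) {M : ℝ}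
    (hM : 0 < M) :
    (Measure.pi fun _ : Fin n => ν).real {e | ∃ i, M < e i ^ 2} ≤
      n * ((∫ e, |e| ^ (4 + η) ∂ν) / M ^ (2 + η / 2)) := by
  have hMp : 0 < M ^ (2 + η / 2) := Real.rpow_pos_of_pos hM _
  have h1 : ∀ i : Fin n, (Measure.pi fun _ : Fin n => ν).real {e | M < e i ^ 2} ≤
      (∫ e, |e| ^ (4 + η) ∂ν) / M ^ (2 + η / 2) := by
    intro i
    have hp := mul_meas_ge_le_integral_of_nonneg (μ := Measure.pi fun _ : Fin n => ν)
      (ae_of_all _ fun e => Real.rpow_nonneg (abs_nonneg (e i)) (4 + η))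
      (integrable_pi_eval h i) (M ^ (2 + η / 2))
    rw [integral_pi_eval (f := fun x => |x| ^ (4 + η)) (by fun_prop)] at hp
    rw [le_div_iff₀ hMp, mul_comm]
    refine le_trans (mul_le_mul_of_nonneg_left (measureReal_mono fun e he => ?_) hMp.le) hp
    have he' : M < e i ^ 2 := he
    have h2 : M ^ (2 + η / 2) ≤ (|e i| ^ (2 : ℝ)) ^ (2 + η / 2) := by
      refine Real.rpow_le_rpow hM.le ?_ (by linarith)
      rw [Real.rpow_two, sq_abs]
      exact he'.le
    rw [← Real.rpow_mul (abs_nonneg _), show (2 : ℝ) * (2 + η / 2) = 4 + η by ring] at h2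
    exact h2
  rw [Set.ofPred_exists]
  refine (measureReal_iUnion_fintype_le _).trans ?_
  have := Finset.sum_le_card_nsmul Finset.univ _ _ fun i _ => h1 i
  simpa using this

theorem quadForm_eq (A : Matrix (Fin n) (Fin n) ℝ) (e : Fin n → ℝ) (s : ℝ) :
    e ⬝ᵥ (A *ᵥ e) - s * A.trace = ∑ i, A i i * (e i ^ 2 - s) +
      ∑ i, ∑ j, (if i = j then 0 else A i j) * (e i * e j) := by
  rw [dotProduct, Matrix.trace, Finset.mul_sum, ← Finset.sum_sub_distrib,
    ← Finset.sum_add_distrib]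
  refine Finset.sum_congr rfl fun i _ => ?_
  rw [Matrix.mulVec, dotProduct, Finset.mul_sum, ← Finset.add_sum_erase _ _ (Finset.mem_univ i),
    ← Finset.add_sum_erase (a := i) _ (fun j => (if i = j then 0 else A i j) * (e i * e j))
      (Finset.mem_univ i)]
  have : ∑ j ∈ Finset.univ.erase i, e i * (A i j * e j) =
      ∑ j ∈ Finset.univ.erase i, (if i = j then 0 else A i j) * (e i * e j) := by
    refine Finset.sum_congr rfl fun j hj => ?_
    rw [if_neg (Finset.ne_of_mem_erase hj).symm]
    ring
  rw [this]
  simp only [if_true, Matrix.diag_apply]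
  ring

/-- If the quadratic form is far from its mean then one of the pieces is large. -/
theorem quadForm_tail_subset {M : ℝ} {s r B : ℝ} (hr : |r - s| ≤ B)
    {L : ℝ} (A : Matrix (Fin n) (Fin n) ℝ) (hA : ∀ i, |A i i| ≤ L) {δ : ℝ}
    (hB : L * B ≤ δ / 4) :
    {e : Fin n → ℝ | δ * n ≤ |e ⬝ᵥ (A *ᵥ e) - s * A.trace|} ⊆
      {e | ∃ i, M < e i ^ 2} ∪ ({e | δ / 4 * n ≤ |∑ i, A i i * (clipSq M (e i) - r)|} ∪
        {e | δ / 2 * n ≤ |∑ i, ∑ j, (if i = j then 0 else A i j) * (e i * e j)|}) := by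
  intro e he
  by_contra hcon
  simp only [Set.mem_union, Set.mem_ofPred_eq, not_or, not_exists, not_lt, not_le] at hcon he
  obtain ⟨h1, h2, h3⟩ := hcon
  have hsum : ∑ i, A i i * (e i ^ 2 - s) =
      ∑ i, A i i * (clipSq M (e i) - r) + (r - s) * ∑ i, A i i := by
    rw [Finset.mul_sum, ← Finset.sum_add_distrib]
    refine Finset.sum_congr rfl fun i _ => ?_
    rw [clipSq, min_eq_left (h1 i)]
    ring
  have hb : |(r - s) * ∑ i, A i i| ≤ δ / 4 * n := by
    rw [abs_mul]
    have h4 : |∑ i, A i i| ≤ n * L := by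
      refine (Finset.abs_sum_le_sum_abs _ _).trans ?_
      have := Finset.sum_le_card_nsmul Finset.univ _ _ fun i _ => hA i
      simpa using this
    calc |r - s| * |∑ i, A i i| ≤ B * (n * L) :=
          mul_le_mul hr h4 (abs_nonneg _) ((abs_nonneg _).trans hr)
      _ = L * B * n := by ring
      _ ≤ _ := by gcongr
  rw [quadForm_eq, hsum] at he
  have t1 := abs_add_le (∑ i, A i i * (clipSq M (e i) - r) + (r - s) * ∑ i, A i i)
    (∑ i, ∑ j, (if i = j then 0 else A i j) * (e i * e j))
  have t2 := abs_add_le (∑ i, A i i * (clipSq M (e i) - r)) ((r - s) * ∑ i, A i i)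
  linarith

end Tail

/-- Quadratic forms in i.i.d. variables with `4 + η` moments concentrate, with summable tails. -/
theorem exists_summable_tail_quadForm {ν : Measure ℝ} [IsProbabilityMeasure ν] {η : ℝ}
    (hη : 0 < η) (h : Integrable (fun e : ℝ => |e| ^ (4 + η)) ν) (hm : (∫ e, e ∂ν) = 0)
    {L δ : ℝ} (hL : 0 ≤ L) (hδ : 0 < δ) :
    ∃ b : ℕ → ℝ, Summable b ∧ (∀ n, 0 ≤ b n) ∧ ∀ (n : ℕ) (A : Matrix (Fin n) (Fin n) ℝ),
      (∀ i, ∑ j, A i j ^ 2 ≤ L ^ 2) →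
      (Measure.pi fun _ : Fin n => ν).real
        {e | δ * n ≤ |e ⬝ᵥ (A *ᵥ e) - (∫ e, e ^ 2 ∂ν) * A.trace|} ≤ b n := by
  have h4 := integrable_pow_four_of_rpow hη h
  have h2 : Integrable (fun e : ℝ => e ^ 2) ν :=
    integrable_pow_of_four measurable_id h4 (by norm_num)
  set m4 := ∫ e, e ^ 4 ∂ν with hm4
  set s := ∫ e, e ^ 2 ∂ν with hs
  set m := ∫ e, |e| ^ (4 + η) ∂ν with hmη
  have hm40 : 0 ≤ m4 := integral_nonneg fun e => by positivity
  have hs0 : 0 ≤ s := integral_nonneg fun e => sq_nonneg _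
  have hm0 : 0 ≤ m := integral_nonneg fun e => Real.rpow_nonneg (abs_nonneg e) _
  set D := s + m4 + 1 with hD
  have hD1 : 1 ≤ D := by linarith
  have hD4 : m4 ≤ D ^ 2 := by nlinarith
  -- Squares are clipped at `M = n^β`. Some square exceeds `M` with probability of order at most
  -- `n^(1 - β(2 + η/2))`, summable iff `β > 4/(4 + η)`; the clipped diagonal part contributes `n
  -- M²/n⁴ = n^(2β - 3)`, summable iff `β < 1`. The value chosen lies in between.
  set β : ℝ := 8 / (8 + η) with hβ
  have hβ0 : 0 < β := by positivity
  have hβ1 : β < 1 := by rw [hβ, div_lt_one (by linarith)]; linarith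
  have hβ2 : 1 - β * (2 + η / 2) < -1 := by
    have : β * (2 + η / 2) = 2 + 2 * η / (8 + η) := by rw [hβ]; field_simp; ring
    have : 0 < 2 * η / (8 + η) := by positivity
    linarith
  set C₁ := L ^ 4 * m4 * (4 / δ) ^ 4 with hC₁
  set C₂ := 3 * (L ^ 2 * m4) ^ 2 * (4 / δ) ^ 4 + 64 * D ^ 4 * (2 * L ^ 2) ^ 2 * (2 / δ) ^ 4 with hC₂
  set c : ℕ → ℝ := fun n => m * (n : ℝ) ^ (1 - β * (2 + η / 2)) + C₁ * (n : ℝ) ^ (2 * β - 3) +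
    C₂ * (n : ℝ) ^ (-2 : ℝ) with hc
  have hc0 : ∀ n, 0 ≤ c n := fun n => by positivity
  have hcs : Summable c := by
    refine (((Real.summable_nat_rpow.2 hβ2).mul_left m).add
      ((Real.summable_nat_rpow.2 (by linarith)).mul_left C₁)).add
      ((Real.summable_nat_rpow.2 (by norm_num)).mul_left C₂)
  have hev : ∀ᶠ n : ℕ in atTop, L * (m4 / (n : ℝ) ^ β) ≤ δ / 4 := by
    have : Tendsto (fun n : ℕ => L * (m4 / (n : ℝ) ^ β)) atTop (𝓝 (L * 0)) :=
      (tendsto_const_nhds.div_atTop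
        ((tendsto_rpow_atTop hβ0).comp tendsto_natCast_atTop_atTop)).const_mul L
    rw [mul_zero] at this
    exact this.eventually (ge_mem_nhds (by linarith))
  -- For `n ≤ N` the bias of clipping need not be small; those finitely many terms get the trivial
  -- bound `1`.
  obtain ⟨N, hN⟩ := eventually_atTop.1 hev
  refine ⟨fun n => c n + if n ∈ Finset.range (N + 1) then 1 else 0,
    hcs.add (summable_of_ne_finset_zero (s := Finset.range (N + 1)) fun n hn => if_neg hn),
    fun n => add_nonneg (hc0 n) (by split_ifs <;> norm_num), fun n A hA => ?_⟩
  by_cases hn : n ∈ Finset.range (N + 1)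
  · simp only [hn, if_true]
    exact measureReal_le_one.trans (by linarith [hc0 n])
  simp only [hn, if_false, add_zero]
  have hnN : N < n := by simpa using hn
  have hn0 : (0 : ℝ) < n := by exact_mod_cast (Nat.zero_le N).trans_lt hnN
  set M := (n : ℝ) ^ β with hM
  have hM0 : 0 < M := Real.rpow_pos_of_pos hn0 β
  have hd := abs_diag_le hL hA
  have hsub := quadForm_tail_subset (M := M) (abs_integral_clipSq_sub_le hM0 h4 h2) A hd
    (hN n hnN.le)
  refine (measureReal_mono hsub).trans ?_
  refine (measureReal_union_le _ _).trans ?_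
  have p1 := tail_max (n := n) hη h hM0
  have p2 := tail_diag hM0 h4 (fun i => A i i) hd (show 0 < δ / 4 * n by positivity)
  -- Off the diagonal each coordinate enters each monomial with degree at most one, so four moments
  -- suffice and nothing is clipped.
  have p3 := tail_offDiag h4 hm (show 0 ≤ D by linarith) (by linarith) hD4 hA
    (show 0 < δ / 2 * n by positivity)
  have p23 := (measureReal_union_le (μ := Measure.pi fun _ : Fin n => ν)
    {e | δ / 4 * n ≤ |∑ i, A i i * (clipSq M (e i) - ∫ e, clipSq M e ∂ν)|}
    {e | δ / 2 * n ≤ |∑ i, ∑ j, (if i = j then 0 else A i j) * (e i * e j)|})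
  refine (add_le_add p1 (p23.trans (add_le_add p2 p3))).trans (le_of_eq ?_)
  rw [← hm4, ← hmη]
  have e1 : n * (m / M ^ (2 + η / 2)) = m * (n : ℝ) ^ (1 - β * (2 + η / 2)) := by
    rw [hM, ← Real.rpow_mul hn0.le, Real.rpow_sub hn0, Real.rpow_one]
    ring
  have e2 : (n : ℝ) ^ (-2 : ℝ) = 1 / (n : ℝ) ^ 2 := by
    rw [Real.rpow_neg hn0.le, Real.rpow_two, one_div]
  have e3 : (n : ℝ) ^ (2 * β - 3) = M ^ 2 / (n : ℝ) ^ 3 := by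
    rw [Real.rpow_sub hn0, mul_comm 2 β, Real.rpow_mul hn0.le, ← hM]
    norm_cast
  simp only [hc]
  rw [e1, e2, e3, hC₁, hC₂]
  generalize (n : ℝ) ^ (1 - β * (2 + η / 2)) = z
  field_simp
  ring

/-! ### Measurability of matrix functions -/

section Measurability

variable {α : Type*} [MeasurableSpace α]

theorem measurable_matrix_mul {m n p : ℕ} {A : α → Matrix (Fin m) (Fin n) ℝ}
    {B : α → Matrix (Fin n) (Fin p) ℝ} (hA : ∀ i j, Measurable fun x => A x i j)
    (hB : ∀ i j, Measurable fun x => B x i j) (i : Fin m) (j : Fin p) :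
    Measurable fun x => (A x * B x) i j := by
  simp only [Matrix.mul_apply]
  exact Finset.measurable_fun_sum _ fun k _ => (hA i k).mul (hB k j)

/-- The inverse is `det⁻¹` times the adjugate, and this formula also covers singular matrices, where
both sides are `0`. -/
theorem measurable_matrix_inv {n : ℕ} {A : α → Matrix (Fin n) (Fin n) ℝ}
    (hA : ∀ i j, Measurable fun x => A x i j) (i j : Fin n) :
    Measurable fun x => (A x)⁻¹ i j := by
  have hA' : Measurable fun x (k : Fin n) (l : Fin n) => A x k l :=
    measurable_pi_lambda _ fun k => measurable_pi_lambda _ fun l => hA k l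
  have hof : Continuous fun M : Fin n → Fin n → ℝ => (Matrix.of M : Matrix (Fin n) (Fin n) ℝ) :=
    continuous_id
  have h1 : Measurable fun x => (A x).det :=
    (hof.matrix_det).measurable.comp hA'
  have h2 : Measurable fun x => (A x).adjugate i j :=
    (hof.matrix_adjugate.matrix_elem i j).measurable.comp hA'
  simp only [Matrix.inv_def, Ring.inverse_eq_inv', Matrix.smul_apply, smul_eq_mul]
  exact h1.inv.mul h2

theorem measurable_resolvent_gram {n p : ℕ} {A : α → Matrix (Fin n) (Fin p) ℝ}
    (hA : ∀ i j, Measurable fun x => A x i j) (l : ℝ) (i j : Fin n) :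
    Measurable fun x => resolvent (gram (A x)) l i j := by
  refine measurable_matrix_inv (fun i j => ?_) i j
  have h := measurable_matrix_mul hA (B := fun x => (A x)ᵀ) (fun i j => hA j i) i j
  simp only [gram, Matrix.add_apply, Matrix.smul_apply, smul_eq_mul]
  exact (h.const_mul _).add_const _

theorem measurable_whitened {X : Type v} [MeasurableSpace X] (PX : Measure X) {n p : ℕ}
    {φ : X → Fin p → ℝ} (hφ : Measurable φ) (i : Fin n) (j : Fin p) :
    Measurable fun x : Fin n → X => whitened PX φ x i j := by
  refine measurable_matrix_mul (A := fun x => featureMatrix φ x)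
    (B := fun _ => invSqrt (featureCov PX φ)) (fun i j => ?_) (fun i j => measurable_const) i j
  exact (measurable_pi_apply j).comp (hφ.comp (measurable_pi_apply i))

end Measurability

/-! ### Row norms of resolvents -/

theorem row_norm_eq_mulVec {n : ℕ} {B : Matrix (Fin n) (Fin n) ℝ} (hB : Bᵀ = B) (i : Fin n) :
    ∑ j, B i j ^ 2 = (B *ᵥ Pi.single i 1) ⬝ᵥ (B *ᵥ Pi.single i 1) := by
  rw [Matrix.mulVec_single_one, dotProduct]
  refine Finset.sum_congr rfl fun j _ => ?_
  rw [Matrix.col_apply, ← Matrix.transpose_apply B i j, hB, sq]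

/-- By symmetry a row is the image of a basis vector, so the contraction bound applies. The bound is
uniform in `W`, which lets the concentration estimate be used conditionally on the inputs. -/
theorem row_norm_resolvent_le {n p : ℕ} (W : Matrix (Fin n) (Fin p) ℝ) {l : ℝ} (hl : 0 < l)
    (i : Fin n) : ∑ j, resolvent (gram W) l i j ^ 2 ≤ (1 / l) ^ 2 := by
  rw [row_norm_eq_mulVec (resolvent_isSymm W l)]
  refine (resolvent_mulVec_dotProduct_le W hl _).trans (le_of_eq ?_)
  rw [single_one_dotProduct, Pi.single_eq_same, one_div, one_div, inv_pow]

theorem resolvent_sq_isSymm {n p : ℕ} (W : Matrix (Fin n) (Fin p) ℝ) (l : ℝ) :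
    (resolvent (gram W) l * resolvent (gram W) l)ᵀ =
      resolvent (gram W) l * resolvent (gram W) l := by
  rw [Matrix.transpose_mul, resolvent_isSymm]

theorem row_norm_resolvent_sq_le {n p : ℕ} (W : Matrix (Fin n) (Fin p) ℝ) {l : ℝ} (hl : 0 < l)
    (i : Fin n) :
    ∑ j, (resolvent (gram W) l * resolvent (gram W) l) i j ^ 2 ≤ (1 / l ^ 2) ^ 2 := by
  rw [row_norm_eq_mulVec (resolvent_sq_isSymm W l), ← Matrix.mulVec_mulVec]
  refine (resolvent_mulVec_dotProduct_le W hl _).trans ?_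
  have h := resolvent_mulVec_dotProduct_le W hl (Pi.single i 1)
  rw [single_one_dotProduct, Pi.single_eq_same] at h
  calc _ ≤ (1 / l ^ 2) / l ^ 2 := by gcongr
    _ = _ := by field_simp

theorem dotProduct_resolvent_sq {n p : ℕ} (W : Matrix (Fin n) (Fin p) ℝ) (l : ℝ)
    (e : Fin n → ℝ) : e ⬝ᵥ ((resolvent (gram W) l * resolvent (gram W) l) *ᵥ e) =
      (resolvent (gram W) l *ᵥ e) ⬝ᵥ (resolvent (gram W) l *ᵥ e) := by
  rw [mulVec_dotProduct_eq, resolvent_isSymm, Matrix.mulVec_mulVec]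

/-! ### Joint law of the inputs and the noise -/

/-- The sample law is the image of i.i.d. pairs (input, noise) under a coordinatewise map that `T`
undoes. Regrouping coordinates then shows that the noise vector is independent of all the inputs. -/
theorem map_noise_eq {Ω : Type u} [MeasurableSpace Ω] {μ : Measure Ω} {X : Type v}
    [MeasurableSpace X] {P : Measure (X × ℝ)} [IsProbabilityMeasure P] {n p : ℕ}
    {φ : X → Fin p → ℝ} (hφ : Measurable φ) {ν : Measure ℝ} [IsProbabilityMeasure ν]
    {βs : Fin p → ℝ} (hP : P = (P.fst.prod ν).map fun z => (z.1, linPred φ βs z.1 + z.2))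
    {x : Ω → Fin n → X} {y : Ω → Fin n → ℝ} (hx : Measurable x) (hy : Measurable y)
    (hlaw : μ.map (fun ω i => (x ω i, y ω i)) = Measure.pi fun _ => P) :
    μ.map (fun ω => (x ω, fun i => y ω i - linPred φ βs (x ω i))) =
      (Measure.pi fun _ : Fin n => P.fst).prod (Measure.pi fun _ : Fin n => ν) := by
  have hl := measurable_linPred hφ βs
  have hg : Measurable fun z : X × ℝ => (z.1, linPred φ βs z.1 + z.2) := by fun_prop
  have hxy : Measurable fun ω i => (x ω i, y ω i) :=
    measurable_pi_lambda _ fun i =>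
      ((measurable_pi_apply i).comp hx).prodMk ((measurable_pi_apply i).comp hy)
  set T : (Fin n → X × ℝ) → (Fin n → X) × (Fin n → ℝ) :=
    fun w => (fun i => (w i).1, fun i => (w i).2 - linPred φ βs (w i).1) with hT
  have hTm : Measurable T := by
    refine (measurable_pi_lambda _ fun i => (measurable_pi_apply i).fst).prodMk
      (measurable_pi_lambda _ fun i => ?_)
    exact (measurable_pi_apply i).snd.sub (hl.comp (measurable_pi_apply i).fst)
  have h1 : (fun ω => (x ω, fun i => y ω i - linPred φ βs (x ω i))) =
      T ∘ fun ω i => (x ω i, y ω i) := rfl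
  have h2 : (Measure.pi fun _ : Fin n => P) =
      (Measure.pi fun _ : Fin n => P.fst.prod ν).map
        fun w i => ((w i).1, linPred φ βs (w i).1 + (w i).2) := by
    rw [Measure.pi_map_pi (fun _ => hg.aemeasurable), ← hP]
  have hgn : Measurable fun (w : Fin n → X × ℝ) (i : Fin n) =>
      ((w i).1, linPred φ βs (w i).1 + (w i).2) :=
    measurable_pi_lambda _ fun i => hg.comp (measurable_pi_apply i)
  rw [h1, ← Measure.map_map hTm hxy, hlaw, h2, Measure.map_map hTm hgn,
    ← (measurePreserving_arrowProdEquivProdArrow X ℝ (Fin n) (fun _ => P.fst)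
      (fun _ => ν)).map_eq]
  congr 1
  funext w
  simp [hT, MeasurableEquiv.arrowProdEquivProdArrow, Equiv.arrowProdEquivProdArrow]

/-- The hypotheses on the noise and the linear model, with a chosen noise law and coefficients. -/
structure LinData {Ω : Type u} (S : ProblemSeq.{u, v} Ω) (σ : ℝ) (ν : Measure ℝ) (η : ℝ)
    (βs : ∀ k, Fin (S.p k) → ℝ) : Prop where
  prob : IsProbabilityMeasure ν
  pos : 0 < η
  moment : Integrable (fun e : ℝ => |e| ^ (4 + η)) ν
  mean : (∫ e, e ∂ν) = 0
  var : (∫ e, e ^ 2 ∂ν) = σ ^ 2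
  model : ∀ k, S.P k =
    ((S.P k).fst.prod ν).map fun z => (z.1, linPred (S.φ k) (βs k) z.1 + z.2)

theorem ProblemSeq.IsLin.exists_linData {Ω : Type u} {S : ProblemSeq.{u, v} Ω} {σ : ℝ}
    (h : S.IsLin σ) : ∃ ν η βs, LinData S σ ν η βs := by
  obtain ⟨ν, hν, ⟨η, hη, hi⟩, hm, hv, hk⟩ := h
  choose βs hβs using hk
  exact ⟨ν, η, βs, hν, hη, hi, hm, hv, hβs⟩

/-- The noise in the training labels. -/
def ProblemSeq.noise {Ω : Type u} (S : ProblemSeq.{u, v} Ω) (βs : ∀ k, Fin (S.p k) → ℝ) (k : ℕ)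
    (ω : Ω) (i : Fin (S.n k)) : ℝ :=
  S.y k ω i - linPred (S.φ k) (βs k) (S.x k ω i)

theorem LinData.integrable_four {Ω : Type u} {S : ProblemSeq.{u, v} Ω} {σ : ℝ}
    {ν : Measure ℝ} {η : ℝ} {βs : ∀ k, Fin (S.p k) → ℝ} (hL : LinData S σ ν η βs) :
    Integrable (fun e : ℝ => e ^ 4) ν := by
  have := hL.prob
  exact integrable_pow_four_of_rpow hL.pos hL.moment

theorem LinData.integrable_sq {Ω : Type u} {S : ProblemSeq.{u, v} Ω} {σ : ℝ}
    {ν : Measure ℝ} {η : ℝ} {βs : ∀ k, Fin (S.p k) → ℝ} (hL : LinData S σ ν η βs) : Integrable (fun e : ℝ => e ^ 2) ν := by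
  have := hL.prob
  exact integrable_pow_of_four measurable_id hL.integrable_four (by norm_num)

theorem LinData.integrable_id {Ω : Type u} {S : ProblemSeq.{u, v} Ω} {σ : ℝ}
    {ν : Measure ℝ} {η : ℝ} {βs : ∀ k, Fin (S.p k) → ℝ} (hL : LinData S σ ν η βs) : Integrable (fun e : ℝ => e) ν := by
  have := hL.prob
  simpa using integrable_pow_of_four (i := 1) measurable_id hL.integrable_four (by norm_num)

/-! ### Almost sure limits of quadratic forms in the noise -/

section Convergence

variable {Ω : Type u} [MeasurableSpace Ω] {μ : Measure Ω} {S : ProblemSeq.{u, v} Ω} {σ : ℝ}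
  {ν : Measure ℝ} {η : ℝ} {βs : ∀ k, Fin (S.p k) → ℝ}

theorem LinData.map_noise (hL : LinData S σ ν η βs) (hS : S.IsSampled μ) (k : ℕ) :
    μ.map (fun ω => (S.x k ω, S.noise βs k ω)) =
      (Measure.pi fun _ : Fin (S.n k) => (S.P k).fst).prod
        (Measure.pi fun _ : Fin (S.n k) => ν) := by
  have := hL.prob
  have := hS.isProb k
  exact map_noise_eq (hS.measurable_φ k) (hL.model k) (hS.measurable_x k) (hS.measurable_y k)
    (hS.law k)

theorem ProblemSeq.IsSampled.measurable_x_noise (hS : S.IsSampled μ)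
    (βs : ∀ k, Fin (S.p k) → ℝ) (k : ℕ) : Measurable fun ω => (S.x k ω, S.noise βs k ω) := by
  refine (hS.measurable_x k).prodMk (measurable_pi_lambda _ fun i => ?_)
  exact ((measurable_pi_apply i).comp (hS.measurable_y k)).sub
    ((measurable_linPred (hS.measurable_φ k) (βs k)).comp
      ((measurable_pi_apply i).comp (hS.measurable_x k)))

theorem LinData.minExcess_eq (hL : LinData S σ ν η βs) (hS : S.IsSampled μ) (τ : ℝ) (k : ℕ)
    (ω : Ω) : S.minExcess σ τ k ω = minNormSq (S.W k ω) (S.noise βs k ω) (τ * σ ^ 2) := by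
  have := hL.prob
  have := hS.isProb k
  exact minExcessLoss_eq_minNormSq (hS.measurable_φ k) (hS.memLp_φ k) (hS.posDef k)
    hL.integrable_id hL.integrable_sq hL.mean hL.var (hL.model k) _ _ _

/-- Almost sure concentration of quadratic forms in the noise. -/
theorem LinData.ae_tendsto_quadForm (hL : LinData S σ ν η βs) (hS : S.IsSampled μ)
    (hn : StrictMono S.n) {L : ℝ} (hL0 : 0 ≤ L)
    (A : ∀ k, (Fin (S.n k) → S.X k) → Matrix (Fin (S.n k)) (Fin (S.n k)) ℝ)
    (hAm : ∀ k i j, Measurable fun x => A k x i j)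
    (hA : ∀ k x i, ∑ j, A k x i j ^ 2 ≤ L ^ 2) :
    ∀ᵐ ω ∂μ, Tendsto (fun k => (1 / (S.n k : ℝ)) *
      (S.noise βs k ω ⬝ᵥ (A k (S.x k ω) *ᵥ S.noise βs k ω)) -
        σ ^ 2 * ((1 / (S.n k : ℝ)) * (A k (S.x k ω)).trace)) atTop (𝓝 0) := by
  have := hL.prob
  have key : ∀ m : ℕ, ∀ᵐ ω ∂μ, ∀ᶠ k in atTop, ω ∉ {ω | (1 / ((m : ℝ) + 1)) * (S.n k : ℝ) ≤
      |S.noise βs k ω ⬝ᵥ (A k (S.x k ω) *ᵥ S.noise βs k ω) -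
        σ ^ 2 * (A k (S.x k ω)).trace|} := by
    intro m
    obtain ⟨b, hbs, hb0, hb⟩ := exists_summable_tail_quadForm hL.pos hL.moment hL.mean hL0
      (show 0 < 1 / ((m : ℝ) + 1) by positivity)
    -- First Borel–Cantelli lemma, valid for arbitrary dependence between stages. As `n` is strictly
    -- increasing, the bounds `b (S.n k)` form a subfamily of a summable one.
    refine ae_eventually_notMem ?_
    refine ne_top_of_le_ne_top (hbs.comp_injective hn.injective).tsum_ofReal_ne_top
      (ENNReal.tsum_le_tsum fun k => ?_)
    have := hS.isProb k
    set D : Set ((Fin (S.n k) → S.X k) × (Fin (S.n k) → ℝ)) :=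
      {z | (1 / ((m : ℝ) + 1)) * (S.n k : ℝ) ≤
        |z.2 ⬝ᵥ (A k z.1 *ᵥ z.2) - σ ^ 2 * (A k z.1).trace|} with hD
    have hDm : MeasurableSet D := by
      refine measurableSet_le measurable_const ?_
      have h1 : Measurable fun z : (Fin (S.n k) → S.X k) × (Fin (S.n k) → ℝ) =>
          z.2 ⬝ᵥ (A k z.1 *ᵥ z.2) := by
        simp only [dotProduct, Matrix.mulVec]
        refine Finset.measurable_fun_sum _ fun i _ => ?_
        refine ((measurable_pi_apply i).comp measurable_snd).mul ?_
        refine Finset.measurable_fun_sum _ fun j _ => ?_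
        exact ((hAm k i j).comp measurable_fst).mul ((measurable_pi_apply j).comp measurable_snd)
      have h2 : Measurable fun z : (Fin (S.n k) → S.X k) × (Fin (S.n k) → ℝ) =>
          (A k z.1).trace := by
        simp only [Matrix.trace, Matrix.diag_apply]
        exact Finset.measurable_fun_sum _ fun i _ => (hAm k i i).comp measurable_fst
      exact (h1.sub (h2.const_mul _)).abs
    have hpre : {ω | (1 / ((m : ℝ) + 1)) * (S.n k : ℝ) ≤
        |S.noise βs k ω ⬝ᵥ (A k (S.x k ω) *ᵥ S.noise βs k ω) -
          σ ^ 2 * (A k (S.x k ω)).trace|} = (fun ω => (S.x k ω, S.noise βs k ω)) ⁻¹' D := rfl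
    rw [hpre, ← Measure.map_apply (hS.measurable_x_noise βs k) hDm, hL.map_noise hS k,
      Measure.prod_apply hDm]
    -- For fixed inputs the matrix is deterministic, and the tail bound does not depend on which
    -- matrix it is.
    calc ∫⁻ x, (Measure.pi fun _ : Fin (S.n k) => ν) (Prod.mk x ⁻¹' D)
          ∂(Measure.pi fun _ : Fin (S.n k) => (S.P k).fst)
        ≤ ∫⁻ _, ENNReal.ofReal (b (S.n k)) ∂(Measure.pi fun _ : Fin (S.n k) => (S.P k).fst) := by
          refine lintegral_mono fun x => ?_
          rw [← ofReal_measureReal]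
          refine ENNReal.ofReal_le_ofReal ?_
          have := hb (S.n k) (A k x) (hA k x)
          rw [hL.var] at this
          exact this
      _ = _ := by simp
  filter_upwards [ae_all_iff.2 key] with ω hω
  rw [Metric.tendsto_atTop']
  intro ε hε
  obtain ⟨m, hm⟩ := exists_nat_one_div_lt hε
  obtain ⟨N, hN⟩ := eventually_atTop.1 (hω m)
  refine ⟨N, fun k hk => ?_⟩
  have h1 := hN k hk.le
  simp only [not_le] at h1
  have hnk : (0 : ℝ) < S.n k := by
    exact_mod_cast (Nat.zero_le _).trans_lt (hn hk)
  rw [Real.dist_eq, sub_zero]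
  refine lt_trans ?_ hm
  have e : (1 / (S.n k : ℝ)) * (S.noise βs k ω ⬝ᵥ (A k (S.x k ω) *ᵥ S.noise βs k ω)) -
      σ ^ 2 * ((1 / (S.n k : ℝ)) * (A k (S.x k ω)).trace) = (1 / (S.n k : ℝ)) *
      (S.noise βs k ω ⬝ᵥ (A k (S.x k ω) *ᵥ S.noise βs k ω) -
        σ ^ 2 * (A k (S.x k ω)).trace) := by ring
  rw [e, abs_mul, abs_of_pos (by positivity), one_div_mul_eq_div, div_lt_iff₀ hnk]
  exact h1

/-- The bounded continuous function `s ↦ (|s| + l)⁻¹ ^ j`. -/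
def invPowBCF (l : ℝ) (hl : 0 < l) (j : ℕ) : ℝ →ᵇ ℝ :=
  BoundedContinuousFunction.ofNormedAddCommGroup (fun s => ((|s| + l)⁻¹) ^ j)
    ((Continuous.inv₀ (by fun_prop) fun s => by positivity).pow j) (l⁻¹ ^ j) fun s => by
      rw [Real.norm_of_nonneg (pow_nonneg (inv_abs_add_nonneg hl s) j)]
      exact pow_le_pow_left₀ (inv_abs_add_nonneg hl s) (inv_abs_add_le hl s) j

theorem integral_invPow_spectralDistribution {n p : ℕ} (W : Matrix (Fin n) (Fin p) ℝ) {l : ℝ}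
    (hl : 0 < l) (j : ℕ) : ∫ s, invPowBCF l hl j s ∂(spectralDistribution W) =
      (1 / n : ℝ) * ∑ i, ((gramEigenvalues W i + l)⁻¹) ^ j := by
  rw [integral_spectralDistribution]
  congr 1
  refine Finset.sum_congr rfl fun i _ => ?_
  simp [invPowBCF, abs_of_nonneg (gramEigenvalues_nonneg W i)]

variable {γ : ℝ}

theorem LinData.ae_tendsto_resolvent (hL : LinData S σ ν η βs) (hS : S.IsSampled μ)
    (hM : S.IsMP μ γ) {l : ℝ} (hl : 0 < l) :
    ∀ᵐ ω ∂μ, Tendsto (fun k => (1 / (S.n k : ℝ)) *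
      (S.noise βs k ω ⬝ᵥ (resolvent (gram (S.W k ω)) l *ᵥ S.noise βs k ω))) atTop
        (𝓝 (σ ^ 2 * mpStieltjes γ l)) := by
  have h := hL.ae_tendsto_quadForm hS hM.n_strictMono (L := 1 / l) (by positivity)
    (fun k x => resolvent (gram (whitened (S.P k).fst (S.φ k) x)) l)
    (fun k => measurable_resolvent_gram (measurable_whitened _ (hS.measurable_φ k)) l)
    (fun k x => row_norm_resolvent_le _ hl)
  filter_upwards [h, hM.weak] with ω h1 h2
  have h3 := h2 (invPowBCF l hl 1)
  have h4 : ∫ s, invPowBCF l hl 1 s ∂(marchenkoPastur γ) = mpStieltjes γ l := by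
    simp [invPowBCF, mpStieltjes]
  rw [h4] at h3
  have h5 := h1.add (h3.const_mul (σ ^ 2))
  rw [zero_add] at h5
  refine h5.congr fun k => ?_
  rw [integral_invPow_spectralDistribution, trace_resolvent _ hl]
  simp only [pow_one, ProblemSeq.W]
  ring

theorem LinData.ae_tendsto_resolvent_sq (hL : LinData S σ ν η βs) (hS : S.IsSampled μ)
    (hM : S.IsMP μ γ) {l : ℝ} (hl : 0 < l) :
    ∀ᵐ ω ∂μ, Tendsto (fun k => (1 / (S.n k : ℝ)) *
      ((resolvent (gram (S.W k ω)) l *ᵥ S.noise βs k ω) ⬝ᵥ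
        (resolvent (gram (S.W k ω)) l *ᵥ S.noise βs k ω))) atTop
        (𝓝 (σ ^ 2 * mpStieltjesSq γ l)) := by
  have hm : ∀ k i j, Measurable fun x : Fin (S.n k) → S.X k =>
      resolvent (gram (whitened (S.P k).fst (S.φ k) x)) l i j := fun k =>
    measurable_resolvent_gram (measurable_whitened _ (hS.measurable_φ k)) l
  have h := hL.ae_tendsto_quadForm hS hM.n_strictMono (L := 1 / l ^ 2) (by positivity)
    (fun k x => resolvent (gram (whitened (S.P k).fst (S.φ k) x)) l *
      resolvent (gram (whitened (S.P k).fst (S.φ k) x)) l)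
    (fun k => measurable_matrix_mul (hm k) (hm k))
    (fun k x => row_norm_resolvent_sq_le _ hl)
  filter_upwards [h, hM.weak] with ω h1 h2
  have h3 := h2 (invPowBCF l hl 2)
  have h4 : ∫ s, invPowBCF l hl 2 s ∂(marchenkoPastur γ) = mpStieltjesSq γ l := by
    simp [invPowBCF, mpStieltjesSq]
  rw [h4] at h3
  have h5 := h1.add (h3.const_mul (σ ^ 2))
  rw [zero_add] at h5
  refine h5.congr fun k => ?_
  rw [integral_invPow_spectralDistribution, trace_resolvent_sq _ hl, dotProduct_resolvent_sq]
  simp only [ProblemSeq.W]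
  ring

theorem LinData.ae_tendsto_noise_sq (hL : LinData S σ ν η βs) (hS : S.IsSampled μ)
    (hn : StrictMono S.n) :
    ∀ᵐ ω ∂μ, Tendsto (fun k => (1 / (S.n k : ℝ)) *
      (S.noise βs k ω ⬝ᵥ S.noise βs k ω)) atTop (𝓝 (σ ^ 2)) := by
  have h := hL.ae_tendsto_quadForm hS hn (L := 1) zero_le_one (fun k x => 1)
    (fun k i j => measurable_const) (fun k x i => by simp [Matrix.one_apply])
  filter_upwards [h] with ω h1
  have h5 := h1.add_const (σ ^ 2)
  rw [zero_add] at h5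
  refine h5.congr' ?_
  filter_upwards [eventually_gt_atTop 0] with k hk
  have hnk : (0 : ℝ) < S.n k := by
    exact_mod_cast (Nat.zero_le _).trans_lt (hn hk)
  simp only [Matrix.one_mulVec, Matrix.trace_one, Fintype.card_fin]
  field_simp
  ring

theorem LinData.ae_noise_eq_zero (hL : LinData S σ ν η βs) (hS : S.IsSampled μ) (hσ : σ = 0) :
    ∀ᵐ ω ∂μ, ∀ k, S.noise βs k ω = 0 := by
  have := hL.prob
  refine ae_all_iff.2 fun k => ?_
  have := hS.isProb k
  have h0 : ∀ᵐ e ∂ν, e = 0 := by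
    have h := hL.var
    rw [hσ, zero_pow two_ne_zero, integral_eq_zero_iff_of_nonneg (fun e => sq_nonneg e)
      hL.integrable_sq] at h
    filter_upwards [h] with e he
    exact pow_eq_zero_iff two_ne_zero |>.1 he
  have h1 : ∀ᵐ e ∂(Measure.pi fun _ : Fin (S.n k) => ν), e = 0 := by
    have : ∀ᵐ e ∂(Measure.pi fun _ : Fin (S.n k) => ν), ∀ i, e i = 0 :=
      ae_all_iff.2 fun i => (Measure.quasiMeasurePreserving_eval (fun _ => ν) i).ae h0
    filter_upwards [this] with e he
    exact funext he
  have h2 : ∀ᵐ z ∂((Measure.pi fun _ : Fin (S.n k) => (S.P k).fst).prod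
      (Measure.pi fun _ : Fin (S.n k) => ν)), z.2 = 0 :=
    Measure.quasiMeasurePreserving_snd.ae h1
  rw [← hL.map_noise hS k] at h2
  exact ae_of_ae_map (hS.measurable_x_noise βs k).aemeasurable h2

end Convergence

/-! ### Limits of the minimal excess error -/

section Limits

variable {Ω : Type u} [MeasurableSpace Ω] {μ : Measure Ω} {S : ProblemSeq.{u, v} Ω} {σ : ℝ}
  {ν : Measure ℝ} {η : ℝ} {βs : ∀ k, Fin (S.p k) → ℝ} {γ : ℝ}

theorem ProblemSeq.IsMP.eventually_pos (hM : S.IsMP μ γ) :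
    ∀ᶠ k in atTop, 0 < S.n k ∧ 0 < S.p k := by
  filter_upwards [eventually_gt_atTop 0, hM.p_tendsto.eventually_gt_atTop 0] with k hk hp
  exact ⟨(Nat.zero_le _).trans_lt (hM.n_strictMono hk), hp⟩

/-- The lower limit of the minimal excess errors is at least the dual value. -/
theorem LinData.ae_limitExcess_le_liminf (hL : LinData S σ ν η βs) (hS : S.IsSampled μ)
    (hM : S.IsMP μ γ) (τ : ℝ) :
    ∀ᵐ ω ∂μ, limitExcess σ τ γ ≤ liminf (fun k => S.minExcess σ τ k ω) atTop := by
  set f : Set.Ioi (0 : ℝ) → ℝ≥0∞ := fun l =>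
    ENNReal.ofReal (γ * (σ ^ 2 * mpStieltjes γ l - τ * σ ^ 2 / l)) with hf
  have : Nonempty (Set.Ioi (0 : ℝ)) := ⟨⟨1, Set.mem_Ioi.2 one_pos⟩⟩
  -- The null set depends on `l`, so the supremum over all `l > 0` is first replaced by a maximising
  -- sequence.
  obtain ⟨u, -, hu, hmem⟩ := exists_seq_tendsto_sSup (Set.range_nonempty f)
    (OrderTop.bddAbove _)
  choose l hl using hmem
  have h : ∀ m, ∀ᵐ ω ∂μ, u m ≤ liminf (fun k => S.minExcess σ τ k ω) atTop := by
    intro m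
    have hl0 : (0 : ℝ) < l m := (l m).2
    filter_upwards [hL.ae_tendsto_resolvent hS hM hl0] with ω hω
    have h1 := ENNReal.tendsto_ofReal (hM.ratio.mul (hω.sub_const (τ * σ ^ 2 / l m)))
    rw [← hl m, hf]
    simp only
    rw [← h1.liminf_eq]
    refine liminf_le_liminf ?_
    filter_upwards [hM.eventually_pos] with k hk
    rw [hL.minExcess_eq hS]
    exact le_minNormSq hk.1 hk.2 _ _ _ hl0
  filter_upwards [ae_all_iff.2 h] with ω hω
  exact le_of_tendsto' hu hω

/-- A ridge parameter with small enough limiting training error bounds the upper limit. -/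
theorem LinData.ae_limsup_le_ridge (hL : LinData S σ ν η βs) (hS : S.IsSampled μ)
    (hM : S.IsMP μ γ) (hσ : σ ≠ 0) {τ l : ℝ} (hl : 0 < l) (hT : mpTrain γ l < τ) :
    ∀ᵐ ω ∂μ, limsup (fun k => S.minExcess σ τ k ω) atTop ≤
      ENNReal.ofReal (γ * (σ ^ 2 * mpStieltjes γ l - l * (σ ^ 2 * mpStieltjesSq γ l))) := by
  filter_upwards [hL.ae_tendsto_resolvent hS hM hl, hL.ae_tendsto_resolvent_sq hS hM hl]
    with ω h1 h2
  have h3 := ENNReal.tendsto_ofReal (hM.ratio.mul (h1.sub (h2.const_mul l)))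
  rw [← h3.limsup_eq]
  refine limsup_le_limsup ?_
  -- Strictness in the limit makes the ridge solution feasible for all large `k`.
  have h4 : l ^ 2 * (σ ^ 2 * mpStieltjesSq γ l) < τ * σ ^ 2 := by
    have : 0 < σ ^ 2 := by positivity
    calc l ^ 2 * (σ ^ 2 * mpStieltjesSq γ l) = mpTrain γ l * σ ^ 2 := by rw [mpTrain]; ring
      _ < τ * σ ^ 2 := by gcongr
  filter_upwards [hM.eventually_pos, (h2.const_mul (l ^ 2)).eventually (gt_mem_nhds h4)]
    with k hk hk2
  rw [hL.minExcess_eq hS]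
  exact minNormSq_le_ridge hk.1 hk.2 _ _ _ hl hk2.le

/-- The ridge bound exceeds the dual value at the same `l` by `γσ² (τ - mpTrain γ l)/l`, which
`exists_mpTrain_lt` makes arbitrarily small. -/
theorem LinData.ae_limsup_le_limitExcess (hL : LinData S σ ν η βs) (hS : S.IsSampled μ)
    (hM : S.IsMP μ γ) (hσ : σ ≠ 0) (hγ : 0 < γ) {τ : ℝ} (h1 : max (1 - 1 / γ) 0 < τ)
    (h2 : τ ≤ 1) :
    ∀ᵐ ω ∂μ, limsup (fun k => S.minExcess σ τ k ω) atTop ≤ limitExcess σ τ γ := by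
  have h : ∀ m : ℕ, ∀ᵐ ω ∂μ, limsup (fun k => S.minExcess σ τ k ω) atTop ≤
      limitExcess σ τ γ + ENNReal.ofReal (γ * σ ^ 2 * (1 / ((m : ℝ) + 1))) := by
    intro m
    obtain ⟨l, hl, hT, hd⟩ := exists_mpTrain_lt hγ h1 h2 (show 0 < 1 / ((m : ℝ) + 1) by positivity)
    filter_upwards [hL.ae_limsup_le_ridge hS hM hσ hl hT] with ω hω
    refine hω.trans (le_trans ?_ (add_le_add_left (le_limitExcess σ τ γ hl) _))
    refine le_trans (ENNReal.ofReal_le_ofReal ?_) ENNReal.ofReal_add_le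
    have e : γ * (σ ^ 2 * mpStieltjes γ l - l * (σ ^ 2 * mpStieltjesSq γ l)) =
        γ * (σ ^ 2 * mpStieltjes γ l - τ * σ ^ 2 / l) +
          γ * σ ^ 2 * ((τ - mpTrain γ l) / l) := by
      rw [mpTrain]
      field_simp
      ring
    rw [e]
    gcongr
  filter_upwards [ae_all_iff.2 h] with ω hω
  have ht : Tendsto (fun m : ℕ => limitExcess σ τ γ +
      ENNReal.ofReal (γ * σ ^ 2 * (1 / ((m : ℝ) + 1)))) atTop
      (𝓝 (limitExcess σ τ γ + ENNReal.ofReal (γ * σ ^ 2 * 0))) :=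
    tendsto_const_nhds.add (ENNReal.tendsto_ofReal
      (tendsto_one_div_add_atTop_nhds_zero_nat.const_mul _))
  simp only [mul_zero, ENNReal.ofReal_zero, add_zero] at ht
  exact ge_of_tendsto' ht hω

/-- Ridge solutions generally do not interpolate, so the exact interpolant is compared with the
resolvent at `l = 1/(m + 1)`, at a cost of order `l/c²`. The constant `c` depends on `ω`, hence the
limits for all `m` are secured on one event before `c` is chosen. -/
theorem LinData.ae_limsup_le_of_spectrumBoundedBelow (hL : LinData S σ ν η βs)
    (hS : S.IsSampled μ) (hM : S.IsMP μ γ) (hB : S.SpectrumBoundedBelow μ) :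
    ∀ᵐ ω ∂μ, limsup (fun k => S.minExcess σ 0 k ω) atTop ≤ limitExcess σ 0 γ := by
  have h : ∀ m : ℕ, ∀ᵐ ω ∂μ, Tendsto (fun k => (1 / (S.n k : ℝ)) *
      (S.noise βs k ω ⬝ᵥ (resolvent (gram (S.W k ω)) (1 / ((m : ℝ) + 1)) *ᵥ S.noise βs k ω))) atTop
        (𝓝 (σ ^ 2 * mpStieltjes γ (1 / ((m : ℝ) + 1)))) := fun m =>
    hL.ae_tendsto_resolvent hS hM (by positivity)
  filter_upwards [ae_all_iff.2 h, hL.ae_tendsto_noise_sq hS hM.n_strictMono, hB]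
    with ω h1 h2 ⟨c, hc, hB⟩
  have h3 : ∀ m : ℕ, limsup (fun k => S.minExcess σ 0 k ω) atTop ≤ limitExcess σ 0 γ +
      ENNReal.ofReal (γ * ((1 / ((m : ℝ) + 1)) / c ^ 2 * σ ^ 2)) := by
    intro m
    have hl : 0 < 1 / ((m : ℝ) + 1) := by positivity
    have h4 := ENNReal.tendsto_ofReal (hM.ratio.mul
      ((h1 m).add (h2.const_mul ((1 / ((m : ℝ) + 1)) / c ^ 2))))
    have h5 : limsup (fun k => S.minExcess σ 0 k ω) atTop ≤ ENNReal.ofReal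
        (γ * (σ ^ 2 * mpStieltjes γ (1 / ((m : ℝ) + 1)) +
          (1 / ((m : ℝ) + 1)) / c ^ 2 * σ ^ 2)) := by
      rw [← h4.limsup_eq]
      refine limsup_le_limsup ?_
      filter_upwards [hM.eventually_pos, hB] with k hk hBk
      rw [hL.minExcess_eq hS]
      exact minNormSq_le_interpolation hk.1 hk.2 _ _ (by simp) hl hc
        (le_dotProduct_gram_of_le_eigenvalues _ hBk)
    refine h5.trans (le_trans ?_ (add_le_add_left (le_limitExcess σ 0 γ hl) _))
    refine le_trans (ENNReal.ofReal_le_ofReal (le_of_eq ?_)) ENNReal.ofReal_add_le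
    ring
  have ht : Tendsto (fun m : ℕ => limitExcess σ 0 γ +
      ENNReal.ofReal (γ * ((1 / ((m : ℝ) + 1)) / c ^ 2 * σ ^ 2))) atTop
      (𝓝 (limitExcess σ 0 γ + ENNReal.ofReal (γ * (0 / c ^ 2 * σ ^ 2)))) :=
    tendsto_const_nhds.add (ENNReal.tendsto_ofReal
      (((tendsto_one_div_add_atTop_nhds_zero_nat.div_const _).mul_const _).const_mul _))
  simp only [zero_div, zero_mul, mul_zero, ENNReal.ofReal_zero, add_zero] at ht
  exact ge_of_tendsto' ht h3

theorem LinData.ae_minExcess_eq_zero (hL : LinData S σ ν η βs) (hS : S.IsSampled μ)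
    (hσ : σ = 0) (τ : ℝ) : ∀ᵐ ω ∂μ, ∀ k, S.minExcess σ τ k ω = 0 := by
  filter_upwards [hL.ae_noise_eq_zero hS hσ] with ω hω k
  rw [hL.minExcess_eq hS, hω k, hσ]
  refine le_antisymm ((iInf₂_le 0 (by simp)).trans (by simp)) bot_le

end Limits

/-! ### Existence of the limit in all regimes -/

theorem isLimitingMinExcess_limitExcess (σ : ℝ) :
    IsLimitingMinExcess.{u, v} σ (limitExcess σ) := by
  refine ⟨?_, fun τ _ γ hγ => tendsto_limitExcess_right σ τ hγ⟩
  intro τ hτ γ hγ hb Ω _ μ _ S hS hLin hM hB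
  obtain ⟨ν, η, βs, hL⟩ := hLin.exists_linData
  have hlow := hL.ae_limitExcess_le_liminf hS hM τ
  suffices hup : ∀ᵐ ω ∂μ, limsup (fun k => S.minExcess σ τ k ω) atTop ≤ limitExcess σ τ γ by
    filter_upwards [hlow, hup] with ω h1 h2
    exact tendsto_of_le_liminf_of_limsup_le h1 h2
  by_cases hσ : σ = 0
  · filter_upwards [hL.ae_minExcess_eq_zero hS hσ τ] with ω hω
    simp [hω]
  have htop : limitExcess σ τ γ = ∞ →
      ∀ᵐ ω ∂μ, limsup (fun k => S.minExcess σ τ k ω) atTop ≤ limitExcess σ τ γ := by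
    intro h
    rw [h]
    exact ae_of_all _ fun ω => le_top
  -- In the first two cases the dual value is infinite and the upper bound is vacuous; equality is
  -- allowed only at `τ = 0`, hence `γ = 1`.
  rcases lt_trichotomy τ (1 - 1 / γ) with h | h | h
  · exact htop (limitExcess_eq_top_of_lt hσ hγ h)
  · have h0 := hb h
    have h1 : γ = 1 := by
      rw [h0] at h
      field_simp at h
      linarith
    exact htop (by rw [h0, h1]; exact limitExcess_zero_one_eq_top hσ)
  · rcases hτ.1.eq_or_lt with h0 | h0
    · subst h0
      have h1 : γ < 1 := by
        have : 1 < 1 / γ := by linarith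
        rwa [lt_div_iff₀ hγ, one_mul] at this
      exact hL.ae_limsup_le_of_spectrumBoundedBelow hS hM (hB rfl h1)
    · exact hL.ae_limsup_le_limitExcess hS hM hσ hγ (max_lt h h0) hτ.2

end MPRegression

end

/-! ### The lower bound and its tightness -/

theorem mainTheorem3 (σ : ℝ) :
    ∃ E : ℝ → ℝ → ℝ≥0∞, MPRegression.IsLimitingMinExcess.{u, v} σ E ∧
      ∀ τ ∈ Set.Icc (0 : ℝ) 1,
        -- the lower bound for the limit
        (∀ γ : ℝ, 0 < γ → ENNReal.ofReal (σ ^ 2 * γ * (1 - Real.sqrt τ) ^ 2) ≤ E τ γ) ∧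
        -- the same bound for the lower limit, whether or not the limit exists
        (∀ γ : ℝ, 0 < γ →
          ∀ (Ω : Type u) [MeasurableSpace Ω] (μ : Measure Ω) [IsProbabilityMeasure μ]
            (S : MPRegression.ProblemSeq.{u, v} Ω), S.IsSampled μ → S.IsLin σ → S.IsMP μ γ →
            ∀ᵐ ω ∂μ, ENNReal.ofReal (σ ^ 2 * γ * (1 - Real.sqrt τ) ^ 2) ≤
              liminf (fun k => S.minExcess σ τ k ω) atTop) ∧
        -- tightness
        (⨅ γ : Set.Ioi (0 : ℝ), E τ γ / ENNReal.ofReal γ) =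
          ENNReal.ofReal (σ ^ 2 * (1 - Real.sqrt τ) ^ 2) ∧
        Tendsto (fun γ => E τ γ / ENNReal.ofReal γ) (𝓝[>] 0)
          (𝓝 (ENNReal.ofReal (σ ^ 2 * (1 - Real.sqrt τ) ^ 2))) := by
  refine ⟨MPRegression.limitExcess σ, MPRegression.isLimitingMinExcess_limitExcess σ,
    fun τ hτ => ⟨fun γ hγ => MPRegression.le_limitExcess_bound σ hτ hγ, ?_,
      MPRegression.iInf_limitExcess_div σ hτ, MPRegression.tendsto_limitExcess_div σ hτ⟩⟩
  intro γ hγ Ω _ μ _ S hS hLin hM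
  obtain ⟨ν, η, βs, hL⟩ := hLin.exists_linData
  filter_upwards [hL.ae_limitExcess_le_liminf hS hM τ] with ω hω
  exact (MPRegression.le_limitExcess_bound σ hτ hγ).trans hω
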